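/- **Setting.** Write $x=(x_1,x_2,z)\in\mathbb T^3$ (unit torus), $\nabla=(\partial_{x_1},\partial_{x_2})$, $v^\perp=(-v_2,v_1)$. For $v\in L^2(\mathbb T^3;\mathbb R^2)$ with Fourier coefficients $\hat v_k$, $k\in\mathbb Z^3$, let $A=\sqrt{-(\Delta+\partial_{zz})}$ and, for $\tau,r\ge 0$, $$\|e^{\tau A}v\|_{H^r}^2=\sum_{k\in\mathbb Z^3}\bigl(1+|k|^{2r}e^{2\tau|k|}\bigr)|\hat v_k|^2,\qquad \mathcal D(e^{\tau A}:H^r)=\{v\in L^2:\|e^{\tau A}v\|_{H^r}<\infty\}.$$ Let $P_0v(x_1,x_2)=\int_0^1 v(x_1,x_2,s)\,ds$, let $\mathbb P_hF=F-\nabla\Delta^{-1}\nabla\cdot F$ be the two-dimensional Leray projection of fields $F(x_1,x_2)$ ($\Delta=\partial_{x_1x_1}+\partial_{x_2x_2}$, $\Delta^{-1}$ with zero mean), and let $\mathcal S$ be the space of $v\in L^2(\mathbb T^3;\mathbb R^2)$ with $\int_{\mathbb T^3}v=0$ and $\nabla\cdot P_0v=0$. For $\Omega\in\mathbb R$ consider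 the barotropic/baroclinic form of the inviscid primitive equations for pairs $(\overline v,\widetilde v)$ with $\overline v(t),\widetilde v(t)\in\mathcal S$ even in $z$, $P_0\overline v=\overline v$ and $P_0\widetilde v=0$: $$\partial_t\overline v+\mathbb P_h(\overline v\cdot\nabla\overline v)+\mathbb P_hP_0\bigl((\nabla\cdot\widetilde v)\widetilde v+\widetilde v\cdot\nabla\widetilde v\bigr)=0,$$ $$\partial_t\widetilde v+\widetilde v\cdot\nabla\widetilde v+\widetilde v\cdot\nabla\overline v+\overline v\cdot\nabla\widetilde v-P_0\bigl(\widetilde v\cdot\nabla\widetilde v+(\nabla\cdot\widetilde v)\widetilde v\bigr)-\Bigl(\int_0^z\nabla\cdot\widetilde v(x_1,x_2,s)\,ds\Bigr)\partial_z\widetilde v+\Omega\widetilde v^\perp=0,$$ with $(\overline v,\widetilde v)|_{t=0}=(\overline v_0,\widetilde v_0)$; the equations are understood as identities in $L^2(\mathbb T^3)$, integrated in time from $0$ to $t$. **Theorem.** Let $r>5/2$. There is a constant $C_r>0$, depending only on $r$, with the following properties. (1) Let $\tau_0>0$ and let $\overline v_0,\widetilde v_0\in\mathcal S\cap\mathcal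 D(e^{\tau_0A}:H^r)$ be even in $z$ with $P_0\overline v_0=\overline v_0$, $P_0\widetilde v_0=0$. Put $E=\|e^{\tau_0A}\overline v_0\|_{H^r}^2+\|e^{\tau_0A}\widetilde v_0\|_{H^r}^2$ and $$\mathcal T=\frac{\tau_0}{1+2C_r(1+E)}>0,\qquad \tau(t)=\tau_0-2tC_r(1+E).$$ Then for every $\Omega\in\mathbb R$ there is exactly one solution on $[0,\mathcal T]$ with $$\overline v,\widetilde v\in L^\infty\bigl(0,\mathcal T;\mathcal D(e^{\tau(t)A}:H^r)\bigr)\cap L^2\bigl(0,\mathcal T;\mathcal D(e^{\tau(t)A}:H^{r+1/2})\bigr).$$ In particular $\mathcal T$ and $\tau(t)$ do not depend on $\Omega$. (2) (Continuous dependence.) For $i=1,2$ let $((\overline v_0)_i,(\widetilde v_0)_i)$ be data as in (1) with radius $\tau_{i0}>0$ and size $E_i$, and let $(\overline v_i,\widetilde v_i)$ be the corresponding solutions from (1), for the same $\Omega$. Let $\tau_0=\min\{\tau_{10},\tau_{20}\}$, $M=\max\{E_1,E_2\}$, $\widetilde\tau(t)=\tau_0-2tC_r(1+M)$ and $\widetilde{\mathcal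 T}=\tau_0/(1+2C_r(1+M))$. Then for all $t\in[0,\widetilde{\mathcal T}]$ $$\|e^{\widetilde\tau(t)A}(\overline v_1-\overline v_2)(t)\|_{H^{r-1/2}}^2+\|e^{\widetilde\tau(t)A}(\widetilde v_1-\widetilde v_2)(t)\|_{H^{r-1/2}}^2\le\|e^{\tau_0A}((\overline v_0)_1-(\overline v_0)_2)\|_{H^{r-1/2}}^2+\|e^{\tau_0A}((\widetilde v_0)_1-(\widetilde v_0)_2)\|_{H^{r-1/2}}^2.$$ -/

import Mathlib

open MeasureTheory Set
open scoped ENNReal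

noncomputable section

namespace InviscidPE

/-- The three-dimensional torus `𝕋³` of unit length; a point is `x = (x₁, x₂, z)`, with the
coordinates indexed by `0, 1, 2`. -/
abbrev Torus3 : Type := UnitAddTorus (Fin 3)

/-- Two-component (horizontal) real vector fields on `𝕋³`. -/
abbrev VField : Type := Torus3 → Fin 2 → ℝ

/-- Lebesgue measure on `𝕋³`, of total mass one (the measure used by `UnitAddTorus.mFourierCoeff`).
-/
def vol3 : Measure Torus3 := Measure.pi fun _ => AddCircle.haarAddCircle

/-! ### Fourier coefficients and analytic norms -/

/-- The Fourier coefficient `∫ e^{-2πi k·x} v_i(x) dx` of the `i`-th component of `v`. -/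
def fcoeff (v : VField) (i : Fin 2) (k : Fin 3 → ℤ) : ℂ :=
  UnitAddTorus.mFourierCoeff (fun x => ((v x i : ℝ) : ℂ)) k

/-- The Euclidean length `|k|` of a frequency. -/
def freqNorm (k : Fin 3 → ℤ) : ℝ := Real.sqrt (∑ j, (k j : ℝ) ^ 2)

/-- The squared norm
`‖e^{τA} v‖²_{H^r} = ∑_k (1 + |k|^{2r} e^{2τ|k|}) |v̂_k|²`, with values in `[0, ∞]`. -/
def anormSq (τ r : ℝ) (v : VField) : ℝ≥0∞ :=
  ∑' k : Fin 3 → ℤ, ENNReal.ofReal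
    ((1 + freqNorm k ^ (2 * r) * Real.exp (2 * τ * freqNorm k)) * ∑ i, ‖fcoeff v i k‖ ^ 2)

/-- Membership in `𝒟(e^{τA} : H^r(𝕋³))`. -/
def MemAnalytic (τ r : ℝ) (v : VField) : Prop :=
  MemLp v 2 vol3 ∧ anormSq τ r v < ⊤

/-! ### Differential and integral operators -/

/-- The partial derivative in the `j`-th coordinate of a function on `𝕋³`. -/
def pderiv (j : Fin 3) (f : Torus3 → ℝ) (x : Torus3) : ℝ :=
  deriv (fun h : ℝ => f (x + Pi.single j (h : UnitAddCircle))) 0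

/-- The horizontal divergence `∇ · v = ∂₁ v₁ + ∂₂ v₂`. -/
def hdiv (v : VField) (x : Torus3) : ℝ :=
  pderiv 0 (fun y => v y 0) x + pderiv 1 (fun y => v y 1) x

/-- The horizontal advection `u · ∇ v = u₁ ∂₁ v + u₂ ∂₂ v`. -/
def advect (u v : VField) : VField := fun x i =>
  u x 0 * pderiv 0 (fun y => v y i) x + u x 1 * pderiv 1 (fun y => v y i) x

/-- The barotropic projection `P₀ v (x', z) = ∫₀¹ v(x', s) ds`. -/
def P0 (v : VField) : VField := fun x i =>
  ∫ s : UnitAddCircle, v (Function.update x 2 s) i ∂AddCircle.haarAddCircle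

/-- The vertical primitive `∫₀^z f(x', s) ds`, where `z` is represented in `[0, 1)`. -/
def vprim (f : Torus3 → ℝ) (x : Torus3) : ℝ :=
  ∫ s in (0 : ℝ)..(AddCircle.equivIco (1 : ℝ) 0 (x 2) : ℝ),
    f (Function.update x 2 (s : UnitAddCircle))

/-- The rotation `v^⊥ = (-v₂, v₁)`. -/
def perp (v : VField) : VField := fun x => ![-(v x 1), v x 0]

/-- The inverse `Δ⁻¹ q` of the horizontal Laplacian on functions `q` of `(x₁, x₂)`: the mean-free
solution of `Δ p = q - ∫ q`, i.e. `p = - ∑_{(k₁,k₂) ≠ 0} q̂_k / (4π² (k₁² + k₂²)) e^{2πi k·x}`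
(the term with `k₁ = k₂ = 0` vanishes because division by zero gives zero). -/
def invLaplacian (q : Torus3 → ℝ) (x : Torus3) : ℝ :=
  (∑' k : Fin 3 → ℤ,
    -(UnitAddTorus.mFourierCoeff (fun y => ((q y : ℝ) : ℂ)) k /
        (4 * (Real.pi : ℂ) ^ 2 * ((k 0 : ℂ) ^ 2 + (k 1 : ℂ) ^ 2))) *
      UnitAddTorus.mFourier k x).re

/-- The two-dimensional Leray projection `ℙ_h F = F - ∇ Δ⁻¹ ∇·F`. -/
def leray (F : VField) : VField := fun x =>
  ![F x 0 - pderiv 0 (invLaplacian (hdiv F)) x, F x 1 - pderiv 1 (invLaplacian (hdiv F)) x]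

/-- `(∇·w) w + w·∇w`. -/
def selfFlux (w : VField) : VField := fun x i => hdiv w x * w x i + advect w w x i

/-- The barotropic equation reads `∂ₜ v̄ + barotropicTerm v̄ ṽ = 0`:
`ℙ_h(v̄·∇v̄) + ℙ_h P₀((∇·ṽ)ṽ + ṽ·∇ṽ)`. -/
def barotropicTerm (vb vt : VField) : VField :=
  leray (advect vb vb) + leray (P0 (selfFlux vt))

/-- The baroclinic equation reads `∂ₜ ṽ + baroclinicTerm Ω v̄ ṽ = 0`:
`ṽ·∇ṽ + ṽ·∇v̄ + v̄·∇ṽ - P₀(ṽ·∇ṽ + (∇·ṽ)ṽ) - (∫₀^z ∇·ṽ ds) ∂_z ṽ + Ω ṽ^⊥`. -/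
def baroclinicTerm (Ω : ℝ) (vb vt : VField) : VField := fun x i =>
  advect vt vt x i + advect vt vb x i + advect vb vt x i - P0 (selfFlux vt) x i
    - vprim (hdiv vt) x * pderiv 2 (fun y => vt y i) x + Ω * perp vt x i

/-! ### Admissible states -/

/-- The space `𝒮`: square integrable mean-free fields `v` with `∇ · P₀ v = 0` in the sense of
distributions (tested against the exponentials). -/
structure MemS (v : VField) : Prop where
  memLp : MemLp v 2 vol3
  mean_zero : ∀ i, ∫ x, v x i ∂vol3 = 0
  div_free : ∀ k : Fin 3 → ℤ,
    (k 0 : ℂ) * fcoeff (P0 v) 0 k + (k 1 : ℂ) * fcoeff (P0 v) 1 k = 0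

/-- Evenness in the vertical variable `z`. -/
def EvenInZ (v : VField) : Prop :=
  (fun x : Torus3 => v (Function.update x 2 (-(x 2)))) =ᵐ[vol3] v

/-- A pair `(v̄, ṽ)` in `𝒮`, even in `z`, consisting of a barotropic and a baroclinic mode:
`P₀ v̄ = v̄` and `P₀ ṽ = 0`; equivalently `v̄ = P₀ v` and `ṽ = (I - P₀) v` with `v = v̄ + ṽ`. -/
structure IsModePair (vb vt : VField) : Prop where
  memS_bar : MemS vb
  memS_tilde : MemS vt
  even_bar : EvenInZ vb
  even_tilde : EvenInZ vt
  P0_bar : P0 vb =ᵐ[vol3] vb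
  P0_tilde : P0 vt =ᵐ[vol3] 0

/-- Admissible initial data of analyticity radius `τ₀`. -/
structure IsData (r τ₀ : ℝ) (vb₀ vt₀ : VField) : Prop where
  modes : IsModePair vb₀ vt₀
  analytic_bar : MemAnalytic τ₀ r vb₀
  analytic_tilde : MemAnalytic τ₀ r vt₀

/-! ### Solutions -/

/-- The `L²` inner product of vector fields. -/
def innerL2 (u v : VField) : ℝ := ∫ x, ∑ i, u x i * v x i ∂vol3

/-- `∂ₜ u + F = 0` on `[0, T]` as an identity in `L²(𝕋³)`:
`u(t) - u(0) + ∫₀ᵗ F(s) ds = 0` for all `t ∈ [0, T]`, after taking the inner product with an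
arbitrary `φ ∈ L²(𝕋³)`. -/
def EvolvesBy (T : ℝ) (u F : ℝ → VField) : Prop :=
  ∀ φ : VField, MemLp φ 2 vol3 →
    IntervalIntegrable (fun s => innerL2 (F s) φ) volume 0 T ∧
    ∀ t ∈ Icc 0 T,
      innerL2 (u t) φ - innerL2 (u 0) φ + ∫ s in (0 : ℝ)..t, innerL2 (F s) φ = 0

/-- `(v̄, ṽ)` solves the barotropic/baroclinic system on `[0, T]` with initial data `(v̄₀, ṽ₀)`.
The elements of `L²(𝕋³)` which occur as values of the solution are represented by continuous
functions. -/
structure IsSolution (Ω T : ℝ) (vb₀ vt₀ : VField) (vb vt : ℝ → VField) : Prop where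
  cont_bar : ∀ t ∈ Icc 0 T, Continuous (vb t)
  cont_tilde : ∀ t ∈ Icc 0 T, Continuous (vt t)
  modes : ∀ t ∈ Icc 0 T, IsModePair (vb t) (vt t)
  init_bar : vb 0 =ᵐ[vol3] vb₀
  init_tilde : vt 0 =ᵐ[vol3] vt₀
  barotropic : EvolvesBy T vb fun t => barotropicTerm (vb t) (vt t)
  baroclinic : EvolvesBy T vt fun t => baroclinicTerm Ω (vb t) (vt t)

/-- `u ∈ L^∞(0,T; 𝒟(e^{τ(t)A} : H^r)) ∩ L²(0,T; 𝒟(e^{τ(t)A} : H^{r+1/2}))`. -/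
def InAnalyticClass (r T : ℝ) (τ : ℝ → ℝ) (u : ℝ → VField) : Prop :=
  (∃ K : ℝ, ∀ᵐ t ∂(volume.restrict (Icc 0 T)), anormSq (τ t) r (u t) ≤ ENNReal.ofReal K) ∧
    ∫⁻ t in Icc 0 T, anormSq (τ t) (r + 1 / 2) (u t) < ⊤

/-- `‖e^{τ₀A} v̄₀‖²_{H^r} + ‖e^{τ₀A} ṽ₀‖²_{H^r}`. -/
def dataSize (r τ₀ : ℝ) (vb₀ vt₀ : VField) : ℝ :=
  (anormSq τ₀ r vb₀).toReal + (anormSq τ₀ r vt₀).toReal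

/-- The existence time `τ₀ / (1 + 2C(1 + E))`. -/
def existTime (C τ₀ E : ℝ) : ℝ := τ₀ / (1 + 2 * C * (1 + E))

/-- The radius of analyticity `τ₀ - 2tC(1 + E)`. -/
def radius (C τ₀ E : ℝ) (t : ℝ) : ℝ := τ₀ - 2 * t * C * (1 + E)

/-- `(v̄, ṽ)` is a solution on `[0, 𝒯]` in the class of the theorem, where `𝒯` and `τ(t)` are
given by the initial data, their radius `τ₀`, and the constant `C`. -/
structure IsAnalyticSolution (C r Ω τ₀ : ℝ) (vb₀ vt₀ : VField) (vb vt : ℝ → VField) : Prop where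
  solves : IsSolution Ω (existTime C τ₀ (dataSize r τ₀ vb₀ vt₀)) vb₀ vt₀ vb vt
  class_bar : InAnalyticClass r (existTime C τ₀ (dataSize r τ₀ vb₀ vt₀))
    (radius C τ₀ (dataSize r τ₀ vb₀ vt₀)) vb
  class_tilde : InAnalyticClass r (existTime C τ₀ (dataSize r τ₀ vb₀ vt₀))
    (radius C τ₀ (dataSize r τ₀ vb₀ vt₀)) vt

end InviscidPE

end

open InviscidPE

open MeasureTheory Set
open scoped ENNReal

namespace InviscidPE

/-! ### Frequencies -/

/-! The two modes occupy disjoint sets of vertical frequencies (k₃ = 0 for the barotropic one, k₃ ≠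
0 for the baroclinic one), so the pair is equivalent to the single coefficient family c = v̄^ + ṽ^.
On these coefficients both equations merge into one quadratic system c_k' = -P_k N(c, c)_k - Ω J_k
c_k, with P_k the Leray projection at k₃ = 0 and J_k the rotation at k₃ ≠ 0.

Only one loss has to be compensated. The vertical velocity costs a derivative, so the symbol of N is
bounded only by |j||l|, a derivative on each factor. Since |k| ≤ |j| + |l|, one of j, l has size at
least |k|/2; hence |k|^{r-1} cancels one of the factors |j|^{1-r}, |l|^{1-r} and the other is square
summable over ℤ³ because 2(r-1) > 3. Thus N maps H^r × H^r to H^{r-1}, also with the weight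
e^{σ|k|}, which is submultiplicative: `exists_conv_bound`, `WeightedBound.nonlin_le`.

A radius shrinking with slope L recovers this derivative, as |k| ∫₀ᵗ e^{-L(t-s)|k|} ds ≤ 1/L. In the
space ℓ² over frequencies of suprema in time, the Duhamel operator therefore has norm of order 1/L,
and it is a contraction as soon as L dominates the size of the data (`exists_modeSolution`). The
rotation enters through a group bounded uniformly in Ω, so nothing depends on Ω. The construction
uses slope C(1+E), half the slope in the theorem; the other half yields the L² bound in H^{r+1/2}
(`inAnalyticClass_of_weightedBound`).

For the difference of two solutions, the shrinking radius produces -2ℓ times the squared H^r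
quantity in the derivative of the H^{r-1/2} energy. The nonlinear part is paired as H^r against
H^{r-1} and is bounded by a multiple of the same quantity, and the rotation is skew. So the energy
decreases once ℓ dominates the two solutions: `exists_energy_bound`. Applied on short time intervals
this also gives uniqueness among all uniformly exponentially decaying mode solutions
(`modeSolution_unique`).

The transfer to physical space rests on functions with exponentially decaying Fourier coefficients
(`Rep`), which are stable under every operation in the equations. Any solution in the analytic class
has such coefficients at all times, hence its modes solve the system and it coincides with the
constructed solution. It thereby inherits a square summable majorant of size 4√E uniform in time,
which is what continuous dependence needs. Reality and evenness of the constructed solution follow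
from uniqueness, since conjugation and reflection preserve the mode system. -/

/-- Frequencies of the three-dimensional torus. -/
abbrev Freq : Type := Fin 3 → ℤ

theorem freqNorm_eq_norm (k : Freq) :
    freqNorm k = ‖(WithLp.toLp 2 (fun j => (k j : ℝ)) : EuclideanSpace ℝ (Fin 3))‖ := by
  simp [EuclideanSpace.norm_eq, freqNorm]

theorem freqNorm_nonneg (k : Freq) : 0 ≤ freqNorm k := Real.sqrt_nonneg _

@[simp] theorem freqNorm_zero : freqNorm 0 = 0 := by simp [freqNorm]

@[simp] theorem freqNorm_neg (k : Freq) : freqNorm (-k) = freqNorm k := by simp [freqNorm]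

theorem freqNorm_add_le (j l : Freq) : freqNorm (j + l) ≤ freqNorm j + freqNorm l := by
  simp only [freqNorm_eq_norm]
  refine le_trans (le_of_eq ?_) (norm_add_le _ _)
  congr 1
  ext i
  simp

theorem freqNorm_le_add_sub (j k : Freq) : freqNorm k ≤ freqNorm j + freqNorm (k - j) := by
  simpa using freqNorm_add_le j (k - j)

theorem abs_le_freqNorm (k : Freq) (i : Fin 3) : |(k i : ℝ)| ≤ freqNorm k := by
  rw [freqNorm, ← Real.sqrt_sq_eq_abs]
  exact Real.sqrt_le_sqrt
    (Finset.single_le_sum (f := fun j => (k j : ℝ) ^ 2) (fun j _ => sq_nonneg _) (Finset.mem_univ i))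

theorem norm_intCast_le_freqNorm (k : Freq) (i : Fin 3) : ‖(k i : ℂ)‖ ≤ freqNorm k := by
  rw [Complex.norm_intCast]
  exact abs_le_freqNorm k i

theorem one_le_freqNorm {k : Freq} (hk : k ≠ 0) : 1 ≤ freqNorm k := by
  obtain ⟨i, hi⟩ := Function.ne_iff.mp hk
  have h : (1 : ℤ) ≤ |k i| := Int.one_le_abs hi
  have : (1 : ℝ) ≤ |(k i : ℝ)| := by exact_mod_cast h
  exact this.trans (abs_le_freqNorm k i)

theorem freqNorm_pos {k : Freq} (hk : k ≠ 0) : 0 < freqNorm k :=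
  zero_lt_one.trans_le (one_le_freqNorm hk)

/-- Comparison with the summability of powers over a lattice of rank 3. The lattice carries the sup
norm, which is smaller than |k|, and the exponent is negative, so the comparison goes the right way.
-/
theorem summable_freqNorm_rpow {p : ℝ} (hp : p < -3) : Summable fun k : Freq => freqNorm k ^ p := by
  let b := Pi.basisFun ℝ (Fin 3)
  let L : Submodule ℤ (Fin 3 → ℝ) := Submodule.span ℤ (range b)
  have hrank : Module.finrank ℤ L = 3 := by
    rw [ZLattice.rank ℝ L]; simp
  have hs := ZLattice.summable_norm_rpow L p (by rw [hrank]; exact_mod_cast hp)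
  have hmem : ∀ k : Freq, (fun j => (k j : ℝ)) ∈ L := by
    intro k
    have : (fun j => (k j : ℝ)) = ∑ j, (k j) • b j := by
      ext i
      simp [b, Pi.single_apply, Finset.sum_apply]
    rw [this]
    exact Submodule.sum_mem _ fun j _ =>
      Submodule.smul_mem _ _ (Submodule.subset_span (mem_range_self j))
  let φ : Freq → L := fun k => ⟨fun j => (k j : ℝ), hmem k⟩
  have hφ : Function.Injective φ := by
    intro k l h
    ext j
    have : (k j : ℝ) = l j := congrFun (congrArg Subtype.val h) j
    exact_mod_cast this
  refine (hs.comp_injective hφ).of_nonneg_of_le (fun k => Real.rpow_nonneg (freqNorm_nonneg k) _)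
    fun k => ?_
  by_cases hk : k = 0
  · subst hk
    have : φ 0 = 0 := by ext j; simp [φ]
    simp [this]
  · have h1 : ‖φ k‖ ≤ freqNorm k := by
      change ‖(fun j => (k j : ℝ))‖ ≤ _
      rw [pi_norm_le_iff_of_nonneg (freqNorm_nonneg k)]
      intro i
      exact abs_le_freqNorm k i
    have h2 : 0 < ‖φ k‖ := by
      rw [norm_pos_iff]
      intro h
      refine hk (hφ (h.trans ?_))
      ext j; simp [φ]
    exact Real.rpow_le_rpow_of_nonpos h2 h1 (by linarith)

theorem pow_mul_exp_neg_le {ρ : ℝ} (hρ : 0 < ρ) (m : ℕ) :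
    ∃ K : ℝ, 0 ≤ K ∧ ∀ x : ℝ, 0 ≤ x → x ^ m * Real.exp (-ρ * x) ≤ K := by
  refine ⟨m.factorial / ρ ^ m, by positivity, fun x hx => ?_⟩
  have h := Real.pow_div_factorial_le_exp (ρ * x) (by positivity) m
  rw [neg_mul, Real.exp_neg, ← div_eq_mul_inv, div_le_div_iff₀ (Real.exp_pos _) (by positivity)]
  rw [div_le_iff₀ (by positivity), mul_pow] at h
  linarith

theorem summable_exp_neg_freqNorm {ρ : ℝ} (hρ : 0 < ρ) :
    Summable fun k : Freq => Real.exp (-ρ * freqNorm k) := by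
  obtain ⟨K, hK, h⟩ := pow_mul_exp_neg_le hρ 4
  have hs : Summable fun k : Freq => K * freqNorm k ^ (-4 : ℝ) :=
    (summable_freqNorm_rpow (by norm_num)).mul_left K
  have h0 : Summable fun k : Freq => K * freqNorm k ^ (-4 : ℝ) + if k = 0 then 1 else 0 :=
    hs.add (summable_of_ne_finset_zero (s := {0}) fun k hk => by simp at hk; simp [hk])
  refine h0.of_nonneg_of_le (fun k => (Real.exp_pos _).le) fun k => ?_
  by_cases hk : k = 0
  · subst hk
    simp
  · have hn := freqNorm_pos hk
    have h4 := h _ hn.le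
    have : freqNorm k ^ (-4 : ℝ) = (freqNorm k ^ 4)⁻¹ := by
      rw [Real.rpow_neg hn.le]; norm_cast
    rw [if_neg hk, add_zero, this, ← div_eq_mul_inv, le_div_iff₀ (by positivity)]
    linarith

/-! ### A weighted convolution estimate -/

theorem ENNReal_tsum_mul_sq_le {ι : Type*} (f g : ι → ℝ≥0∞) :
    (∑' i, f i * g i) ^ 2 ≤ (∑' i, f i ^ 2) * ∑' i, g i ^ 2 := by
  let _ : MeasurableSpace ι := ⊤
  have h := ENNReal.lintegral_mul_le_Lp_mul_Lq (Measure.count : Measure ι)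
    (Real.HolderConjugate.two_two) (f := f) (g := g) measurable_from_top.aemeasurable
    measurable_from_top.aemeasurable
  simp only [lintegral_count, Pi.mul_apply] at h
  calc (∑' i, f i * g i) ^ 2
      ≤ ((∑' i, f i ^ (2 : ℝ)) ^ (1 / 2 : ℝ) * (∑' i, g i ^ (2 : ℝ)) ^ (1 / 2 : ℝ)) ^ 2 := by
        gcongr
    _ = _ := by
      rw [mul_pow]
      simp only [← ENNReal.rpow_natCast, ← ENNReal.rpow_mul]
      norm_num

/-- The convolution majorant `∑_j |j|^{1-r} |k-j|^{1-r} A_j B_{k-j}`. -/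
noncomputable def convMaj (r : ℝ) (A B : Freq → ℝ≥0∞) (k : Freq) : ℝ≥0∞ :=
  ∑' j, ENNReal.ofReal (freqNorm j ^ (1 - r)) * ENNReal.ofReal (freqNorm (k - j) ^ (1 - r)) *
    (A j * B (k - j))

/-- Of j and k - j the larger has length at least |k|/2, so its negative power absorbs |k|^{r-1} up
to 2^{r-1}. The sum on the right covers both cases. -/
theorem rpow_weight_le {r : ℝ} (hr : 1 < r) (j k : Freq) :
    freqNorm k ^ (r - 1) * (freqNorm j ^ (1 - r) * freqNorm (k - j) ^ (1 - r)) ≤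
      2 ^ (r - 1) * (freqNorm j ^ (1 - r) + freqNorm (k - j) ^ (1 - r)) := by
  have key : ∀ a b c : ℝ, 0 ≤ a → a ≤ b → 0 ≤ c → c ≤ a + b →
      c ^ (r - 1) * (a ^ (1 - r) * b ^ (1 - r)) ≤ 2 ^ (r - 1) * (a ^ (1 - r) + b ^ (1 - r)) := by
    intro a b c ha hab hc hcab
    have hb := ha.trans hab
    have h1 : c ^ (r - 1) ≤ 2 ^ (r - 1) * b ^ (r - 1) := by
      rw [← Real.mul_rpow (by norm_num) hb]
      exact Real.rpow_le_rpow hc (by linarith) (by linarith)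
    have h2 : b ^ (r - 1) * b ^ (1 - r) ≤ 1 := by
      rcases hb.eq_or_lt with h | h
      · rw [← h, Real.zero_rpow (by linarith)]; simp
      · rw [← Real.rpow_add h]; simp
    have ha' := Real.rpow_nonneg ha (1 - r)
    have hb' := Real.rpow_nonneg hb (1 - r)
    have h2' : (0 : ℝ) < 2 ^ (r - 1) := by positivity
    calc c ^ (r - 1) * (a ^ (1 - r) * b ^ (1 - r))
        ≤ 2 ^ (r - 1) * b ^ (r - 1) * (a ^ (1 - r) * b ^ (1 - r)) := by gcongr
      _ = 2 ^ (r - 1) * a ^ (1 - r) * (b ^ (r - 1) * b ^ (1 - r)) := by ring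
      _ ≤ 2 ^ (r - 1) * a ^ (1 - r) * 1 := by gcongr
      _ ≤ _ := by rw [mul_one, mul_add]; nlinarith
  have hk := freqNorm_le_add_sub j k
  rcases le_total (freqNorm j) (freqNorm (k - j)) with h | h
  · exact key _ _ _ (freqNorm_nonneg _) h (freqNorm_nonneg _) hk
  · have := key _ _ _ (freqNorm_nonneg _) h (freqNorm_nonneg k) (by linarith)
    rwa [mul_comm (freqNorm j ^ (1 - r)), add_comm (freqNorm j ^ (1 - r))]

theorem ENNReal_add_sq_le (a b : ℝ≥0∞) : (a + b) ^ 2 ≤ 2 * (a ^ 2 + b ^ 2) := by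
  have h := ENNReal.rpow_add_le_mul_rpow_add_rpow a b (p := 2) (by norm_num)
  norm_num at h
  exact h

/-- Square summability of the weighted convolution of square summable sequences. -/
theorem exists_conv_bound {r : ℝ} (hr : 5 / 2 < r) :
    ∃ C : ℝ, 0 < C ∧ ∀ A B : Freq → ℝ≥0∞,
      ∑' k, (ENNReal.ofReal (freqNorm k ^ (r - 1)) * convMaj r A B k) ^ 2 ≤
        ENNReal.ofReal C * ((∑' k, A k ^ 2) * ∑' k, B k ^ 2) := by
  -- The only place where the size of r is essential: 2 - 2r < -3 is the condition r > 5/2.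
  have hsum : Summable fun k : Freq => freqNorm k ^ (2 - 2 * r) :=
    summable_freqNorm_rpow (by linarith)
  set S : ℝ := ∑' k : Freq, freqNorm k ^ (2 - 2 * r) with hS
  have hS0 : 0 ≤ S := tsum_nonneg fun k => Real.rpow_nonneg (freqNorm_nonneg k) _
  have hSe : ∑' k : Freq, ENNReal.ofReal (freqNorm k ^ (1 - r)) ^ 2 = ENNReal.ofReal S := by
    rw [hS, ENNReal.ofReal_tsum_of_nonneg
      (fun k => Real.rpow_nonneg (freqNorm_nonneg k) _) hsum]
    refine tsum_congr fun k => ?_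
    rw [← ENNReal.ofReal_pow (Real.rpow_nonneg (freqNorm_nonneg k) _), ← Real.rpow_natCast,
      ← Real.rpow_mul (freqNorm_nonneg k)]
    congr 2
    push_cast
    ring
  set c : ℝ := 2 ^ (r - 1) with hc
  have hc0 : 0 < c := by positivity
  refine ⟨c ^ 2 * (4 * S) + 1, by positivity, fun A B => ?_⟩
  set h : Freq → ℝ≥0∞ := fun j => ENNReal.ofReal (freqNorm j ^ (1 - r)) with hh
  have h1 : ∀ k, (ENNReal.ofReal (freqNorm k ^ (r - 1)) * convMaj r A B k) ^ 2 ≤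
      ENNReal.ofReal (c ^ 2 * (4 * S)) * ∑' j, A j ^ 2 * B (k - j) ^ 2 := by
    intro k
    -- Once one negative power is absorbed, the Cauchy–Schwarz inequality in j puts the other one in
    -- ℓ² and leaves the convolution of A² and B², whose sum over k factorizes.
    have h2 : ENNReal.ofReal (freqNorm k ^ (r - 1)) * convMaj r A B k ≤
        ENNReal.ofReal c * ∑' j, (h j + h (k - j)) * (A j * B (k - j)) := by
      rw [convMaj, ← ENNReal.tsum_mul_left, ← ENNReal.tsum_mul_left]
      refine ENNReal.tsum_le_tsum fun j => ?_
      rw [← mul_assoc, ← mul_assoc (ENNReal.ofReal c)]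
      refine mul_le_mul_left ?_ _
      rw [hh]
      have e1 := Real.rpow_nonneg (freqNorm_nonneg j) (1 - r)
      have e2 := Real.rpow_nonneg (freqNorm_nonneg (k - j)) (1 - r)
      have e3 := Real.rpow_nonneg (freqNorm_nonneg k) (r - 1)
      rw [← ENNReal.ofReal_mul e1, ← ENNReal.ofReal_mul e3, ← ENNReal.ofReal_add e1 e2,
        ← ENNReal.ofReal_mul hc0.le]
      exact ENNReal.ofReal_le_ofReal (rpow_weight_le (by linarith) j k)
    have h3 : ∑' j, (h j + h (k - j)) ^ 2 ≤ ENNReal.ofReal (4 * S) := by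
      calc ∑' j, (h j + h (k - j)) ^ 2 ≤ ∑' j, 2 * (h j ^ 2 + h (k - j) ^ 2) :=
            ENNReal.tsum_le_tsum fun j => ENNReal_add_sq_le _ _
        _ = 2 * (ENNReal.ofReal S + ENNReal.ofReal S) := by
            rw [ENNReal.tsum_mul_left, ENNReal.tsum_add, hSe,
              show ∑' a, h (k - a) ^ 2 = ∑' j, h j ^ 2 from
                (Equiv.subLeft k).tsum_eq (fun j => h j ^ 2), hSe]
        _ = ENNReal.ofReal (4 * S) := by
            rw [← ENNReal.ofReal_add hS0 hS0, show (2 : ℝ≥0∞) = ENNReal.ofReal 2 by simp,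
              ← ENNReal.ofReal_mul (by norm_num)]
            congr 1; ring
    calc _ ≤ (ENNReal.ofReal c * ∑' j, (h j + h (k - j)) * (A j * B (k - j))) ^ 2 := by gcongr
      _ ≤ ENNReal.ofReal c ^ 2 * ((∑' j, (h j + h (k - j)) ^ 2) *
            ∑' j, (A j * B (k - j)) ^ 2) := by
          rw [mul_pow]
          gcongr
          exact ENNReal_tsum_mul_sq_le _ _
      _ ≤ ENNReal.ofReal c ^ 2 * (ENNReal.ofReal (4 * S) * ∑' j, (A j * B (k - j)) ^ 2) := by gcongr
      _ = _ := by
          rw [← mul_assoc, ← ENNReal.ofReal_pow hc0.le, ← ENNReal.ofReal_mul (by positivity)]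
          simp_rw [mul_pow]
  calc _ ≤ ∑' k, ENNReal.ofReal (c ^ 2 * (4 * S)) * ∑' j, A j ^ 2 * B (k - j) ^ 2 :=
        ENNReal.tsum_le_tsum h1
    _ = ENNReal.ofReal (c ^ 2 * (4 * S)) * ((∑' k, A k ^ 2) * ∑' k, B k ^ 2) := by
        rw [ENNReal.tsum_mul_left, ENNReal.tsum_comm]
        congr 1
        rw [← ENNReal.tsum_mul_right]
        refine tsum_congr fun j => ?_
        rw [ENNReal.tsum_mul_left, show ∑' i, B (i - j) ^ 2 = ∑' l, B l ^ 2 from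
          (Equiv.subRight j).tsum_eq (fun l => B l ^ 2)]
    _ ≤ _ := by gcongr; linarith


/-! ### The quadratic term on Fourier coefficients -/

/-- Families of Fourier coefficients of two-component vector fields. -/
abbrev Coef : Type := Freq → Fin 2 → ℂ

/-- The symbol of `u · ∇ - (∫₀^z ∇ · u) ∂_z` up to the factor `2πi`, for a velocity of frequency `j`
acting on a field of frequency `l`. For `j 2 = 0` the vertical part vanishes because division by
zero gives zero. -/
noncomputable def transportSymbol (j l : Freq) (u : Fin 2 → ℂ) : ℂ :=
  u 0 * l 0 + u 1 * l 1 - (j 0 * u 0 + j 1 * u 1) / j 2 * l 2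

/-- Fourier coefficients of the transport term `u · ∇ v - (∫₀^z ∇ · u) ∂_z v`. -/
noncomputable def transportCoef (u v : Coef) (k : Freq) : Fin 2 → ℂ := fun i =>
  2 * Real.pi * Complex.I * ∑' j, transportSymbol j (k - j) (u j) * v (k - j) i

/-- The Leray projection on the barotropic frequencies, the identity on the other ones. -/
noncomputable def lerayCoef (k : Freq) : (Fin 2 → ℂ) →ₗ[ℂ] (Fin 2 → ℂ) where
  toFun F := if k 2 = 0 then fun i =>
    F i - k i.castSucc * (k 0 * F 0 + k 1 * F 1) / ((k 0 : ℂ) ^ 2 + (k 1 : ℂ) ^ 2) else F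
  map_add' F G := by
    split_ifs
    · ext i; simp only [Pi.add_apply]; ring
    · rfl
  map_smul' c F := by
    split_ifs
    · ext i; simp only [Pi.smul_apply, smul_eq_mul, RingHom.id_apply]; ring
    · rfl

/-- The rotation term on Fourier coefficients; it acts on the baroclinic frequencies. -/
noncomputable def rotCoef (k : Freq) : (Fin 2 → ℂ) →ₗ[ℂ] (Fin 2 → ℂ) where
  toFun F := if k 2 = 0 then 0 else ![-(F 1), F 0]
  map_add' F G := by
    split_ifs
    · simp
    · ext i; fin_cases i <;> simp [add_comm]
  map_smul' c F := by
    split_ifs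
    · simp
    · ext i; fin_cases i <;> simp

/-- The quadratic term of the primitive equations on Fourier coefficients. -/
noncomputable def nonlin (u v : Coef) (k : Freq) : Fin 2 → ℂ := lerayCoef k (transportCoef u v k)

theorem transportSymbol_sub (j l : Freq) (u v : Fin 2 → ℂ) :
    transportSymbol j l (u - v) = transportSymbol j l u - transportSymbol j l v := by
  simp only [transportSymbol, Pi.sub_apply]; ring

/-- For j ≠ 0 one has |j| ≥ 1, so the horizontal part may be given a spurious factor |j|; the
vertical part really has it, since dividing by j₃ gains nothing better than 1/|j₃| ≤ 1. At j = 0 the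
right side vanishes while u·l need not, whence the mean-free hypothesis. -/
theorem norm_transportSymbol_le {j l : Freq} {u : Fin 2 → ℂ} (h : j = 0 → u = 0) :
    ‖transportSymbol j l u‖ ≤ 4 * (freqNorm j * freqNorm l * ‖u‖) := by
  by_cases hj : j = 0
  · simp [h hj, transportSymbol]
  have hj1 := one_le_freqNorm hj
  have hl0 := freqNorm_nonneg l
  have hu0 := norm_nonneg u
  have hterm : ∀ (i : Fin 2) (m : Fin 3), ‖u i * l m‖ ≤ freqNorm j * freqNorm l * ‖u‖ := by
    intro i m
    rw [norm_mul]
    calc ‖u i‖ * ‖(l m : ℂ)‖ ≤ ‖u‖ * freqNorm l := by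
          gcongr
          · exact norm_le_pi_norm u i
          · exact norm_intCast_le_freqNorm l m
      _ ≤ freqNorm j * freqNorm l * ‖u‖ := by
          nlinarith [mul_nonneg hl0 hu0]
  have hvert : ‖(j 0 * u 0 + j 1 * u 1) / j 2 * l 2‖ ≤ 2 * (freqNorm j * freqNorm l * ‖u‖) := by
    have h1 : ‖(j 0 * u 0 + j 1 * u 1) / (j 2 : ℂ)‖ ≤ 2 * (freqNorm j * ‖u‖) := by
      have h2 : ‖(j 0 * u 0 + j 1 * u 1 : ℂ)‖ ≤ 2 * (freqNorm j * ‖u‖) := by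
        refine (norm_add_le _ _).trans ?_
        rw [norm_mul, norm_mul, two_mul]
        gcongr <;> first | exact norm_intCast_le_freqNorm j _ | exact norm_le_pi_norm u _
      rw [norm_div]
      by_cases h0 : j 2 = 0
      · simp only [h0, Int.cast_zero, norm_zero, div_zero]
        positivity
      · refine (div_le_self (norm_nonneg _) ?_).trans h2
        rw [Complex.norm_intCast]
        exact_mod_cast Int.one_le_abs h0
    rw [norm_mul]
    calc _ ≤ 2 * (freqNorm j * ‖u‖) * freqNorm l := by
          gcongr
          exact norm_intCast_le_freqNorm l 2
      _ = _ := by ring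
  calc ‖transportSymbol j l u‖ ≤ ‖u 0 * l 0‖ + ‖u 1 * l 1‖ +
        ‖(j 0 * u 0 + j 1 * u 1) / j 2 * l 2‖ :=
        (norm_sub_le _ _).trans (add_le_add_left (norm_add_le _ _) _)
    _ ≤ _ := by linarith [hterm 0 0, hterm 1 1]

theorem norm_lerayCoef_le (k : Freq) (F : Fin 2 → ℂ) : ‖lerayCoef k F‖ ≤ 3 * ‖F‖ := by
  have hF := norm_nonneg F
  by_cases hk : k 2 = 0
  swap
  · simp only [lerayCoef, LinearMap.coe_mk, AddHom.coe_mk, if_neg hk]; linarith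
  simp only [lerayCoef, LinearMap.coe_mk, AddHom.coe_mk, if_pos hk]
  rw [pi_norm_le_iff_of_nonneg (by positivity)]
  intro i
  have hi : ‖(k i.castSucc : ℂ)‖ ≤ ‖(k 0 : ℂ)‖ + ‖(k 1 : ℂ)‖ := by
    fin_cases i
    · exact le_add_of_nonneg_right (norm_nonneg _)
    · exact le_add_of_nonneg_left (norm_nonneg _)
  have hden : ‖((k 0 : ℂ) ^ 2 + (k 1 : ℂ) ^ 2)‖ = ‖(k 0 : ℂ)‖ ^ 2 + ‖(k 1 : ℂ)‖ ^ 2 := by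
    have : ((k 0 : ℂ) ^ 2 + (k 1 : ℂ) ^ 2) = (((k 0 : ℝ) ^ 2 + (k 1 : ℝ) ^ 2 : ℝ) : ℂ) := by
      push_cast; ring
    rw [this, Complex.norm_real, Real.norm_eq_abs, abs_of_nonneg (by positivity)]
    simp
  have hfrac : ‖(k i.castSucc : ℂ) * (k 0 * F 0 + k 1 * F 1) / ((k 0 : ℂ) ^ 2 + (k 1 : ℂ) ^ 2)‖ ≤
      2 * ‖F‖ := by
    rw [norm_div, hden]
    refine div_le_of_le_mul₀ (by positivity) (by positivity) ?_
    rw [norm_mul]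
    have h2 : ‖(k 0 * F 0 + k 1 * F 1 : ℂ)‖ ≤ (‖(k 0 : ℂ)‖ + ‖(k 1 : ℂ)‖) * ‖F‖ := by
      refine (norm_add_le _ _).trans ?_
      rw [norm_mul, norm_mul, add_mul]
      gcongr <;> exact norm_le_pi_norm F _
    calc _ ≤ (‖(k 0 : ℂ)‖ + ‖(k 1 : ℂ)‖) * ((‖(k 0 : ℂ)‖ + ‖(k 1 : ℂ)‖) * ‖F‖) := by gcongr
      _ ≤ _ := by nlinarith [mul_nonneg (sq_nonneg (‖(k 0 : ℂ)‖ - ‖(k 1 : ℂ)‖)) hF]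
  calc _ ≤ ‖F i‖ + _ := norm_sub_le _ _
    _ ≤ ‖F‖ + 2 * ‖F‖ := add_le_add (norm_le_pi_norm F i) hfrac
    _ = 3 * ‖F‖ := by ring

theorem enorm_lerayCoef_le (k : Freq) (F : Fin 2 → ℂ) : ‖lerayCoef k F‖ₑ ≤ 3 * ‖F‖ₑ := by
  rw [← ofReal_norm, ← ofReal_norm, show (3 : ℝ≥0∞) = ENNReal.ofReal 3 by simp,
    ← ENNReal.ofReal_mul (by norm_num)]
  exact ENNReal.ofReal_le_ofReal (norm_lerayCoef_le k F)

/-! ### Weighted bounds -/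

/-- The weight `|k|^r e^{σ|k|}`. -/
noncomputable def weight (r σ : ℝ) (k : Freq) : ℝ := freqNorm k ^ r * Real.exp (σ * freqNorm k)

theorem weight_nonneg (r σ : ℝ) (k : Freq) : 0 ≤ weight r σ k :=
  mul_nonneg (Real.rpow_nonneg (freqNorm_nonneg k) _) (Real.exp_pos _).le

theorem weight_mono (r : ℝ) {σ σ' : ℝ} (h : σ ≤ σ') (k : Freq) : weight r σ k ≤ weight r σ' k := by
  unfold weight
  have := Real.rpow_nonneg (freqNorm_nonneg k) r
  have := freqNorm_nonneg k
  gcongr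

theorem one_le_weight {r σ : ℝ} (hr : 0 ≤ r) (hσ : 0 ≤ σ) {k : Freq} (hk : k ≠ 0) :
    1 ≤ weight r σ k := by
  have h1 := Real.one_le_rpow (one_le_freqNorm hk) hr
  have h2 := Real.one_le_exp (mul_nonneg hσ (freqNorm_nonneg k))
  exact one_le_mul_of_one_le_of_one_le h1 h2

/-- The mean-free family `u` is dominated by `A` in the weighted sense. -/
structure WeightedBound (r σ : ℝ) (u : Coef) (A : Freq → ℝ≥0∞) : Prop where
  zero : u 0 = 0
  le : ∀ k, ENNReal.ofReal (weight r σ k) * ‖u k‖ₑ ≤ A k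

namespace WeightedBound

variable {r σ σ' : ℝ} {u v : Coef} {A B : Freq → ℝ≥0∞}

theorem mono (h : WeightedBound r σ u A) (hσ : σ' ≤ σ) : WeightedBound r σ' u A :=
  ⟨h.zero, fun k => le_trans
    (mul_le_mul_left (ENNReal.ofReal_le_ofReal (weight_mono r hσ k)) _) (h.le k)⟩

theorem sub (hu : WeightedBound r σ u A) (hv : WeightedBound r σ v B) :
    WeightedBound r σ (u - v) (A + B) := by
  refine ⟨by simp [hu.zero, hv.zero], fun k => ?_⟩
  calc _ ≤ ENNReal.ofReal (weight r σ k) * (‖u k‖ₑ + ‖v k‖ₑ) := by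
        gcongr; exact enorm_sub_le
    _ ≤ _ := by rw [mul_add]; exact add_le_add (hu.le k) (hv.le k)

theorem self (h : u 0 = 0) :
    WeightedBound r σ u fun k => ENNReal.ofReal (weight r σ k) * ‖u k‖ₑ := ⟨h, fun _ => le_rfl⟩

/-- One derivative of u in the analytic norm leaves r - 1 unused powers of |k|; these become the
decay |k|^{1-r} in `convMaj`. -/
theorem freqNorm_mul_le (h : WeightedBound r σ u A) (k : Freq) :
    ENNReal.ofReal (Real.exp (σ * freqNorm k)) * (ENNReal.ofReal (freqNorm k) * ‖u k‖ₑ) ≤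
      ENNReal.ofReal (freqNorm k ^ (1 - r)) * A k := by
  by_cases hk : k = 0
  · simp [hk, h.zero]
  have hn := freqNorm_pos hk
  calc _ = ENNReal.ofReal (freqNorm k ^ (1 - r)) *
        (ENNReal.ofReal (weight r σ k) * ‖u k‖ₑ) := by
        rw [← mul_assoc, ← mul_assoc, ← ENNReal.ofReal_mul (Real.exp_pos _).le,
          ← ENNReal.ofReal_mul (Real.rpow_nonneg hn.le _), weight, ← mul_assoc,
          ← Real.rpow_add hn, sub_add_cancel, Real.rpow_one, mul_comm (Real.exp _)]
    _ ≤ _ := by gcongr; exact h.le k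

theorem transport_term_le (hu : WeightedBound r σ u A) (hv : WeightedBound r σ v B) (hσ : 0 ≤ σ)
    (j k : Freq) (i : Fin 2) :
    ENNReal.ofReal (Real.exp (σ * freqNorm k)) *
        ‖transportSymbol j (k - j) (u j) * v (k - j) i‖ₑ ≤
      4 * (ENNReal.ofReal (freqNorm j ^ (1 - r)) * ENNReal.ofReal (freqNorm (k - j) ^ (1 - r)) *
        (A j * B (k - j))) := by
  set l := k - j with hl
  have h1 : ‖transportSymbol j l (u j)‖ₑ ≤
      4 * (ENNReal.ofReal (freqNorm j) * ENNReal.ofReal (freqNorm l) * ‖u j‖ₑ) := by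
    rw [← ofReal_norm, ← ofReal_norm, show (4 : ℝ≥0∞) = ENNReal.ofReal 4 by simp,
      ← ENNReal.ofReal_mul (freqNorm_nonneg j),
      ← ENNReal.ofReal_mul (mul_nonneg (freqNorm_nonneg j) (freqNorm_nonneg l)),
      ← ENNReal.ofReal_mul (by norm_num)]
    exact ENNReal.ofReal_le_ofReal
      (norm_transportSymbol_le fun h => by rw [h, hu.zero])
  have h2 : ‖v l i‖ₑ ≤ ‖v l‖ₑ := by
    rw [← ofReal_norm, ← ofReal_norm]
    exact ENNReal.ofReal_le_ofReal (norm_le_pi_norm _ _)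
  have h3 : ENNReal.ofReal (Real.exp (σ * freqNorm k)) ≤
      ENNReal.ofReal (Real.exp (σ * freqNorm j)) * ENNReal.ofReal (Real.exp (σ * freqNorm l)) := by
    rw [← ENNReal.ofReal_mul (Real.exp_pos _).le, ← Real.exp_add, ← mul_add]
    refine ENNReal.ofReal_le_ofReal (Real.exp_le_exp.mpr ?_)
    gcongr
    exact freqNorm_le_add_sub j k
  rw [enorm_mul]
  calc _ ≤ (ENNReal.ofReal (Real.exp (σ * freqNorm j)) * ENNReal.ofReal (Real.exp (σ * freqNorm l)))
        * (4 * (ENNReal.ofReal (freqNorm j) * ENNReal.ofReal (freqNorm l) * ‖u j‖ₑ) * ‖v l‖ₑ) := by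
        gcongr
    _ = 4 * ((ENNReal.ofReal (Real.exp (σ * freqNorm j)) *
          (ENNReal.ofReal (freqNorm j) * ‖u j‖ₑ)) *
        (ENNReal.ofReal (Real.exp (σ * freqNorm l)) *
          (ENNReal.ofReal (freqNorm l) * ‖v l‖ₑ))) := by ring
    _ ≤ 4 * ((ENNReal.ofReal (freqNorm j ^ (1 - r)) * A j) *
          (ENNReal.ofReal (freqNorm l ^ (1 - r)) * B l)) := by
        gcongr 4 * (?_ * ?_)
        · exact hu.freqNorm_mul_le j
        · exact hv.freqNorm_mul_le l
    _ = _ := by ring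

end WeightedBound

/-! ### Absolute convergence of the convolution series -/

theorem ofReal_freqNorm_rpow_le_one {r : ℝ} (hr : 1 < r) (k : Freq) :
    ENNReal.ofReal (freqNorm k ^ (1 - r)) ≤ 1 := by
  rw [ENNReal.ofReal_le_one]
  by_cases hk : k = 0
  · rw [hk, freqNorm_zero, Real.zero_rpow (by linarith)]; exact zero_le_one
  · exact Real.rpow_le_one_of_one_le_of_nonpos (one_le_freqNorm hk) (by linarith)

/-- Without the outer weight the factors |j|^{1-r} are merely bounded by 1, and the Cauchy–Schwarz
inequality gives a bound at each single frequency. This suffices for convergence and continuity of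
the series. -/
theorem convMaj_sq_le {r : ℝ} (hr : 1 < r) (A B : Freq → ℝ≥0∞) (k : Freq) :
    convMaj r A B k ^ 2 ≤ (∑' k, A k ^ 2) * ∑' k, B k ^ 2 := by
  have h1 : convMaj r A B k ≤ ∑' j, A j * B (k - j) := by
    refine ENNReal.tsum_le_tsum fun j => ?_
    calc _ ≤ 1 * 1 * (A j * B (k - j)) := by
          gcongr <;> exact ofReal_freqNorm_rpow_le_one hr _
      _ = _ := by ring
  calc _ ≤ (∑' j, A j * B (k - j)) ^ 2 := by gcongr
    _ ≤ _ := ENNReal_tsum_mul_sq_le _ _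
    _ = _ := by
      congr 1
      exact (Equiv.subLeft k).tsum_eq (fun l => B l ^ 2)

theorem convMaj_ne_top {r : ℝ} (hr : 1 < r) {A B : Freq → ℝ≥0∞} (hA : ∑' k, A k ^ 2 ≠ ⊤)
    (hB : ∑' k, B k ^ 2 ≠ ⊤) (k : Freq) : convMaj r A B k ≠ ⊤ := by
  intro h
  have := convMaj_sq_le hr A B k
  rw [h] at this
  exact ENNReal.mul_ne_top hA hB (top_le_iff.mp (by simpa using this))

theorem summable_of_enorm_le {ι E : Type*} [NormedAddCommGroup E] [CompleteSpace E] {f : ι → E}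
    {g : ι → ℝ≥0∞} (hg : ∑' i, g i ≠ ⊤) (h : ∀ i, ‖f i‖ₑ ≤ g i) : Summable f := by
  refine Summable.of_norm_bounded (ENNReal.summable_toReal hg) fun i => ?_
  rw [← toReal_enorm]
  exact ENNReal.toReal_mono (ENNReal.ne_top_of_tsum_ne_top hg i) (h i)

theorem enorm_tsum_le_of_le {ι E : Type*} [NormedAddCommGroup E] {f : ι → E}
    {g : ι → ℝ≥0∞} (h : ∀ i, ‖f i‖ₑ ≤ g i) : ‖∑' i, f i‖ₑ ≤ ∑' i, g i :=
  enorm_tsum_le_tsum_enorm.trans (ENNReal.tsum_le_tsum h)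

theorem exists_enorm_eq (F : Fin 2 → ℂ) : ∃ i, ‖F‖ₑ = ‖F i‖ₑ := by
  by_contra! h
  have h' : ∀ i, ‖F i‖ < ‖F‖ := fun i =>
    lt_of_le_of_ne (norm_le_pi_norm F i) fun e => h i (by rw [← ofReal_norm, ← ofReal_norm, e])
  exact lt_irrefl _ ((pi_norm_lt_iff ((norm_nonneg _).trans_lt (h' 0))).mpr h')

namespace WeightedBound

variable {r σ : ℝ} {u v : Coef} {A B : Freq → ℝ≥0∞}

theorem summable_transport (hu : WeightedBound r σ u A) (hv : WeightedBound r σ v B) (hσ : 0 ≤ σ)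
    (hr : 1 < r) (hA : ∑' k, A k ^ 2 ≠ ⊤) (hB : ∑' k, B k ^ 2 ≠ ⊤) (k : Freq) (i : Fin 2) :
    Summable fun j => transportSymbol j (k - j) (u j) * v (k - j) i := by
  refine summable_of_enorm_le (g := fun j => 4 * (ENNReal.ofReal (freqNorm j ^ (1 - r)) *
    ENNReal.ofReal (freqNorm (k - j) ^ (1 - r)) * (A j * B (k - j)))) ?_ fun j => ?_
  · rw [ENNReal.tsum_mul_left]
    exact ENNReal.mul_ne_top (by simp) (convMaj_ne_top hr hA hB k)
  · simpa using (hu.mono hσ).transport_term_le (hv.mono hσ) le_rfl j k i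

/-- The constant is 2π from differentiation, 4 from the symbol and 3 from the Leray projection. -/
theorem nonlin_le (hu : WeightedBound r σ u A) (hv : WeightedBound r σ v B) (hσ : 0 ≤ σ)
    (k : Freq) :
    ENNReal.ofReal (Real.exp (σ * freqNorm k)) * ‖nonlin u v k‖ₑ ≤
      ENNReal.ofReal (24 * Real.pi) * convMaj r A B k := by
  have h1 : ∀ i, ENNReal.ofReal (Real.exp (σ * freqNorm k)) * ‖transportCoef u v k i‖ₑ ≤
      ENNReal.ofReal (8 * Real.pi) * convMaj r A B k := by
    intro i
    have e0 : ENNReal.ofReal (Real.exp (σ * freqNorm k)) ≠ 0 := by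
      simp [Real.exp_pos]
    have e1 : ‖(2 * Real.pi * Complex.I : ℂ)‖ₑ = ENNReal.ofReal (2 * Real.pi) := by
      rw [← ofReal_norm]; congr 1; simp [abs_of_pos Real.pi_pos]
    have h2 : ENNReal.ofReal (Real.exp (σ * freqNorm k)) *
        ‖∑' j, transportSymbol j (k - j) (u j) * v (k - j) i‖ₑ ≤ 4 * convMaj r A B k := by
      -- The exponential does not depend on j; it is divided out so that the series can be estimated
      -- term by term, and restored in each term.
      rw [convMaj, ← ENNReal.tsum_mul_left,
        mul_comm, ← ENNReal.le_div_iff_mul_le (Or.inl e0) (Or.inl ENNReal.ofReal_ne_top),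
        ENNReal.div_eq_inv_mul, ← ENNReal.tsum_mul_left]
      refine enorm_tsum_le_of_le fun j => ?_
      rw [← ENNReal.div_eq_inv_mul, ENNReal.le_div_iff_mul_le (Or.inl e0)
        (Or.inl ENNReal.ofReal_ne_top), mul_comm]
      exact hu.transport_term_le hv hσ j k i
    simp only [transportCoef, enorm_mul (2 * (Real.pi : ℂ) * Complex.I), e1]
    calc _ = ENNReal.ofReal (2 * Real.pi) * (ENNReal.ofReal (Real.exp (σ * freqNorm k)) *
        ‖∑' j, transportSymbol j (k - j) (u j) * v (k - j) i‖ₑ) := by ring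
      _ ≤ ENNReal.ofReal (2 * Real.pi) * (4 * convMaj r A B k) := by gcongr
      _ = _ := by
        rw [← mul_assoc, show (4 : ℝ≥0∞) = ENNReal.ofReal 4 by simp,
          ← ENNReal.ofReal_mul (by positivity)]
        congr 2; ring
  have h3 : ENNReal.ofReal (Real.exp (σ * freqNorm k)) * ‖transportCoef u v k‖ₑ ≤
      ENNReal.ofReal (8 * Real.pi) * convMaj r A B k := by
    obtain ⟨i, hi⟩ := exists_enorm_eq (transportCoef u v k)
    rw [hi]
    exact h1 i
  calc _ ≤ ENNReal.ofReal (Real.exp (σ * freqNorm k)) * (3 * ‖transportCoef u v k‖ₑ) := by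
        gcongr; exact enorm_lerayCoef_le k _
    _ = 3 * (ENNReal.ofReal (Real.exp (σ * freqNorm k)) * ‖transportCoef u v k‖ₑ) := by ring
    _ ≤ 3 * (ENNReal.ofReal (8 * Real.pi) * convMaj r A B k) := by gcongr
    _ = _ := by
      rw [← mul_assoc, show (3 : ℝ≥0∞) = ENNReal.ofReal 3 by simp,
          ← ENNReal.ofReal_mul (by norm_num)]
      congr 2; ring

end WeightedBound

/-- Bilinearity. It is not formal, because the series can be split only where they converge; the
weighted bounds provide this. -/
theorem nonlin_sub_nonlin {r : ℝ} (hr : 1 < r) {u u' v v' : Coef} {A A' B B' : Freq → ℝ≥0∞}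
    (hu : WeightedBound r 0 u A) (hu' : WeightedBound r 0 u' A') (hv : WeightedBound r 0 v B)
    (hv' : WeightedBound r 0 v' B') (hA : ∑' k, A k ^ 2 ≠ ⊤) (hA' : ∑' k, A' k ^ 2 ≠ ⊤)
    (hB : ∑' k, B k ^ 2 ≠ ⊤) (hB' : ∑' k, B' k ^ 2 ≠ ⊤) (k : Freq) :
    nonlin u v k - nonlin u' v' k = nonlin (u - u') v k + nonlin u' (v - v') k := by
  have s1 := hu.summable_transport hv le_rfl hr hA hB k
  have s2 := hu'.summable_transport hv le_rfl hr hA' hB k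
  have s3 := hu'.summable_transport hv' le_rfl hr hA' hB' k
  simp only [nonlin]
  rw [← map_sub, ← map_add]
  congr 1
  ext i
  simp only [transportCoef, Pi.sub_apply, Pi.add_apply, transportSymbol_sub, sub_mul, mul_sub]
  rw [(s1 i).tsum_sub (s2 i), (s2 i).tsum_sub (s3 i)]
  ring

/-- Majorants A and B independent of time dominate the convolution series uniformly in t, so the sum
of continuous terms is continuous. -/
theorem continuousOn_nonlin {r : ℝ} (hr : 1 < r) {s : Set ℝ} {c d : ℝ → Coef}
    {A B : Freq → ℝ≥0∞} (hA : ∑' k, A k ^ 2 ≠ ⊤) (hB : ∑' k, B k ^ 2 ≠ ⊤)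
    (hc : ∀ t ∈ s, WeightedBound r 0 (c t) A) (hd : ∀ t ∈ s, WeightedBound r 0 (d t) B)
    (hc' : ∀ k, ContinuousOn (fun t => c t k) s) (hd' : ∀ k, ContinuousOn (fun t => d t k) s)
    (k : Freq) : ContinuousOn (fun t => nonlin (c t) (d t) k) s := by
  refine (LinearMap.continuous_of_finiteDimensional (lerayCoef k)).comp_continuousOn
    (f := fun t => transportCoef (c t) (d t) k) ?_
  rw [continuousOn_pi]
  intro i
  refine continuousOn_const.mul ?_
  have hfin : ∑' j, 4 * (ENNReal.ofReal (freqNorm j ^ (1 - r)) *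
    ENNReal.ofReal (freqNorm (k - j) ^ (1 - r)) * (A j * B (k - j))) ≠ ⊤ := by
    rw [ENNReal.tsum_mul_left]
    exact ENNReal.mul_ne_top (by simp) (convMaj_ne_top hr hA hB k)
  refine continuousOn_tsum (fun j => ?_) (ENNReal.summable_toReal hfin) fun j t ht => ?_
  · have h1 := continuousOn_pi.mp (hc' j)
    have h2 := continuousOn_pi.mp (hd' (k - j)) i
    have h10 := h1 0
    have h11 := h1 1
    unfold transportSymbol
    fun_prop
  · rw [← toReal_enorm]
    refine ENNReal.toReal_mono (ENNReal.ne_top_of_tsum_ne_top hfin j) ?_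
    simpa using (hc t ht).transport_term_le (hd t ht) le_rfl j k i


/-! ### The rotation group -/

/-- The rotation group `exp(φ J)` generated by the rotation term. -/
noncomputable def rotGroup (k : Freq) (φ : ℝ) (v : Fin 2 → ℂ) : Fin 2 → ℂ :=
  if k 2 = 0 then v else (Real.cos φ : ℂ) • v + (Real.sin φ : ℂ) • rotCoef k v

theorem rotCoef_rotCoef {k : Freq} (hk : k 2 ≠ 0) (v : Fin 2 → ℂ) : rotCoef k (rotCoef k v) = -v := by
  ext i; fin_cases i <;> simp [rotCoef, hk]

theorem norm_rotCoef_le (k : Freq) (v : Fin 2 → ℂ) : ‖rotCoef k v‖ ≤ ‖v‖ := by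
  rw [pi_norm_le_iff_of_nonneg (norm_nonneg v)]
  intro i
  by_cases hk : k 2 = 0
  · simp [rotCoef, hk]
  · fin_cases i <;> simp [rotCoef, hk, norm_le_pi_norm]

theorem rotGroup_zero (k : Freq) (v : Fin 2 → ℂ) : rotGroup k 0 v = v := by
  simp [rotGroup]

theorem rotGroup_sub (k : Freq) (φ : ℝ) (v w : Fin 2 → ℂ) :
    rotGroup k φ (v - w) = rotGroup k φ v - rotGroup k φ w := by
  unfold rotGroup
  split_ifs
  · rfl
  · rw [map_sub, smul_sub, smul_sub]; abel

theorem rotGroup_add (k : Freq) (φ : ℝ) (v w : Fin 2 → ℂ) :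
    rotGroup k φ (v + w) = rotGroup k φ v + rotGroup k φ w := by
  unfold rotGroup
  split_ifs
  · rfl
  · rw [map_add, smul_add, smul_add]; abel

theorem rotGroup_neg_rotGroup (k : Freq) (φ : ℝ) (v : Fin 2 → ℂ) :
    rotGroup k (-φ) (rotGroup k φ v) = v := by
  unfold rotGroup
  split_ifs with hk
  · rfl
  · rw [map_add, map_smul, map_smul, rotCoef_rotCoef hk]
    ext i
    have h := Complex.cos_sq_add_sin_sq φ
    simp only [Real.cos_neg, Real.sin_neg, Complex.ofReal_neg, Complex.ofReal_cos,
      Complex.ofReal_sin, Pi.add_apply, Pi.smul_apply, Pi.neg_apply, smul_eq_mul]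
    linear_combination v i * h

/-- The sup norm on ℂ² is not invariant under rotation, hence the factor 2. What matters is
uniformity in φ, and so in Ω. -/
theorem norm_rotGroup_le (k : Freq) (φ : ℝ) (v : Fin 2 → ℂ) : ‖rotGroup k φ v‖ ≤ 2 * ‖v‖ := by
  unfold rotGroup
  split_ifs
  · linarith [norm_nonneg v]
  · refine (norm_add_le _ _).trans ?_
    rw [norm_smul, norm_smul, Complex.norm_real, Complex.norm_real, Real.norm_eq_abs,
      Real.norm_eq_abs]
    have h1 := Real.abs_cos_le_one φ
    have h2 := Real.abs_sin_le_one φ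
    have h3 := norm_rotCoef_le k v
    nlinarith [norm_nonneg v, norm_nonneg (rotCoef k v), abs_nonneg (Real.sin φ)]

theorem continuous_rotGroup (k : Freq) {X : Type*} [TopologicalSpace X] {φ : X → ℝ}
    {v : X → Fin 2 → ℂ} (hφ : Continuous φ) (hv : Continuous v) :
    Continuous fun x => rotGroup k (φ x) (v x) := by
  unfold rotGroup
  split_ifs
  · exact hv
  · have := (LinearMap.continuous_of_finiteDimensional (rotCoef k)).comp hv
    have h2 : Continuous fun x => rotCoef k (v x) := this
    fun_prop

/-- Product rule together with J² = -1: the derivative of the group is -ΩJ applied to the group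
itself. -/
theorem hasDerivAt_rotGroup_neg (k : Freq) (Ω : ℝ) {v : ℝ → Fin 2 → ℂ} {v' : Fin 2 → ℂ} {t : ℝ}
    (hv : HasDerivAt v v' t) :
    HasDerivAt (fun s => rotGroup k (-(Ω * s)) (v s))
      (rotGroup k (-(Ω * t)) v' - (Ω : ℂ) • rotCoef k (rotGroup k (-(Ω * t)) (v t))) t := by
  unfold rotGroup
  split_ifs with hk
  · have : ∀ w, rotCoef k w = 0 := fun w => by simp [rotCoef, hk]
    simpa [this] using hv
  · have hJ : HasDerivAt (fun s => rotCoef k (v s)) (rotCoef k v') t :=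
      (((rotCoef k).toContinuousLinearMap.restrictScalars ℝ).hasFDerivAt.comp_hasDerivAt t hv)
    have hlin : HasDerivAt (fun s : ℝ => -(Ω * s)) (-Ω) t := by
      simpa using ((hasDerivAt_id t).const_mul Ω).fun_neg
    have hcos : HasDerivAt (fun s : ℝ => ((Real.cos (-(Ω * s)) : ℝ) : ℂ)) _ t :=
      (hlin.cos).ofReal_comp
    have hsin : HasDerivAt (fun s : ℝ => ((Real.sin (-(Ω * s)) : ℝ) : ℂ)) _ t :=
      (hlin.sin).ofReal_comp
    refine ((hcos.smul hv).add (hsin.smul hJ)).congr_deriv ?_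
    rw [map_add, map_smul, map_smul, rotCoef_rotCoef hk]
    ext i
    simp only [Pi.add_apply, Pi.sub_apply, Pi.smul_apply, Pi.neg_apply, smul_eq_mul]
    push_cast
    ring

/-! ### Solutions of the system of Fourier modes -/

/-- `c` solves the system for the Fourier coefficients on `[a, b]`. -/
structure ModeSolution (Ω a b : ℝ) (c : ℝ → Coef) : Prop where
  cont : ∀ k, ContinuousOn (fun t => c t k) (Icc a b)
  hasDerivAt : ∀ k, ∀ t ∈ Ioo a b,
    HasDerivAt (fun s => c s k) (-nonlin (c t) (c t) k - (Ω : ℂ) • rotCoef k (c t k)) t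

/-- The barotropic modes of `c` are divergence free. -/
def DivFree (c : Coef) : Prop := ∀ k : Freq, k 2 = 0 → (k 0 : ℂ) * c k 0 + k 1 * c k 1 = 0

/-- Conservation of the mean. At output frequency 0 the partner of j is -j: for j₃ ≠ 0 the vertical
part cancels the horizontal one, and for j₃ = 0 the symbol is minus the horizontal divergence. -/
theorem nonlin_zero_eq_zero {u : Coef} (hu : DivFree u) (v : Coef) : nonlin u v 0 = 0 := by
  have : transportCoef u v 0 = 0 := by
    ext i
    have h : ∀ j, transportSymbol j (0 - j) (u j) = 0 := by
      intro j
      simp only [transportSymbol, Pi.sub_apply, Pi.zero_apply, zero_sub, Int.cast_neg]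
      by_cases hj : j 2 = 0
      · have := hu j hj
        simp only [hj, Int.cast_zero, div_zero, zero_mul]
        linear_combination -this
      · have : (j 2 : ℂ) ≠ 0 := by exact_mod_cast hj
        field_simp
        ring
    simp only [transportCoef, h, zero_mul, tsum_zero, mul_zero, Pi.zero_apply]
  simp [nonlin, this]

theorem divergence_lerayCoef {k : Freq} (hk : k 2 = 0) (F : Fin 2 → ℂ) :
    (k 0 : ℂ) * lerayCoef k F 0 + k 1 * lerayCoef k F 1 = 0 := by
  simp only [lerayCoef, LinearMap.coe_mk, AddHom.coe_mk, if_pos hk]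
  by_cases h : ((k 0 : ℂ) ^ 2 + (k 1 : ℂ) ^ 2) = 0
  · have h' : (k 0) ^ 2 + (k 1) ^ 2 = 0 := by exact_mod_cast h
    have h0 : k 0 = 0 := by nlinarith [sq_nonneg (k 0), sq_nonneg (k 1)]
    have h1 : k 1 = 0 := by nlinarith [sq_nonneg (k 0), sq_nonneg (k 1)]
    simp [h0, h1]
  · simp only [Fin.castSucc_zero, Fin.castSucc_one]
    field_simp
    ring

/-! ### The Duhamel operator -/

/-- The space of weighted Fourier coefficients: square summable families of bounded functions of
time. -/
abbrev PathSpace : Type := lp (fun _ : Freq => BoundedContinuousFunction ℝ (Fin 2 → ℂ)) 2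

theorem pathSpace_tsum_enorm_sq (U : PathSpace) : ∑' k, ‖U k‖ₑ ^ 2 = ‖U‖ₑ ^ 2 := by
  have h := lp.hasSum_norm (p := 2) (by simp) U
  simp only [ENNReal.toReal_ofNat, Real.rpow_two] at h
  have h2 := ENNReal.ofReal_tsum_of_nonneg (fun k => sq_nonneg ‖U k‖) h.summable
  rw [h.tsum_eq, ENNReal.ofReal_pow (norm_nonneg _), ofReal_norm] at h2
  rw [h2]
  exact tsum_congr fun k => by rw [ENNReal.ofReal_pow (norm_nonneg _), ofReal_norm]

theorem memℓp_of_enorm {f : Freq → BoundedContinuousFunction ℝ (Fin 2 → ℂ)}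
    (h : ∑' k, ‖f k‖ₑ ^ 2 ≠ ⊤) : Memℓp f 2 := by
  refine memℓp_gen ?_
  have := ENNReal.summable_toReal h
  simpa [Real.rpow_two] using this

/-- Banach's fixed point theorem on the ball of radius 2‖y‖, where U ↦ y - B(U, U) has Lipschitz
constant 4κ‖y‖ ≤ 1/2. Bilinearity enters only through the difference identity `hsub`. -/
theorem abstract_quadratic_fixedPoint {X : Type*} [NormedAddCommGroup X] [CompleteSpace X]
    (B : X → X → X) (κ : ℝ) (hκ : 0 ≤ κ) (hB : ∀ U V, ‖B U V‖ ≤ κ * (‖U‖ * ‖V‖))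
    (hsub : ∀ U V, B U U - B V V = B (U - V) U + B V (U - V)) (y : X) (hy : 8 * κ * ‖y‖ ≤ 1) :
    ∃ U, U = y - B U U ∧ ‖U‖ ≤ 2 * ‖y‖ := by
  let s : Set X := Metric.closedBall 0 (2 * ‖y‖)
  let f : X → X := fun U => y - B U U
  have hs : IsComplete s := Metric.isClosed_closedBall.isComplete
  have hy0 := norm_nonneg y
  have hmaps : MapsTo f s s := by
    intro U hU
    simp only [s, mem_closedBall_zero_iff, f] at hU ⊢
    have := hB U U
    have hU0 := norm_nonneg U
    calc _ ≤ ‖y‖ + ‖B U U‖ := norm_sub_le _ _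
      _ ≤ ‖y‖ + κ * ((2 * ‖y‖) * (2 * ‖y‖)) := by
        gcongr
        refine this.trans ?_
        gcongr
      _ ≤ 2 * ‖y‖ := by nlinarith
  have hcontr : ContractingWith (1 / 2) (MapsTo.restrict f s s hmaps) := by
    refine ⟨by rw [← NNReal.coe_lt_coe]; norm_num, LipschitzWith.of_dist_le_mul ?_⟩
    rintro ⟨U, hU⟩ ⟨V, hV⟩
    simp only [s, mem_closedBall_zero_iff] at hU hV
    rw [Subtype.dist_eq, Subtype.dist_eq]
    simp only [MapsTo.val_restrict_apply, f, dist_eq_norm, sub_sub_sub_cancel_left]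
    rw [norm_sub_rev, hsub]
    have h0 := norm_nonneg (U - V)
    calc _ ≤ ‖B (U - V) U‖ + ‖B V (U - V)‖ := norm_add_le _ _
      _ ≤ κ * (‖U - V‖ * (2 * ‖y‖)) + κ * ((2 * ‖y‖) * ‖U - V‖) := by
        refine add_le_add ((hB _ _).trans ?_) ((hB _ _).trans ?_) <;> gcongr
      _ = (4 * κ * ‖y‖) * ‖U - V‖ := by ring
      _ ≤ _ := by
        push_cast
        gcongr
        linarith
  obtain ⟨U, hU, hfix, -⟩ := hcontr.exists_fixedPoint' hs hmaps (x := 0)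
    (by simp [s]) (edist_ne_top _ _)
  exact ⟨U, hfix.symm, by simpa [s] using hU⟩

/-- The projection of the time line onto `[0, T]`. -/
noncomputable def clamp (T t : ℝ) : ℝ := max 0 (min t T)

theorem continuous_clamp (T : ℝ) : Continuous (clamp T) := by unfold clamp; fun_prop

theorem clamp_nonneg (T t : ℝ) : 0 ≤ clamp T t := le_max_left _ _

theorem clamp_le {T : ℝ} (hT : 0 ≤ T) (t : ℝ) : clamp T t ≤ T := max_le hT (min_le_right _ _)

theorem clamp_of_mem {T t : ℝ} (ht : t ∈ Icc 0 T) : clamp T t = t := by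
  rw [clamp, min_eq_left ht.2, max_eq_right ht.1]

section Duhamel

variable {r L T τ₀ Ω : ℝ}

/-- The Fourier coefficients encoded by a path `U` of weighted coefficients. -/
noncomputable def pathCoef (r L T τ₀ : ℝ) (U : PathSpace) (t : ℝ) : Coef := fun k =>
  (freqNorm k ^ (-r) * Real.exp (-(τ₀ - L * clamp T t) * freqNorm k)) • U k t

theorem continuous_pathCoef (U : PathSpace) (k : Freq) :
    Continuous fun t => pathCoef r L T τ₀ U t k := by
  have h1 := continuous_clamp T
  have h2 := (U k).continuous
  unfold pathCoef
  fun_prop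

theorem pathCoef_sub (U V : PathSpace) (t : ℝ) :
    pathCoef r L T τ₀ (U - V) t = pathCoef r L T τ₀ U t - pathCoef r L T τ₀ V t := by
  ext k : 1
  simp [pathCoef, smul_sub]

theorem weight_smul_pathCoef (U : PathSpace) (t : ℝ) {k : Freq} (hk : k ≠ 0) :
    weight r (τ₀ - L * clamp T t) k • pathCoef r L T τ₀ U t k = U k t := by
  have hn := freqNorm_pos hk
  rw [pathCoef, smul_smul]
  have : weight r (τ₀ - L * clamp T t) k *
      (freqNorm k ^ (-r) * Real.exp (-(τ₀ - L * clamp T t) * freqNorm k)) = 1 := by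
    rw [weight, mul_mul_mul_comm, ← Real.rpow_add hn, ← Real.exp_add,
      add_neg_cancel, neg_mul, add_neg_cancel]
    simp
  rw [this, one_smul]

theorem pathCoef_weightedBound (hr : 0 < r) (U : PathSpace) (t : ℝ) :
    WeightedBound r (τ₀ - L * clamp T t) (pathCoef r L T τ₀ U t) fun k => ‖U k‖ₑ := by
  refine ⟨?_, fun k => ?_⟩
  -- Since 0^{-r} = 0 for r ≠ 0, the encoded family is mean free whatever the value of U at
  -- frequency 0.
  · simp [pathCoef, Real.zero_rpow (neg_ne_zero.mpr hr.ne')]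
  · by_cases hk : k = 0
    · simp [hk, weight, Real.zero_rpow hr.ne']
    · have h := weight_smul_pathCoef (r := r) (L := L) (T := T) (τ₀ := τ₀) U t hk
      have h2 : ‖U k t‖ₑ ≤ ‖U k‖ₑ := by
        rw [← ofReal_norm, ← ofReal_norm]
        exact ENNReal.ofReal_le_ofReal ((U k).norm_coe_le_norm t)
      refine le_trans (le_of_eq ?_) h2
      rw [← h, enorm_smul, Real.enorm_of_nonneg (weight_nonneg _ _ _)]

theorem pathCoef_weightedBound_zero (hr : 0 < r) (hL : 0 ≤ L) (hT : 0 ≤ T) (hτ : 0 ≤ τ₀ - L * T)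
    (U : PathSpace) (t : ℝ) : WeightedBound r 0 (pathCoef r L T τ₀ U t) fun k => ‖U k‖ₑ := by
  refine (pathCoef_weightedBound hr U t).mono ?_
  have := mul_le_mul_of_nonneg_left (clamp_le hT t) hL
  linarith

/-- The integrand of the Duhamel formula. -/
noncomputable def duhamelIntegrand (r L T τ₀ Ω : ℝ) (U V : PathSpace) (k : Freq) (s : ℝ) :
    Fin 2 → ℂ :=
  rotGroup k (Ω * s) (nonlin (pathCoef r L T τ₀ U s) (pathCoef r L T τ₀ V s) k)

theorem continuous_duhamelIntegrand (hr : 1 < r) (hL : 0 ≤ L) (hT : 0 ≤ T) (hτ : 0 ≤ τ₀ - L * T)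
    (U V : PathSpace) (k : Freq) : Continuous (duhamelIntegrand r L T τ₀ Ω U V k) := by
  refine continuous_rotGroup k (by fun_prop) ?_
  rw [← continuousOn_univ]
  refine continuousOn_nonlin hr (A := fun k => ‖U k‖ₑ) (B := fun k => ‖V k‖ₑ) ?_ ?_
    (fun t _ => pathCoef_weightedBound_zero (by linarith) hL hT hτ U t)
    (fun t _ => pathCoef_weightedBound_zero (by linarith) hL hT hτ V t)
    (fun k => (continuous_pathCoef U k).continuousOn)
    (fun k => (continuous_pathCoef V k).continuousOn) k
  · rw [pathSpace_tsum_enorm_sq]; simp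
  · rw [pathSpace_tsum_enorm_sq]; simp

/-- The bilinear Duhamel term on weighted coefficients. -/
noncomputable def duhamelFun (r L T τ₀ Ω : ℝ) (U V : PathSpace) (k : Freq) (t : ℝ) : Fin 2 → ℂ :=
  weight r (τ₀ - L * clamp T t) k • rotGroup k (-(Ω * clamp T t))
    (∫ s in (0 : ℝ)..clamp T t, duhamelIntegrand r L T τ₀ Ω U V k s)

theorem continuous_weight_clamp (k : Freq) :
    Continuous fun t => weight r (τ₀ - L * clamp T t) k := by
  have h1 := continuous_clamp T
  unfold weight
  fun_prop

theorem continuous_duhamelFun (hr : 1 < r) (hL : 0 ≤ L) (hT : 0 ≤ T) (hτ : 0 ≤ τ₀ - L * T)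
    (U V : PathSpace) (k : Freq) : Continuous (duhamelFun r L T τ₀ Ω U V k) := by
  have h1 := continuous_clamp T
  have hc := continuous_duhamelIntegrand (Ω := Ω) hr hL hT hτ U V k
  refine (continuous_weight_clamp k).smul (continuous_rotGroup k (by fun_prop) ?_)
  exact (intervalIntegral.continuous_primitive (fun a b => hc.intervalIntegrable a b) 0).comp h1

/-- The bound 24π of the quadratic term, doubled by the rotation group. The exponential
e^{-(τ₀-Ls)|k|} records that the product is analytic with the radius available at time s. -/
theorem norm_duhamelIntegrand_le (hr : 1 < r) (hL : 0 ≤ L) (hτ : 0 ≤ τ₀ - L * T)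
    (U V : PathSpace) (k : Freq) {s : ℝ} (hs : s ∈ Icc 0 T) :
    ‖duhamelIntegrand r L T τ₀ Ω U V k s‖ ≤ 48 * Real.pi *
      (convMaj r (fun k => ‖U k‖ₑ) (fun k => ‖V k‖ₑ) k).toReal *
        Real.exp (-(τ₀ - L * s) * freqNorm k) := by
  have hU : ∑' k, ‖U k‖ₑ ^ 2 ≠ ⊤ := by rw [pathSpace_tsum_enorm_sq]; simp
  have hV : ∑' k, ‖V k‖ₑ ^ 2 ≠ ⊤ := by rw [pathSpace_tsum_enorm_sq]; simp
  have hs' : 0 ≤ τ₀ - L * s := by nlinarith [hs.2]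
  have hbU := pathCoef_weightedBound (r := r) (L := L) (T := T) (τ₀ := τ₀) (by linarith) U s
  have hbV := pathCoef_weightedBound (r := r) (L := L) (T := T) (τ₀ := τ₀) (by linarith) V s
  rw [clamp_of_mem hs] at hbU hbV
  have h := hbU.nonlin_le hbV hs' k
  have h2 := ENNReal.toReal_mono (ENNReal.mul_ne_top ENNReal.ofReal_ne_top
    (convMaj_ne_top hr hU hV k)) h
  rw [ENNReal.toReal_mul, ENNReal.toReal_mul, ENNReal.toReal_ofReal (Real.exp_pos _).le,
    ENNReal.toReal_ofReal (by positivity), toReal_enorm] at h2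
  refine (norm_rotGroup_le _ _ _).trans ?_
  have h3 : Real.exp (-(τ₀ - L * s) * freqNorm k) = (Real.exp ((τ₀ - L * s) * freqNorm k))⁻¹ := by
    rw [neg_mul, Real.exp_neg]
  rw [h3, ← div_eq_mul_inv, le_div_iff₀ (Real.exp_pos _)]
  linarith

/-- This is where the derivative is recovered: integrating e^{Ls|k|} up to time t gives
e^{Lt|k|}/(L|k|), which turns |k|^r into |k|^{r-1} and produces the small factor 1/L. The
exponentials at time t cancel against the weight. -/
theorem norm_duhamelFun_le (hr : 1 < r) (hL : 0 < L) (hT : 0 ≤ T) (hτ : 0 ≤ τ₀ - L * T)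
    (U V : PathSpace) (k : Freq) (t : ℝ) :
    ‖duhamelFun r L T τ₀ Ω U V k t‖ ≤ 96 * Real.pi / L * (freqNorm k ^ (r - 1) *
      (convMaj r (fun k => ‖U k‖ₑ) (fun k => ‖V k‖ₑ) k).toReal) := by
  set Q := (convMaj r (fun k => ‖U k‖ₑ) (fun k => ‖V k‖ₑ) k).toReal with hQ
  have hQ0 : 0 ≤ Q := ENNReal.toReal_nonneg
  by_cases hk : k = 0
  · have : (0 : ℝ) ^ (r - 1) = 0 := Real.zero_rpow (by linarith)
    simp [hk, duhamelFun, weight, Real.zero_rpow (show r ≠ 0 by linarith), this]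
  have hn := freqNorm_pos hk
  set n := freqNorm k with hnn
  set θ := clamp T t with hθ
  have hθ0 : 0 ≤ θ := clamp_nonneg T t
  have hθT : θ ≤ T := clamp_le hT t
  have hint : ‖∫ s in (0 : ℝ)..θ, duhamelIntegrand r L T τ₀ Ω U V k s‖ ≤
      48 * Real.pi * Q * (Real.exp (-(τ₀ - L * θ) * n) / (L * n)) := by
    have h1 : ‖∫ s in (0 : ℝ)..θ, duhamelIntegrand r L T τ₀ Ω U V k s‖ ≤
        ∫ s in (0 : ℝ)..θ, 48 * Real.pi * Q * Real.exp (-(τ₀ - L * s) * n) := by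
      refine intervalIntegral.norm_integral_le_of_norm_le hθ0 ?_
        ((by fun_prop : Continuous fun s => 48 * Real.pi * Q *
          Real.exp (-(τ₀ - L * s) * n)).intervalIntegrable _ _)
      refine Filter.Eventually.of_forall fun s hs => ?_
      exact norm_duhamelIntegrand_le hr hL.le hτ U V k ⟨hs.1.le, hs.2.trans hθT⟩
    have h2 : ∫ s in (0 : ℝ)..θ, Real.exp (-(τ₀ - L * s) * n) =
        Real.exp (-(τ₀ - L * θ) * n) / (L * n) - Real.exp (-(τ₀ - L * 0) * n) / (L * n) := by
      refine intervalIntegral.integral_eq_sub_of_hasDerivAt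
        (f := fun s => Real.exp (-(τ₀ - L * s) * n) / (L * n)) (fun s _ => ?_)
        ((by fun_prop : Continuous fun s => Real.exp (-(τ₀ - L * s) * n)).intervalIntegrable _ _)
      have hd : HasDerivAt (fun s : ℝ => -(τ₀ - L * s) * n) (L * n) s := by
        have := ((((hasDerivAt_id s).const_mul L).const_sub τ₀).neg).mul_const n
        simpa using this
      refine (hd.exp.div_const (L * n)).congr_deriv ?_
      field_simp
    rw [intervalIntegral.integral_const_mul, h2] at h1
    refine h1.trans ?_
    gcongr
    have : 0 ≤ Real.exp (-(τ₀ - L * 0) * n) / (L * n) := by positivity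
    linarith
  rw [duhamelFun, norm_smul, Real.norm_of_nonneg (weight_nonneg _ _ _)]
  calc _ ≤ weight r (τ₀ - L * θ) k *
        (2 * (48 * Real.pi * Q * (Real.exp (-(τ₀ - L * θ) * n) / (L * n)))) := by
        refine mul_le_mul_of_nonneg_left ((norm_rotGroup_le _ _ _).trans ?_) (weight_nonneg _ _ _)
        gcongr
    _ = 96 * Real.pi / L * (n ^ r / n * Q) *
        (Real.exp ((τ₀ - L * θ) * n) * Real.exp (-(τ₀ - L * θ) * n)) := by
        rw [weight]; field_simp; ring
    _ = _ := by
        rw [← Real.exp_add, Real.rpow_sub hn, Real.rpow_one, neg_mul, add_neg_cancel]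
        simp

/-- The Duhamel term as a function of time. -/
noncomputable def duhamelBcf (hr : 1 < r) (hL : 0 < L) (hT : 0 ≤ T) (hτ : 0 ≤ τ₀ - L * T)
    (Ω : ℝ) (U V : PathSpace) (k : Freq) : BoundedContinuousFunction ℝ (Fin 2 → ℂ) :=
  BoundedContinuousFunction.ofNormedAddCommGroup (duhamelFun r L T τ₀ Ω U V k)
    (continuous_duhamelFun hr hL.le hT hτ U V k) _ (norm_duhamelFun_le hr hL hT hτ U V k)

theorem tsum_duhamelBcf_le {C : ℝ} (hC : ∀ A B : Freq → ℝ≥0∞,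
      ∑' k, (ENNReal.ofReal (freqNorm k ^ (r - 1)) * convMaj r A B k) ^ 2 ≤
        ENNReal.ofReal C * ((∑' k, A k ^ 2) * ∑' k, B k ^ 2))
    (hr : 1 < r) (hL : 0 < L) (hT : 0 ≤ T) (hτ : 0 ≤ τ₀ - L * T) (U V : PathSpace) :
    ∑' k, ‖duhamelBcf hr hL hT hτ Ω U V k‖ₑ ^ 2 ≤
      ENNReal.ofReal (96 * Real.pi / L) ^ 2 * (ENNReal.ofReal C * (‖U‖ₑ ^ 2 * ‖V‖ₑ ^ 2)) := by
  have hU : ∑' k, ‖U k‖ₑ ^ 2 ≠ ⊤ := by rw [pathSpace_tsum_enorm_sq]; simp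
  have hV : ∑' k, ‖V k‖ₑ ^ 2 ≠ ⊤ := by rw [pathSpace_tsum_enorm_sq]; simp
  have h1 : ∀ k, ‖duhamelBcf hr hL hT hτ Ω U V k‖ₑ ≤ ENNReal.ofReal (96 * Real.pi / L) *
      (ENNReal.ofReal (freqNorm k ^ (r - 1)) *
        convMaj r (fun k => ‖U k‖ₑ) (fun k => ‖V k‖ₑ) k) := by
    intro k
    have hn := Real.rpow_nonneg (freqNorm_nonneg k) (r - 1)
    have hpos : 0 ≤ 96 * Real.pi / L := by positivity
    rw [← ofReal_norm, ← ENNReal.ofReal_toReal (convMaj_ne_top hr hU hV k),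
      ← ENNReal.ofReal_mul hn, ← ENNReal.ofReal_mul hpos]
    refine ENNReal.ofReal_le_ofReal ?_
    refine (BoundedContinuousFunction.norm_le (by positivity)).mpr fun t => ?_
    exact norm_duhamelFun_le hr hL hT hτ U V k t
  calc _ ≤ ∑' k, (ENNReal.ofReal (96 * Real.pi / L) * (ENNReal.ofReal (freqNorm k ^ (r - 1)) *
        convMaj r (fun k => ‖U k‖ₑ) (fun k => ‖V k‖ₑ) k)) ^ 2 := by
        gcongr with k; exact h1 k
    _ ≤ _ := by
        simp_rw [mul_pow (ENNReal.ofReal (96 * Real.pi / L))]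
        rw [ENNReal.tsum_mul_left, ← pathSpace_tsum_enorm_sq U, ← pathSpace_tsum_enorm_sq V]
        gcongr
        exact hC _ _

/-- The weight, the rotation group and the integral are linear, so the difference identity descends
from the one for the quadratic term. -/
theorem duhamelFun_sub (hr : 1 < r) (hL : 0 ≤ L) (hT : 0 ≤ T) (hτ : 0 ≤ τ₀ - L * T)
    (U V : PathSpace) (k : Freq) (t : ℝ) :
    duhamelFun r L T τ₀ Ω U U k t - duhamelFun r L T τ₀ Ω V V k t =
      duhamelFun r L T τ₀ Ω (U - V) U k t + duhamelFun r L T τ₀ Ω V (U - V) k t := by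
  have hc := fun U V : PathSpace => (continuous_duhamelIntegrand (Ω := Ω) hr hL hT hτ U V k)
  have hi := fun U V : PathSpace => (hc U V).intervalIntegrable (μ := volume) 0 (clamp T t)
  have hfin : ∀ U : PathSpace, ∑' k, ‖U k‖ₑ ^ 2 ≠ ⊤ := fun U => by
    rw [pathSpace_tsum_enorm_sq]; simp
  have hb := fun (U : PathSpace) (s : ℝ) =>
    pathCoef_weightedBound_zero (r := r) (by linarith) hL hT hτ U s
  simp only [duhamelFun]
  rw [← smul_sub, ← smul_add, ← rotGroup_sub, ← rotGroup_add,
    ← intervalIntegral.integral_sub (hi _ _) (hi _ _),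
    ← intervalIntegral.integral_add (hi _ _) (hi _ _)]
  congr 3
  ext s : 1
  simp only [duhamelIntegrand]
  rw [← rotGroup_sub, ← rotGroup_add, pathCoef_sub]
  congr 1
  exact nonlin_sub_nonlin hr (hb U s) (hb V s) (hb U s) (hb V s) (hfin U) (hfin V) (hfin U)
    (hfin V) k

end Duhamel


/-! ### Existence of solutions of the mode system -/

theorem norm_le_of_enorm_sq_le {E : Type*} [NormedAddCommGroup E] {x : E} {a : ℝ} (ha : 0 ≤ a)
    (h : ‖x‖ₑ ^ 2 ≤ ENNReal.ofReal (a ^ 2)) : ‖x‖ ≤ a := by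
  rw [← ofReal_norm, ← ENNReal.ofReal_pow (norm_nonneg _),
    ENNReal.ofReal_le_ofReal_iff (by positivity)] at h
  exact (pow_le_pow_iff_left₀ (norm_nonneg _) ha two_ne_zero).mp h

theorem weight_pos {r σ : ℝ} {k : Freq} (hk : k ≠ 0) : 0 < weight r σ k :=
  mul_pos (Real.rpow_pos_of_pos (freqNorm_pos hk) _) (Real.exp_pos _)

/-- The weighted free evolution of the initial coefficients. -/
noncomputable def freeFun (r L T τ₀ Ω : ℝ) (c₀ : Coef) (k : Freq) (t : ℝ) : Fin 2 → ℂ :=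
  weight r (τ₀ - L * clamp T t) k • rotGroup k (-(Ω * clamp T t)) (c₀ k)

section Existence

variable {r L T τ₀ Ω : ℝ}

theorem norm_freeFun_le (hL : 0 ≤ L) (c₀ : Coef) (k : Freq) (t : ℝ) :
    ‖freeFun r L T τ₀ Ω c₀ k t‖ ≤ 2 * (weight r τ₀ k * ‖c₀ k‖) := by
  have h1 := weight_nonneg r (τ₀ - L * clamp T t) k
  rw [freeFun, norm_smul, Real.norm_of_nonneg h1]
  have h2 : weight r (τ₀ - L * clamp T t) k ≤ weight r τ₀ k :=
    weight_mono r (by nlinarith [clamp_nonneg T t]) k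
  calc _ ≤ weight r τ₀ k * (2 * ‖c₀ k‖) := by
        gcongr
        · exact weight_nonneg _ _ _
        · exact norm_rotGroup_le _ _ _
    _ = _ := by ring

theorem continuous_freeFun (c₀ : Coef) (k : Freq) : Continuous (freeFun r L T τ₀ Ω c₀ k) := by
  have h1 := continuous_clamp T
  exact (continuous_weight_clamp k).smul (continuous_rotGroup k (by fun_prop) continuous_const)

/-- The abstract fixed point with κ = 96π√C/L and a free evolution of norm at most 2e, doubled by
the rotation group. The smallness condition 8κ·2e ≤ 1 is where 1536 = 8·96·2 comes from, and 4e is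
twice the norm of the free evolution. -/
theorem exists_duhamel_fixedPoint {C : ℝ} (hC0 : 0 < C) (hC : ∀ A B : Freq → ℝ≥0∞,
      ∑' k, (ENNReal.ofReal (freqNorm k ^ (r - 1)) * convMaj r A B k) ^ 2 ≤
        ENNReal.ofReal C * ((∑' k, A k ^ 2) * ∑' k, B k ^ 2))
    (hr : 1 < r) (hL : 0 < L) (hT : 0 ≤ T) (hτ : 0 ≤ τ₀ - L * T) (c₀ : Coef) {e : ℝ} (he : 0 ≤ e)
    (hc₀ : ∑' k, (ENNReal.ofReal (weight r τ₀ k) * ‖c₀ k‖ₑ) ^ 2 ≤ ENNReal.ofReal (e ^ 2))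
    (hLe : 1536 * Real.pi * Real.sqrt C * e ≤ L) :
    ∃ U : PathSpace, ‖U‖ ≤ 4 * e ∧
      ∀ k t, U k t = freeFun r L T τ₀ Ω c₀ k t - duhamelFun r L T τ₀ Ω U U k t := by
  let yf : Freq → BoundedContinuousFunction ℝ (Fin 2 → ℂ) := fun k =>
    BoundedContinuousFunction.ofNormedAddCommGroup (freeFun r L T τ₀ Ω c₀ k)
      (continuous_freeFun c₀ k) _ (norm_freeFun_le hL.le c₀ k)
  have hyk : ∀ k, ‖yf k‖ₑ ≤ 2 * (ENNReal.ofReal (weight r τ₀ k) * ‖c₀ k‖ₑ) := by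
    intro k
    have hw := weight_nonneg r τ₀ k
    rw [← ofReal_norm, ← ofReal_norm, show (2 : ℝ≥0∞) = ENNReal.ofReal 2 by simp,
      ← ENNReal.ofReal_mul hw, ← ENNReal.ofReal_mul (by norm_num)]
    refine ENNReal.ofReal_le_ofReal ?_
    exact (BoundedContinuousFunction.norm_le (by positivity)).mpr (norm_freeFun_le hL.le c₀ k)
  have hysum : ∑' k, ‖yf k‖ₑ ^ 2 ≤ ENNReal.ofReal ((2 * e) ^ 2) := by
    calc _ ≤ ∑' k, (2 * (ENNReal.ofReal (weight r τ₀ k) * ‖c₀ k‖ₑ)) ^ 2 := by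
          gcongr with k; exact hyk k
      _ = 4 * ∑' k, (ENNReal.ofReal (weight r τ₀ k) * ‖c₀ k‖ₑ) ^ 2 := by
          rw [← ENNReal.tsum_mul_left]
          refine tsum_congr fun k => ?_
          rw [mul_pow]; norm_num
      _ ≤ 4 * ENNReal.ofReal (e ^ 2) := by gcongr
      _ = _ := by
          rw [show (4 : ℝ≥0∞) = ENNReal.ofReal 4 by simp, ← ENNReal.ofReal_mul (by norm_num)]
          congr 1; ring
  let y : PathSpace := ⟨yf, memℓp_of_enorm (hysum.trans_lt ENNReal.ofReal_lt_top).ne⟩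
  have hy : ‖y‖ ≤ 2 * e := by
    refine norm_le_of_enorm_sq_le (by positivity) ?_
    rw [← pathSpace_tsum_enorm_sq]
    exact hysum
  have hBsum := fun U V : PathSpace => tsum_duhamelBcf_le (Ω := Ω) hC hr hL hT hτ U V
  have hfin : ∀ U V : PathSpace, ENNReal.ofReal (96 * Real.pi / L) ^ 2 *
      (ENNReal.ofReal C * (‖U‖ₑ ^ 2 * ‖V‖ₑ ^ 2)) ≠ ⊤ := fun U V =>
    ENNReal.mul_ne_top (by simp) (ENNReal.mul_ne_top (by simp) (ENNReal.mul_ne_top (by simp)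
      (by simp)))
  let B : PathSpace → PathSpace → PathSpace := fun U V =>
    ⟨duhamelBcf hr hL hT hτ Ω U V, memℓp_of_enorm ((hBsum U V).trans_lt (hfin U V).lt_top).ne⟩
  set κ : ℝ := 96 * Real.pi / L * Real.sqrt C with hκ
  have hκ0 : 0 ≤ κ := by positivity
  have hB : ∀ U V, ‖B U V‖ ≤ κ * (‖U‖ * ‖V‖) := by
    intro U V
    refine norm_le_of_enorm_sq_le (by positivity) ?_
    rw [← pathSpace_tsum_enorm_sq]
    refine (hBsum U V).trans (le_of_eq ?_)
    rw [← ofReal_norm, ← ofReal_norm, ← ENNReal.ofReal_pow (by positivity),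
      ← ENNReal.ofReal_pow (by positivity), ← ENNReal.ofReal_pow (by positivity),
      ← ENNReal.ofReal_mul (by positivity), ← ENNReal.ofReal_mul (by positivity),
      ← ENNReal.ofReal_mul (by positivity)]
    congr 1
    rw [hκ, mul_pow, mul_pow _ (Real.sqrt C), Real.sq_sqrt hC0.le, mul_pow]
    ring
  have hsub : ∀ U V, B U U - B V V = B (U - V) U + B V (U - V) := by
    intro U V
    ext k t : 3
    exact duhamelFun_sub hr hL.le hT hτ U V k t
  have hsmall : 8 * κ * ‖y‖ ≤ 1 := by
    calc 8 * κ * ‖y‖ ≤ 8 * κ * (2 * e) := by gcongr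
      _ = (1536 * Real.pi * Real.sqrt C * e) / L := by rw [hκ]; ring
      _ ≤ 1 := by rw [div_le_one hL]; exact hLe
  obtain ⟨U, hU, hUn⟩ := abstract_quadratic_fixedPoint B κ hκ0 hB hsub y hsmall
  refine ⟨U, by linarith, fun k t => ?_⟩
  have : U k t = (y - B U U) k t := by rw [← hU]
  rw [this]
  rfl

theorem intervalIntegral_divergence {k : Freq} {f : ℝ → Fin 2 → ℂ} (hf : Continuous f)
    (h : ∀ s, (k 0 : ℂ) * f s 0 + k 1 * f s 1 = 0) (t : ℝ) :
    (k 0 : ℂ) * (∫ s in (0 : ℝ)..t, f s) 0 + k 1 * (∫ s in (0 : ℝ)..t, f s) 1 = 0 := by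
  let φ : (Fin 2 → ℂ) →L[ℂ] ℂ :=
    (k 0 : ℂ) • ContinuousLinearMap.proj 0 + (k 1 : ℂ) • ContinuousLinearMap.proj 1
  have h1 := φ.intervalIntegral_comp_comm (hf.intervalIntegrable (μ := volume) 0 t)
  have h2 : ∀ s, φ (f s) = 0 := fun s => by simpa [φ] using h s
  simp only [h2, intervalIntegral.integral_zero] at h1
  simpa [φ] using h1.symm

/-- Existence of a solution of the mode system for a radius decreasing with slope `L`, for `L`
large in terms of the size `e` of the initial coefficients. -/
theorem exists_modeSolution (hr : 5 / 2 < r) :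
    ∃ C : ℝ, 0 < C ∧ ∀ (L T τ₀ Ω : ℝ) (c₀ : Coef) (e : ℝ), 0 < L → 0 ≤ T → 0 ≤ τ₀ - L * T →
      c₀ 0 = 0 → DivFree c₀ → 0 ≤ e →
      ∑' k, (ENNReal.ofReal (weight r τ₀ k) * ‖c₀ k‖ₑ) ^ 2 ≤ ENNReal.ofReal (e ^ 2) →
      C * e ≤ L →
      ∃ (c : ℝ → Coef) (A : Freq → ℝ≥0∞), ModeSolution Ω 0 T c ∧ c 0 = c₀ ∧
        (∀ t ∈ Icc 0 T, WeightedBound r (τ₀ - L * t) (c t) A) ∧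
        ∑' k, A k ^ 2 ≤ ENNReal.ofReal ((4 * e) ^ 2) ∧ ∀ t ∈ Icc 0 T, DivFree (c t) := by
  obtain ⟨C, hC0, hC⟩ := exists_conv_bound hr
  have hr1 : 1 < r := by linarith
  refine ⟨1536 * Real.pi * Real.sqrt C, by positivity, ?_⟩
  intro L T τ₀ Ω c₀ e hL hT hτ hc00 hdiv he hc₀ hLe
  obtain ⟨U, hUn, hU⟩ := exists_duhamel_fixedPoint (Ω := Ω) hC0 hC hr1 hL hT hτ c₀ he hc₀ hLe
  let c : ℝ → Coef := pathCoef r L T τ₀ U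
  have hcont : ∀ k, Continuous fun t => c t k := fun k => continuous_pathCoef U k
  have hGc := fun k => continuous_duhamelIntegrand (Ω := Ω) hr1 hL.le hT hτ U U k
  -- Dividing the fixed point equation by the weight, which is nonzero for k ≠ 0, gives the Duhamel
  -- formula for the coefficients themselves.
  have hform : ∀ k, ∀ t ∈ Icc 0 T, k ≠ 0 → c t k = rotGroup k (-(Ω * t))
      (c₀ k - ∫ s in (0 : ℝ)..t, duhamelIntegrand r L T τ₀ Ω U U k s) := by
    intro k t ht hk
    have h1 := weight_smul_pathCoef (r := r) (L := L) (T := T) (τ₀ := τ₀) U t hk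
    rw [hU, freeFun, duhamelFun, ← smul_sub, ← rotGroup_sub, clamp_of_mem ht] at h1
    exact smul_right_injective _ (weight_pos hk).ne' h1
  have hzero : ∀ t, c t 0 = 0 := fun t => (pathCoef_weightedBound (by linarith) U t).zero
  have hdivc : ∀ t ∈ Icc 0 T, DivFree (c t) := by
    intro t ht k hk
    by_cases hk0 : k = 0
    · simp [hk0]
    rw [hform k t ht hk0]
    -- On barotropic frequencies the rotation is trivial and the integrand is Leray projected, so
    -- the Duhamel formula keeps the divergence zero.
    have h1 := intervalIntegral_divergence (k := k) (hGc k) (fun s => by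
      simp only [duhamelIntegrand, rotGroup, if_pos hk, nonlin]
      exact divergence_lerayCoef hk _) t
    have h2 := hdiv k hk
    simp only [rotGroup, if_pos hk, Pi.sub_apply]
    linear_combination h2 - h1
  refine ⟨c, fun k => ‖U k‖ₑ, ⟨fun k => (hcont k).continuousOn, fun k t ht => ?_⟩, ?_, ?_, ?_,
    hdivc⟩
  · have htI : t ∈ Icc 0 T := Ioo_subset_Icc_self ht
    by_cases hk : k = 0
    · subst hk
      -- The Duhamel formula is unavailable at k = 0. There the coefficient vanishes identically,
      -- and conservation of the mean makes the right-hand side zero as well.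
      have h1 : (fun s => c s 0) = fun _ => 0 := funext hzero
      rw [h1, hzero t, nonlin_zero_eq_zero (hdivc t htI)]
      simpa using hasDerivAt_const t (0 : Fin 2 → ℂ)
    · have hint : HasDerivAt
          (fun t => c₀ k - ∫ s in (0 : ℝ)..t, duhamelIntegrand r L T τ₀ Ω U U k s)
          (-duhamelIntegrand r L T τ₀ Ω U U k t) t :=
        (intervalIntegral.integral_hasDerivAt_right ((hGc k).intervalIntegrable _ _)
          ((hGc k).stronglyMeasurableAtFilter _ _) (hGc k).continuousAt).const_sub _
      have h2 := hasDerivAt_rotGroup_neg k Ω hint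
      rw [← hform k t htI hk] at h2
      -- The integrand carries the group at angle Ωt, which is undone by the outer group at angle
      -- -Ωt.
      have h3 : rotGroup k (-(Ω * t)) (-duhamelIntegrand r L T τ₀ Ω U U k t) =
          -nonlin (c t) (c t) k := by
        rw [← zero_sub (duhamelIntegrand _ _ _ _ _ _ _ _ _), rotGroup_sub, duhamelIntegrand, rotGroup_neg_rotGroup]
        have : rotGroup k (-(Ω * t)) 0 = 0 := by simp [rotGroup]
        rw [this, zero_sub]
      rw [h3] at h2
      refine h2.congr_of_eventuallyEq ?_
      filter_upwards [Ioo_mem_nhds ht.1 ht.2] with s hs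
      exact hform k s (Ioo_subset_Icc_self hs) hk
  · ext1 k
    by_cases hk : k = 0
    · rw [hk, hzero, hc00]
    · rw [hform k 0 ⟨le_rfl, hT⟩ hk]
      simp [rotGroup_zero]
  · intro t ht
    have := pathCoef_weightedBound (r := r) (L := L) (T := T) (τ₀ := τ₀) (by linarith) U t
    rwa [clamp_of_mem ht] at this
  · rw [pathSpace_tsum_enorm_sq, ← ofReal_norm, ← ENNReal.ofReal_pow (norm_nonneg _)]
    exact ENNReal.ofReal_le_ofReal (by gcongr)

end Existence


/-! ### The energy estimate -/

/-- The squared analytic norm in terms of Fourier coefficients. -/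
noncomputable def coefNormSq (τ r : ℝ) (u : Coef) : ℝ≥0∞ :=
  ∑' k : Freq, ENNReal.ofReal
    ((1 + freqNorm k ^ (2 * r) * Real.exp (2 * τ * freqNorm k)) * ∑ i, ‖u k i‖ ^ 2)

theorem ENNReal_le_of_sq_le {x y : ℝ≥0∞} (h : x ^ 2 ≤ y ^ 2) : x ≤ y :=
  (ENNReal.pow_le_pow_left_iff two_ne_zero).mp h

/-- Duality between H^r and H^{r-1}: Cauchy–Schwarz in k, then the convolution bound for each of the
two terms. X occurs quadratically while A and B only contribute their norms, as the energy estimate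
for a difference requires. -/
theorem exists_pairing_bound {r : ℝ} (hr : 5 / 2 < r) :
    ∃ C : ℝ, 0 < C ∧ ∀ (X A B : Freq → ℝ≥0∞) (α β : ℝ), 0 ≤ α → 0 ≤ β →
      ∑' k, A k ^ 2 ≤ ENNReal.ofReal (α ^ 2) → ∑' k, B k ^ 2 ≤ ENNReal.ofReal (β ^ 2) →
      ∑' k, X k * (ENNReal.ofReal (freqNorm k ^ (r - 1)) * (convMaj r X A k + convMaj r B X k)) ≤
        ENNReal.ofReal (C * (α + β)) * ∑' k, X k ^ 2 := by
  obtain ⟨C, hC0, hC⟩ := exists_conv_bound hr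
  refine ⟨Real.sqrt (2 * C), by positivity, fun X A B α β hα hβ hA hB => ?_⟩
  refine ENNReal_le_of_sq_le ?_
  refine (ENNReal_tsum_mul_sq_le _ _).trans ?_
  have h1 : ∑' k, (ENNReal.ofReal (freqNorm k ^ (r - 1)) *
      (convMaj r X A k + convMaj r B X k)) ^ 2 ≤
      ENNReal.ofReal (Real.sqrt (2 * C) * (α + β)) ^ 2 * ∑' k, X k ^ 2 := by
    calc _ ≤ ∑' k, 2 * ((ENNReal.ofReal (freqNorm k ^ (r - 1)) * convMaj r X A k) ^ 2 +
          (ENNReal.ofReal (freqNorm k ^ (r - 1)) * convMaj r B X k) ^ 2) := by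
          refine ENNReal.tsum_le_tsum fun k => ?_
          rw [mul_add]
          exact ENNReal_add_sq_le _ _
      _ ≤ 2 * (ENNReal.ofReal C * ((∑' k, X k ^ 2) * ENNReal.ofReal (α ^ 2)) +
          ENNReal.ofReal C * (ENNReal.ofReal (β ^ 2) * ∑' k, X k ^ 2)) := by
          rw [ENNReal.tsum_mul_left, ENNReal.tsum_add]
          gcongr
          · refine (hC X A).trans ?_
            gcongr
          · refine (hC B X).trans ?_
            gcongr
      _ = ENNReal.ofReal (2 * C * (α ^ 2 + β ^ 2)) * ∑' k, X k ^ 2 := by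
          rw [ENNReal.ofReal_mul (by positivity), ENNReal.ofReal_mul (by norm_num),
            ENNReal.ofReal_add (by positivity) (by positivity), ENNReal.ofReal_ofNat]
          ring
      _ ≤ _ := by
          rw [← ENNReal.ofReal_pow (by positivity), mul_pow, Real.sq_sqrt (by positivity)]
          gcongr
          nlinarith [mul_nonneg hα hβ]
  calc _ ≤ (∑' k, X k ^ 2) * (ENNReal.ofReal (Real.sqrt (2 * C) * (α + β)) ^ 2 *
        ∑' k, X k ^ 2) := by gcongr
    _ = _ := by ring

/-! ### Energy of a single frequency -/

theorem sum_inner_rotCoef (k : Freq) (Ω : ℝ) (w : Fin 2 → ℂ) :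
    ∑ i, inner ℝ (w i) (((Ω : ℂ) • rotCoef k w) i) = 0 := by
  by_cases hk : k 2 = 0
  · simp [rotCoef, hk]
  · simp [rotCoef, hk, Fin.sum_univ_two, Complex.inner]
    ring

theorem sum_norm_sq_le (w : Fin 2 → ℂ) : ∑ i, ‖w i‖ ^ 2 ≤ 2 * ‖w‖ ^ 2 := by
  rw [Fin.sum_univ_two, two_mul]
  gcongr <;> exact norm_le_pi_norm w _

theorem norm_sq_le_sum (w : Fin 2 → ℂ) : ‖w‖ ^ 2 ≤ ∑ i, ‖w i‖ ^ 2 := by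
  obtain ⟨i, hi⟩ := exists_enorm_eq w
  have : ‖w‖ = ‖w i‖ := by rw [← toReal_enorm, ← toReal_enorm, hi]
  rw [this]
  exact Finset.single_le_sum (f := fun i => ‖w i‖ ^ 2) (fun _ _ => sq_nonneg _) (Finset.mem_univ i)

theorem abs_sum_inner_le (w g : Fin 2 → ℂ) : |∑ i, inner ℝ (w i) (g i)| ≤ 2 * (‖w‖ * ‖g‖) := by
  rw [Fin.sum_univ_two, two_mul]
  refine (abs_add_le _ _).trans ?_
  gcongr <;> refine (abs_real_inner_le_norm _ _).trans ?_ <;> gcongr <;>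
    exact norm_le_pi_norm _ _

/-- The energy density at frequency `k`. -/
noncomputable def modeEnergy (r σ : ℝ) (k : Freq) (w : Fin 2 → ℂ) : ℝ :=
  (1 + freqNorm k ^ (2 * (r - 1 / 2)) * Real.exp (2 * σ * freqNorm k)) * ∑ i, ‖w i‖ ^ 2

/-- The time derivative of the energy density at frequency `k` along `w' = -g - Ω J w` and
`σ' = -ℓ`. -/
noncomputable def modeEnergyDeriv (r σ ℓ : ℝ) (k : Freq) (w g : Fin 2 → ℂ) : ℝ :=
  -(2 * ℓ * (freqNorm k * freqNorm k ^ (2 * (r - 1 / 2))) * Real.exp (2 * σ * freqNorm k)) *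
      ∑ i, ‖w i‖ ^ 2 -
    2 * (1 + freqNorm k ^ (2 * (r - 1 / 2)) * Real.exp (2 * σ * freqNorm k)) *
      ∑ i, inner ℝ (w i) (g i)

theorem hasDerivAt_modeEnergy {r s₀ ℓ Ω t : ℝ} (k : Freq) {w : ℝ → Fin 2 → ℂ} {g : Fin 2 → ℂ}
    (hw : HasDerivAt w (-g - (Ω : ℂ) • rotCoef k (w t)) t) :
    HasDerivAt (fun t => modeEnergy r (s₀ - ℓ * t) k (w t))
      (modeEnergyDeriv r (s₀ - ℓ * t) ℓ k (w t) g) t := by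
  have h1 : HasDerivAt (fun t => 2 * (s₀ - ℓ * t) * freqNorm k) (2 * (-ℓ) * freqNorm k) t := by
    have := (((hasDerivAt_id t).const_mul ℓ).const_sub s₀).const_mul 2 |>.mul_const (freqNorm k)
    simpa using this
  have h2 := ((h1.exp.const_mul (freqNorm k ^ (2 * (r - 1 / 2)))).const_add 1)
  have h3 : ∀ i, HasDerivAt (fun t => ‖w t i‖ ^ 2) (2 * inner ℝ (w t i)
      ((-g - (Ω : ℂ) • rotCoef k (w t)) i)) t := fun i => ((hasDerivAt_pi.mp hw) i).norm_sq
  have h4 : HasDerivAt (fun t => ∑ i, ‖w t i‖ ^ 2) (∑ i, 2 * inner ℝ (w t i)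
      ((-g - (Ω : ℂ) • rotCoef k (w t)) i)) t := HasDerivAt.fun_sum fun i _ => h3 i
  refine (h2.mul h4).congr_deriv ?_
  have h5 : ∑ i, 2 * inner ℝ (w t i) ((-g - (Ω : ℂ) • rotCoef k (w t)) i) =
      -2 * ∑ i, inner ℝ (w t i) (g i) := by
    have h6 := sum_inner_rotCoef k Ω (w t)
    simp only [Pi.sub_apply, Pi.neg_apply, inner_sub_right, inner_neg_right]
    rw [← Finset.mul_sum, Finset.sum_sub_distrib, h6, Finset.sum_neg_distrib]
    ring
  rw [h5, modeEnergyDeriv]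
  ring

/-- The extra |k| produced by differentiating the radius raises the order from r - 1/2 to r, since 1
+ 2(r - 1/2) = 2r. -/
theorem freqNorm_mul_rpow {r σ : ℝ} {k : Freq} (hk : k ≠ 0) :
    freqNorm k * freqNorm k ^ (2 * (r - 1 / 2)) * Real.exp (2 * σ * freqNorm k) =
      weight r σ k ^ 2 := by
  have hn := freqNorm_pos hk
  rw [weight, mul_pow, ← Real.rpow_natCast, ← Real.rpow_natCast, ← Real.rpow_mul hn.le,
    ← Real.exp_mul]
  congr 1
  · nth_rw 1 [← Real.rpow_one (freqNorm k)]
    rw [← Real.rpow_add hn]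
    congr 1
    push_cast; ring
  · congr 1
    push_cast; ring

/-- The splitting 2(r - 1/2) = r + (r - 1), which distributes the weight of the energy between the
difference (order r) and the nonlinear term (order r - 1). -/
theorem rpow_mul_exp_eq {r σ : ℝ} {k : Freq} (hk : k ≠ 0) :
    freqNorm k ^ (2 * (r - 1 / 2)) * Real.exp (2 * σ * freqNorm k) =
      weight r σ k * weight (r - 1) σ k := by
  have hn := freqNorm_pos hk
  have : 2 * (r - 1 / 2) = r + (r - 1) := by ring
  rw [weight, weight, this, Real.rpow_add hn, show 2 * σ * freqNorm k =
    σ * freqNorm k + σ * freqNorm k by ring, Real.exp_add]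
  ring

theorem one_add_le {r σ : ℝ} (hr : 1 ≤ r) (hσ : 0 ≤ σ) {k : Freq} (hk : k ≠ 0) :
    1 + freqNorm k ^ (2 * (r - 1 / 2)) * Real.exp (2 * σ * freqNorm k) ≤
      2 * (weight r σ k * weight (r - 1) σ k) := by
  rw [rpow_mul_exp_eq hk]
  have h1 := one_le_weight (r := r) (σ := σ) (by linarith) hσ hk
  have h2 := one_le_weight (r := r - 1) (σ := σ) (by linarith) hσ hk
  nlinarith

theorem weight_sub_one_le {r σ : ℝ} {k : Freq} (hk : k ≠ 0) : weight (r - 1) σ k ≤ weight r σ k := by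
  unfold weight
  gcongr
  · exact one_le_freqNorm hk
  · linarith

theorem modeEnergy_le {r σ : ℝ} (hr : 1 ≤ r) (hσ : 0 ≤ σ) {k : Freq} {w : Fin 2 → ℂ}
    (hw : k = 0 → w = 0) : modeEnergy r σ k w ≤ 4 * (weight r σ k * ‖w‖) ^ 2 := by
  by_cases hk : k = 0
  · rw [hw hk]; simp [modeEnergy]
  have h0 := weight_nonneg r σ k
  calc _ ≤ (2 * (weight r σ k * weight r σ k)) * (2 * ‖w‖ ^ 2) := by
        refine mul_le_mul ((one_add_le hr hσ hk).trans ?_) (sum_norm_sq_le w)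
          (Finset.sum_nonneg fun _ _ => sq_nonneg _) (by positivity)
        gcongr
        exact weight_sub_one_le hk
    _ = _ := by ring

/-- The signed bound gives the decay, the absolute one the domination needed to differentiate the
sum over frequencies. The summand 1 in the norm is harmless because both weights are at least 1 away
from k = 0. -/
theorem modeEnergyDeriv_le {r σ ℓ : ℝ} (hr : 1 ≤ r) (hσ : 0 ≤ σ) (hℓ : 0 ≤ ℓ) {k : Freq}
    {w g : Fin 2 → ℂ} (hw : k = 0 → w = 0) :
    modeEnergyDeriv r σ ℓ k w g ≤ -(2 * ℓ) * (weight r σ k * ‖w‖) ^ 2 +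
        8 * ((weight r σ k * ‖w‖) * (weight (r - 1) σ k * ‖g‖)) ∧
      |modeEnergyDeriv r σ ℓ k w g| ≤ 4 * ℓ * (weight r σ k * ‖w‖) ^ 2 +
        8 * ((weight r σ k * ‖w‖) * (weight (r - 1) σ k * ‖g‖)) := by
  by_cases hk : k = 0
  · rw [hw hk]; simp [modeEnergyDeriv]
  have h0 := weight_nonneg r σ k
  have h0' := weight_nonneg (r - 1) σ k
  have e1 : modeEnergyDeriv r σ ℓ k w g = -(2 * ℓ) * (weight r σ k ^ 2 * ∑ i, ‖w i‖ ^ 2) -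
      2 * (1 + freqNorm k ^ (2 * (r - 1 / 2)) * Real.exp (2 * σ * freqNorm k)) *
        ∑ i, inner ℝ (w i) (g i) := by
    rw [modeEnergyDeriv, ← freqNorm_mul_rpow (r := r) (σ := σ) hk]; ring
  have e2 : |2 * (1 + freqNorm k ^ (2 * (r - 1 / 2)) * Real.exp (2 * σ * freqNorm k)) *
        ∑ i, inner ℝ (w i) (g i)| ≤
      8 * ((weight r σ k * ‖w‖) * (weight (r - 1) σ k * ‖g‖)) := by
    have hpos : 0 ≤ freqNorm k ^ (2 * (r - 1 / 2)) := Real.rpow_nonneg (freqNorm_nonneg k) _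
    rw [abs_mul, abs_of_nonneg (by positivity)]
    calc _ ≤ (2 * (2 * (weight r σ k * weight (r - 1) σ k))) * (2 * (‖w‖ * ‖g‖)) := by
          gcongr
          · exact one_add_le hr hσ hk
          · exact abs_sum_inner_le w g
      _ = _ := by ring
  have e3 := norm_sq_le_sum w
  have e4 := sum_norm_sq_le w
  have e5 : weight r σ k ^ 2 * ‖w‖ ^ 2 ≤ weight r σ k ^ 2 * ∑ i, ‖w i‖ ^ 2 := by gcongr
  have e6 : weight r σ k ^ 2 * ∑ i, ‖w i‖ ^ 2 ≤ weight r σ k ^ 2 * (2 * ‖w‖ ^ 2) := by gcongr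
  rw [e1, mul_pow]
  obtain ⟨e7, e8⟩ := abs_le.mp e2
  refine ⟨?_, abs_le.mpr ⟨?_, ?_⟩⟩
  · nlinarith [mul_le_mul_of_nonneg_left e5 hℓ]
  · nlinarith [mul_le_mul_of_nonneg_left e6 hℓ]
  · have : 0 ≤ weight r σ k ^ 2 * ‖w‖ ^ 2 := by positivity
    nlinarith [mul_le_mul_of_nonneg_left e5 hℓ, mul_nonneg hℓ this]

theorem weight_sub_one_mul_nonlin_le {r σ : ℝ} {u v : Coef} {A B : Freq → ℝ≥0∞}
    (hu : WeightedBound r σ u A) (hv : WeightedBound r σ v B) (hσ : 0 ≤ σ) (k : Freq) :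
    ENNReal.ofReal (weight (r - 1) σ k) * ‖nonlin u v k‖ₑ ≤
      ENNReal.ofReal (24 * Real.pi) *
        (ENNReal.ofReal (freqNorm k ^ (r - 1)) * convMaj r A B k) := by
  rw [weight, ENNReal.ofReal_mul (Real.rpow_nonneg (freqNorm_nonneg k) _), mul_assoc]
  calc _ ≤ ENNReal.ofReal (freqNorm k ^ (r - 1)) *
        (ENNReal.ofReal (24 * Real.pi) * convMaj r A B k) := by
        exact mul_le_mul_right (hu.nonlin_le hv hσ k) _
    _ = _ := by ring

/-- The difference of the quadratic terms in the weighted norm of order `r - 1`. -/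
theorem weight_sub_one_mul_nonlin_sub_le {r σ : ℝ} (hr : 1 < r) {c d : Coef}
    {A B X : Freq → ℝ≥0∞} (hσ : 0 ≤ σ) (hc : WeightedBound r σ c A) (hd : WeightedBound r σ d B)
    (hw : WeightedBound r σ (c - d) X) (hA : ∑' k, A k ^ 2 ≠ ⊤) (hB : ∑' k, B k ^ 2 ≠ ⊤)
    (k : Freq) :
    ENNReal.ofReal (weight (r - 1) σ k) * ‖nonlin c c k - nonlin d d k‖ₑ ≤
      ENNReal.ofReal (24 * Real.pi) *
        (ENNReal.ofReal (freqNorm k ^ (r - 1)) * (convMaj r X A k + convMaj r B X k)) := by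
  rw [nonlin_sub_nonlin hr (hc.mono hσ) (hd.mono hσ) (hc.mono hσ) (hd.mono hσ) hA hB hA hB k]
  calc _ ≤ ENNReal.ofReal (weight (r - 1) σ k) *
        (‖nonlin (c - d) c k‖ₑ + ‖nonlin d (c - d) k‖ₑ) := by
        gcongr; exact enorm_add_le _ _
    _ ≤ _ := by
        rw [mul_add, mul_add, mul_add]
        exact add_le_add (weight_sub_one_mul_nonlin_le hw hc hσ k)
          (weight_sub_one_mul_nonlin_le hd hw hσ k)

/-- The energy of the difference of two solutions does not increase, in the norm of order `r - 1/2`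
whose radius decreases sufficiently fast. -/
theorem exists_energy_bound {r : ℝ} (hr : 5 / 2 < r) :
    ∃ C : ℝ, 0 < C ∧ ∀ (Ω a b s₀ ℓ : ℝ) (c d : ℝ → Coef) (A B : Freq → ℝ≥0∞) (α β : ℝ),
      ModeSolution Ω a b c → ModeSolution Ω a b d →
      (∀ t ∈ Icc a b, 0 ≤ s₀ - ℓ * t) →
      (∀ t ∈ Icc a b, WeightedBound r (s₀ - ℓ * t) (c t) A) →
      (∀ t ∈ Icc a b, WeightedBound r (s₀ - ℓ * t) (d t) B) →
      0 ≤ α → 0 ≤ β →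
      ∑' k, A k ^ 2 ≤ ENNReal.ofReal (α ^ 2) → ∑' k, B k ^ 2 ≤ ENNReal.ofReal (β ^ 2) →
      C * (α + β) ≤ ℓ →
      ∀ t ∈ Icc a b, coefNormSq (s₀ - ℓ * t) (r - 1 / 2) (c t - d t) ≤
        coefNormSq (s₀ - ℓ * a) (r - 1 / 2) (c a - d a) := by
  obtain ⟨K, hK0, hK⟩ := exists_pairing_bound hr
  have hr1 : 1 < r := by linarith
  -- The summed derivative is at most -2ℓ Σx² + 8 Σxg with Σxg ≤ 24πK(α+β) Σx²; it is nonpositive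
  -- when 4·24πK(α+β) ≤ ℓ.
  refine ⟨4 * (24 * Real.pi) * K, by positivity, ?_⟩
  intro Ω a b s₀ ℓ c d A B α β hc hd hσ hcA hdB hα hβ hA hB hℓ
  have hℓ0 : 0 ≤ ℓ := le_trans (by positivity) hℓ
  have hAt : ∑' k, A k ^ 2 ≠ ⊤ := (hA.trans_lt ENNReal.ofReal_lt_top).ne
  have hBt : ∑' k, B k ^ 2 ≠ ⊤ := (hB.trans_lt ENNReal.ofReal_lt_top).ne
  set D : Freq → ℝ≥0∞ := A + B with hD
  have hDt : ∑' k, D k ^ 2 ≠ ⊤ := by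
    refine ((ENNReal.tsum_le_tsum fun k => ENNReal_add_sq_le (A k) (B k)).trans_lt ?_).ne
    rw [ENNReal.tsum_mul_left, ENNReal.tsum_add]
    exact ENNReal.mul_lt_top (by simp) (ENNReal.add_lt_top.mpr ⟨hAt.lt_top, hBt.lt_top⟩)
  have hDk : ∀ k, D k ≠ ⊤ := fun k h => by
    refine ENNReal.ne_top_of_tsum_ne_top hDt k ?_
    simp [h]
  have hw : ∀ t ∈ Icc a b, WeightedBound r (s₀ - ℓ * t) (c t - d t) D :=
    fun t ht => (hcA t ht).sub (hdB t ht)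
  have hw0 : ∀ t ∈ Icc a b, ∀ k : Freq, k = 0 → (c t - d t) k = 0 :=
    fun t ht k hk => by rw [hk, (hw t ht).zero]
  set f : Freq → ℝ → ℝ := fun k t => modeEnergy r (s₀ - ℓ * t) k (c t k - d t k) with hf
  set f' : Freq → ℝ → ℝ := fun k t => modeEnergyDeriv r (s₀ - ℓ * t) ℓ k (c t k - d t k)
    (nonlin (c t) (c t) k - nonlin (d t) (d t) k) with hf'
  have hderiv : ∀ k, ∀ t ∈ Ioo a b, HasDerivAt (f k) (f' k t) t := by
    intro k t ht
    refine hasDerivAt_modeEnergy (Ω := Ω) k ?_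
    refine ((hc.hasDerivAt k t ht).fun_sub (hd.hasDerivAt k t ht)).congr_deriv ?_
    rw [map_sub, smul_sub]
    abel
  -- A summable bound for the derivatives, uniform in time; it uses the majorant D of the difference
  -- and serves only to differentiate term by term.
  set P : Freq → ℝ≥0∞ := fun k => ENNReal.ofReal (4 * ℓ) * D k ^ 2 +
    8 * (D k * (ENNReal.ofReal (24 * Real.pi) *
      (ENNReal.ofReal (freqNorm k ^ (r - 1)) * (convMaj r D A k + convMaj r B D k)))) with hP
  have hPt : ∑' k, P k ≠ ⊤ := by
    rw [ENNReal.tsum_add, ENNReal.tsum_mul_left, ENNReal.tsum_mul_left]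
    refine ENNReal.add_ne_top.mpr ⟨ENNReal.mul_ne_top ENNReal.ofReal_ne_top hDt,
      ENNReal.mul_ne_top (by simp) ?_⟩
    simp_rw [mul_left_comm (D _) (ENNReal.ofReal (24 * Real.pi))]
    rw [ENNReal.tsum_mul_left]
    refine ENNReal.mul_ne_top ENNReal.ofReal_ne_top ((hK D A B α β hα hβ hA hB).trans_lt ?_).ne
    exact ENNReal.mul_lt_top ENNReal.ofReal_lt_top hDt.lt_top
  have hx : ∀ t ∈ Icc a b, ∀ k, ENNReal.ofReal (weight r (s₀ - ℓ * t) k * ‖c t k - d t k‖) ≤ D k := by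
    intro t ht k
    rw [ENNReal.ofReal_mul (weight_nonneg _ _ _), ofReal_norm]
    exact (hw t ht).le k
  have hf'bound : ∀ k, ∀ t ∈ Ioo a b, ‖f' k t‖ ≤ (P k).toReal := by
    intro k t ht
    have ht' := Ioo_subset_Icc_self ht
    rw [← toReal_enorm]
    refine ENNReal.toReal_mono (ENNReal.ne_top_of_tsum_ne_top hPt k) ?_
    rw [← ofReal_norm, Real.norm_eq_abs]
    refine (ENNReal.ofReal_le_ofReal (modeEnergyDeriv_le hr1.le (hσ t ht') hℓ0
      (hw0 t ht' k)).2).trans ?_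
    have n1 := weight_nonneg r (s₀ - ℓ * t) k
    have n2 := weight_nonneg (r - 1) (s₀ - ℓ * t) k
    rw [ENNReal.ofReal_add (by positivity) (by positivity), ENNReal.ofReal_mul (p := 4 * ℓ) (by positivity),
      ENNReal.ofReal_pow (by positivity), ENNReal.ofReal_mul (p := 8) (by positivity),
      ENNReal.ofReal_mul (p := weight r (s₀ - ℓ * t) k * _) (by positivity),
      ENNReal.ofReal_mul (p := weight (r - 1) (s₀ - ℓ * t) k) n2, ofReal_norm (nonlin _ _ _ - _),
      ENNReal.ofReal_ofNat]
    simp only [hP]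
    refine add_le_add ?_ (mul_le_mul_right (mul_le_mul' (hx t ht' k)
      (weight_sub_one_mul_nonlin_sub_le hr1 (hσ t ht') (hcA t ht') (hdB t ht') (hw t ht')
        hAt hBt k)) _)
    gcongr
    exact hx t ht' k
  have hf'nonpos : ∀ t ∈ Ioo a b, ∑' k, f' k t ≤ 0 := by
    intro t ht
    have ht' := Ioo_subset_Icc_self ht
    set σ := s₀ - ℓ * t with hσt
    have hσ0 : 0 ≤ σ := hσ t ht'
    set x : Freq → ℝ := fun k => weight r σ k * ‖c t k - d t k‖ with hx_def
    set g : Freq → ℝ := fun k => weight (r - 1) σ k *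
      ‖nonlin (c t) (c t) k - nonlin (d t) (d t) k‖ with hg_def
    have hx0 : ∀ k, 0 ≤ x k := fun k => mul_nonneg (weight_nonneg _ _ _) (norm_nonneg _)
    have hg0 : ∀ k, 0 ≤ g k := fun k => mul_nonneg (weight_nonneg _ _ _) (norm_nonneg _)
    -- For the sign the actual size of the difference at time t is needed: with D in place of X the
    -- nonlinear term could not be absorbed by the dissipative one.
    set X : Freq → ℝ≥0∞ := fun k => ENNReal.ofReal (weight r σ k) * ‖(c t - d t) k‖ₑ with hX_def
    have hXx : ∀ k, X k = ENNReal.ofReal (x k) := fun k => by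
      rw [hx_def, ENNReal.ofReal_mul (weight_nonneg _ _ _), ofReal_norm]
      rfl
    have hXD : ∀ k, X k ≤ D k := (hw t ht').le
    have hXt : ∑' k, X k ^ 2 ≠ ⊤ := by
      refine ((ENNReal.tsum_le_tsum fun k => ?_).trans_lt hDt.lt_top).ne
      gcongr
      exact hXD k
    have hXself : WeightedBound r σ (c t - d t) X := WeightedBound.self (hw t ht').zero
    have hxg : ∑' k, ENNReal.ofReal (x k * g k) ≤
        ENNReal.ofReal (24 * Real.pi * (K * (α + β))) * ∑' k, X k ^ 2 := by
      calc _ ≤ ∑' k, X k * (ENNReal.ofReal (24 * Real.pi) *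
            (ENNReal.ofReal (freqNorm k ^ (r - 1)) * (convMaj r X A k + convMaj r B X k))) := by
            refine ENNReal.tsum_le_tsum fun k => ?_
            rw [ENNReal.ofReal_mul (hx0 k), ← hXx]
            gcongr
            rw [hg_def, ENNReal.ofReal_mul (weight_nonneg _ _ _), ofReal_norm]
            exact weight_sub_one_mul_nonlin_sub_le hr1 hσ0 (hcA t ht') (hdB t ht') hXself hAt hBt k
        _ ≤ _ := by
            simp_rw [mul_left_comm (X _) (ENNReal.ofReal (24 * Real.pi))]
            rw [ENNReal.tsum_mul_left, ENNReal.ofReal_mul (p := 24 * Real.pi) (by positivity),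
              mul_assoc]
            exact mul_le_mul_right (hK X A B α β hα hβ hA hB) _
    have hxsq : ∑' k, X k ^ 2 = ∑' k, ENNReal.ofReal (x k ^ 2) :=
      tsum_congr fun k => by rw [hXx, ENNReal.ofReal_pow (hx0 k)]
    have sx : Summable fun k => x k ^ 2 := by
      rw [hxsq] at hXt
      have := ENNReal.summable_toReal hXt
      simpa [ENNReal.toReal_ofReal (sq_nonneg _)] using this
    have hxg_t : ∑' k, ENNReal.ofReal (x k * g k) ≠ ⊤ :=
      (hxg.trans_lt (ENNReal.mul_lt_top ENNReal.ofReal_lt_top hXt.lt_top)).ne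
    have sxg : Summable fun k => x k * g k := by
      have := ENNReal.summable_toReal hxg_t
      simpa [ENNReal.toReal_ofReal (mul_nonneg (hx0 _) (hg0 _))] using this
    have hreal : ∑' k, x k * g k ≤ 24 * Real.pi * (K * (α + β)) * ∑' k, x k ^ 2 := by
      have hS : 0 ≤ ∑' k, x k ^ 2 := tsum_nonneg fun k => sq_nonneg _
      rw [← ENNReal.ofReal_le_ofReal_iff (by positivity), ENNReal.ofReal_mul (by positivity),
        ENNReal.ofReal_tsum_of_nonneg (fun k => mul_nonneg (hx0 k) (hg0 k)) sxg,
        ENNReal.ofReal_tsum_of_nonneg (fun k => sq_nonneg _) sx, ← hxsq]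
      exact hxg
    have sf' : Summable fun k => f' k t :=
      Summable.of_norm_bounded (ENNReal.summable_toReal hPt) fun k => hf'bound k t ht
    calc ∑' k, f' k t ≤ ∑' k, (-(2 * ℓ) * x k ^ 2 + 8 * (x k * g k)) := by
          refine sf'.tsum_le_tsum (fun k => ?_) ((sx.mul_left _).add (sxg.mul_left _))
          exact (modeEnergyDeriv_le hr1.le hσ0 hℓ0 (hw0 t ht' k)).1
      _ = -(2 * ℓ) * ∑' k, x k ^ 2 + 8 * ∑' k, x k * g k := by
          rw [(sx.mul_left _).tsum_add (sxg.mul_left _), tsum_mul_left, tsum_mul_left]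
      _ ≤ 0 := by
          have hS : 0 ≤ ∑' k, x k ^ 2 := tsum_nonneg fun k => sq_nonneg _
          nlinarith [mul_le_mul_of_nonneg_right hℓ hS]
  have hfnn : ∀ k t, 0 ≤ f k t := fun k t => by
    have := Real.rpow_nonneg (freqNorm_nonneg k) (2 * (r - 1 / 2))
    exact mul_nonneg (by positivity) (Finset.sum_nonneg fun _ _ => sq_nonneg _)
  have hD4 : ∑' k, 4 * D k ^ 2 ≠ ⊤ := by
    rw [ENNReal.tsum_mul_left]; exact ENNReal.mul_ne_top (by simp) hDt
  have hfbound : ∀ k, ∀ t ∈ Icc a b, ‖f k t‖ ≤ (4 * D k ^ 2).toReal := by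
    intro k t ht
    rw [← toReal_enorm]
    refine ENNReal.toReal_mono (ENNReal.ne_top_of_tsum_ne_top hD4 k) ?_
    rw [Real.enorm_of_nonneg (hfnn k t)]
    refine (ENNReal.ofReal_le_ofReal (modeEnergy_le hr1.le (hσ t ht) (hw0 t ht k))).trans ?_
    have n1 := weight_nonneg r (s₀ - ℓ * t) k
    rw [ENNReal.ofReal_mul (by norm_num), ENNReal.ofReal_pow (by positivity),
      ENNReal.ofReal_ofNat]
    gcongr
    exact hx t ht k
  have hsumf : ∀ t ∈ Icc a b, Summable fun k => f k t := fun t ht =>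
    Summable.of_norm_bounded (ENNReal.summable_toReal hD4) fun k => hfbound k t ht
  have hcoef : ∀ t ∈ Icc a b, coefNormSq (s₀ - ℓ * t) (r - 1 / 2) (c t - d t) =
      ENNReal.ofReal (∑' k, f k t) := fun t ht => by
    rw [ENNReal.ofReal_tsum_of_nonneg (fun k => hfnn k t) (hsumf t ht)]
    rfl
  have hcontf : ∀ k, ContinuousOn (f k) (Icc a b) := by
    intro k
    have h1 : ∀ i, ContinuousOn (fun t => c t k i - d t k i) (Icc a b) := fun i =>
      (continuousOn_pi.mp (hc.cont k) i).sub (continuousOn_pi.mp (hd.cont k) i)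
    simp only [hf, modeEnergy, Pi.sub_apply]
    refine ContinuousOn.mul (by fun_prop) ?_
    exact continuousOn_finsetSum _ fun i _ => (h1 i).norm.pow 2
  have hanti : AntitoneOn (fun t => ∑' k, f k t) (Icc a b) := by
    have hd : ∀ t ∈ Ioo a b, HasDerivAt (fun t => ∑' k, f k t) (∑' k, f' k t) t := fun t ht =>
      hasDerivAt_tsum_of_isPreconnected (ENNReal.summable_toReal hPt) isOpen_Ioo
        isPreconnected_Ioo hderiv hf'bound ht (hsumf t (Ioo_subset_Icc_self ht)) ht
    refine antitoneOn_of_deriv_nonpos (convex_Icc a b)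
      -- Continuity up to the endpoints is separate, as the mode equations hold only in the open
      -- interval.
      (continuousOn_tsum hcontf (ENNReal.summable_toReal hD4) hfbound) ?_ ?_
    · rw [interior_Icc]
      exact fun t ht => (hd t ht).differentiableAt.differentiableWithinAt
    · rw [interior_Icc]
      intro t ht
      rw [(hd t ht).deriv]
      exact hf'nonpos t ht
  intro t ht
  have ha : a ∈ Icc a b := ⟨le_rfl, ht.1.trans ht.2⟩
  rw [hcoef t ht, hcoef a ha]
  exact ENNReal.ofReal_le_ofReal (hanti ha ht ht.1)


/-! ### Exponential decay -/

theorem exists_freqNorm_rpow_mul_exp_le (r : ℝ) {ρ : ℝ} (hρ : 0 < ρ) :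
    ∃ K : ℝ, 0 < K ∧ ∀ k : Freq, freqNorm k ^ r * Real.exp (-ρ * freqNorm k) ≤ K := by
  obtain ⟨K, hK, h⟩ := pow_mul_exp_neg_le hρ ⌈r⌉₊
  refine ⟨K + 1, by linarith, fun k => ?_⟩
  by_cases hk : k = 0
  · subst hk
    have : (0 : ℝ) ^ r ≤ 1 := by
      by_cases h0 : r = 0
      · simp [h0]
      · rw [Real.zero_rpow h0]; exact zero_le_one
    simp only [freqNorm_zero, mul_zero, Real.exp_zero, mul_one]
    linarith
  · have h1 : freqNorm k ^ r ≤ freqNorm k ^ ⌈r⌉₊ := by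
      rw [← Real.rpow_natCast]
      exact Real.rpow_le_rpow_of_exponent_le (one_le_freqNorm hk) (Nat.le_ceil r)
    calc _ ≤ freqNorm k ^ ⌈r⌉₊ * Real.exp (-ρ * freqNorm k) := by gcongr
      _ ≤ K := h _ (freqNorm_nonneg k)
      _ ≤ _ := by linarith

/-- Exponentially decaying families. -/
def ExpDecay (a : Freq → ℂ) : Prop :=
  ∃ ρ K : ℝ, 0 < ρ ∧ ∀ k, ‖a k‖ ≤ K * Real.exp (-ρ * freqNorm k)

namespace ExpDecay

variable {a b : Freq → ℂ}

theorem nonneg_const {ρ K : ℝ} (h : ∀ k, ‖a k‖ ≤ K * Real.exp (-ρ * freqNorm k)) : 0 ≤ K := by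
  have := (norm_nonneg _).trans (h 0)
  simpa using this

theorem summable_norm (h : ExpDecay a) : Summable fun k => ‖a k‖ := by
  obtain ⟨ρ, K, hρ, h⟩ := h
  exact ((summable_exp_neg_freqNorm hρ).mul_left K).of_nonneg_of_le (fun _ => norm_nonneg _) h

theorem of_norm_le (h : ExpDecay a) {m : ℝ} {M : ℝ}
    (hb : ∀ k, ‖b k‖ ≤ M * freqNorm k ^ m * ‖a k‖) : ExpDecay b := by
  obtain ⟨ρ, K, hρ, h⟩ := h
  obtain ⟨K', hK', h'⟩ := exists_freqNorm_rpow_mul_exp_le m (half_pos hρ)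
  have hK := nonneg_const h
  refine ⟨ρ / 2, |M| * K' * K, half_pos hρ, fun k => (hb k).trans ?_⟩
  have hn := Real.rpow_nonneg (freqNorm_nonneg k) m
  have e : Real.exp (-ρ * freqNorm k) =
      Real.exp (-(ρ / 2) * freqNorm k) * Real.exp (-(ρ / 2) * freqNorm k) := by
    rw [← Real.exp_add]; congr 1; ring
  calc M * freqNorm k ^ m * ‖a k‖ ≤ |M| * freqNorm k ^ m * (K * Real.exp (-ρ * freqNorm k)) := by
        gcongr
        · exact le_abs_self M
        · exact h k
    _ = |M| * (freqNorm k ^ m * Real.exp (-(ρ / 2) * freqNorm k)) * K *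
        Real.exp (-(ρ / 2) * freqNorm k) := by rw [e]; ring
    _ ≤ _ := by
        gcongr
        exact h' k

theorem mono (h : ExpDecay a) (hb : ∀ k, ‖b k‖ ≤ ‖a k‖) : ExpDecay b :=
  h.of_norm_le (m := 0) (M := 1) fun k => by simpa using hb k

theorem const_mul (h : ExpDecay a) (c : ℂ) : ExpDecay fun k => c * a k :=
  h.of_norm_le (m := 0) (M := ‖c‖) fun k => by simp

theorem freq_mul (h : ExpDecay a) (j : Fin 3) : ExpDecay fun k => (k j : ℂ) * a k :=
  h.of_norm_le (m := 1) (M := 1) fun k => by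
    rw [norm_mul, Real.rpow_one, one_mul]
    gcongr
    exact norm_intCast_le_freqNorm k j

theorem add (ha : ExpDecay a) (hb : ExpDecay b) : ExpDecay fun k => a k + b k := by
  obtain ⟨ρ, K, hρ, ha⟩ := ha
  obtain ⟨ρ', K', hρ', hb⟩ := hb
  refine ⟨min ρ ρ', K + K', lt_min hρ hρ', fun k => (norm_add_le _ _).trans ?_⟩
  have hn := freqNorm_nonneg k
  have h1 := nonneg_const ha
  have h2 := nonneg_const hb
  rw [add_mul]
  refine add_le_add ((ha k).trans ?_) ((hb k).trans ?_)
  · gcongr; exact min_le_left _ _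
  · gcongr; exact min_le_right _ _

/-- From |j| + |k-j| ≥ |k|, half of the common rate q is kept as decay in k, and the other half
still leaves e^{-(q/2)|j|}, which makes the series in j converge. -/
theorem conv (ha : ExpDecay a) (hb : ExpDecay b) :
    ExpDecay (fun k => ∑' j, a j * b (k - j)) ∧ ∀ k, Summable fun j => a j * b (k - j) := by
  obtain ⟨ρ, K, hρ, ha⟩ := ha
  obtain ⟨ρ', K', hρ', hb⟩ := hb
  set q := min ρ ρ' with hq
  have hq0 : 0 < q := lt_min hρ hρ'
  have h1 := nonneg_const ha
  have h2 := nonneg_const hb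
  have hterm : ∀ k j, ‖a j * b (k - j)‖ ≤
      (K * K' * Real.exp (-(q / 2) * freqNorm k)) * Real.exp (-(q / 2) * freqNorm j) := by
    intro k j
    have hj := freqNorm_nonneg j
    have hl := freqNorm_nonneg (k - j)
    have hk := freqNorm_le_add_sub j k
    rw [norm_mul]
    calc _ ≤ (K * Real.exp (-q * freqNorm j)) * (K' * Real.exp (-q * freqNorm (k - j))) := by
          gcongr
          · refine (ha j).trans ?_
            gcongr; exact min_le_left _ _
          · refine (hb _).trans ?_
            gcongr; exact min_le_right _ _
      _ = K * K' * Real.exp (-q * freqNorm j + -q * freqNorm (k - j)) := by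
          rw [Real.exp_add]; ring
      _ ≤ K * K' * Real.exp (-(q / 2) * freqNorm k + -(q / 2) * freqNorm j) := by
          have hlin : -q * freqNorm j + -q * freqNorm (k - j) ≤
              -(q / 2) * freqNorm k + -(q / 2) * freqNorm j := by
            nlinarith [mul_nonneg hq0.le hl, mul_le_mul_of_nonneg_left hk hq0.le]
          gcongr
      _ = _ := by rw [Real.exp_add]; ring
  have hs := summable_exp_neg_freqNorm (half_pos hq0)
  refine ⟨⟨q / 2, K * K' * ∑' j : Freq, Real.exp (-(q / 2) * freqNorm j), half_pos hq0,
    fun k => ?_⟩, fun k => Summable.of_norm_bounded (hs.mul_left _) (hterm k)⟩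
  refine (tsum_of_norm_bounded (hs.mul_left _).hasSum (hterm k)).trans (le_of_eq ?_)
  rw [tsum_mul_left]
  ring

end ExpDecay

/-! ### Uniqueness of solutions of the mode system -/

theorem ModeSolution.mono {Ω a b a' b' : ℝ} {c : ℝ → Coef} (h : ModeSolution Ω a b c)
    (ha : a ≤ a') (hb : b' ≤ b) : ModeSolution Ω a' b' c :=
  ⟨fun k => (h.cont k).mono (Icc_subset_Icc ha hb),
    fun k t ht => h.hasDerivAt k t (Ioo_subset_Ioo ha hb ht)⟩

theorem eq_zero_of_coefNormSq_eq_zero {τ r : ℝ} {u : Coef} (h : coefNormSq τ r u = 0) : u = 0 := by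
  rw [coefNormSq, ENNReal.tsum_eq_zero] at h
  ext k i
  have h1 := ENNReal.ofReal_eq_zero.mp (h k)
  have h2 := Real.rpow_nonneg (freqNorm_nonneg k) (2 * r)
  have h3 : 0 < 1 + freqNorm k ^ (2 * r) * Real.exp (2 * τ * freqNorm k) := by positivity
  have h4 : ∑ i, ‖u k i‖ ^ 2 ≤ 0 := nonpos_of_mul_nonpos_right h1 h3
  have h5 := Finset.single_le_sum (f := fun i => ‖u k i‖ ^ 2) (fun _ _ => sq_nonneg _)
    (Finset.mem_univ i)
  have h6 : ‖u k i‖ ^ 2 = 0 := le_antisymm (h5.trans h4) (sq_nonneg _)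
  simpa using h6

theorem coefNormSq_zero (τ r : ℝ) : coefNormSq τ r 0 = 0 := by simp [coefNormSq]

/-- A family of paths in a fixed exponentially decaying class. -/
structure UniformDecay (s : Set ℝ) (ρ K : ℝ) (c : ℝ → Coef) : Prop where
  zero : ∀ t ∈ s, c t 0 = 0
  le : ∀ t ∈ s, ∀ k, ‖c t k‖ ≤ K * Real.exp (-ρ * freqNorm k)

/-- Half of the decay rate pays for the radius σ ≤ ρ/2, a quarter for the power |k|^r, and the last
quarter is square summable. The majorant depends only on ρ, K and r, so different paths share it. -/
theorem UniformDecay.exists_majorant (r : ℝ) {s : Set ℝ} {ρ K : ℝ} (hρ : 0 < ρ)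
    (hK : 0 ≤ K) : ∃ (A : Freq → ℝ≥0∞) (α : ℝ), 0 ≤ α ∧ ∑' k, A k ^ 2 ≤ ENNReal.ofReal (α ^ 2) ∧
      ∀ (c : ℝ → Coef), UniformDecay s ρ K c → ∀ t ∈ s, ∀ σ ≤ ρ / 2, WeightedBound r σ (c t) A := by
  obtain ⟨K', hK', h'⟩ := exists_freqNorm_rpow_mul_exp_le r (show 0 < ρ / 4 by positivity)
  have hs := summable_exp_neg_freqNorm (show 0 < ρ / 2 by positivity)
  set S : ℝ := ∑' k : Freq, (K * K') ^ 2 * Real.exp (-(ρ / 2) * freqNorm k) with hS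
  have hS0 : 0 ≤ S := tsum_nonneg fun k => by positivity
  refine ⟨fun k => ENNReal.ofReal (K * K' * Real.exp (-(ρ / 4) * freqNorm k)), Real.sqrt S,
    Real.sqrt_nonneg _, ?_, fun c h t ht σ hσ => ⟨h.zero t ht, fun k => ?_⟩⟩
  · rw [Real.sq_sqrt hS0, hS, ENNReal.ofReal_tsum_of_nonneg (fun k => by positivity)
      (hs.mul_left _)]
    refine le_of_eq (tsum_congr fun k => ?_)
    rw [← ENNReal.ofReal_pow (by positivity), mul_pow, ← Real.exp_nat_mul]
    congr 3
    push_cast; ring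
  · have hn := freqNorm_nonneg k
    have hnr := Real.rpow_nonneg hn r
    rw [← ofReal_norm, ← ENNReal.ofReal_mul (weight_nonneg _ _ _)]
    refine ENNReal.ofReal_le_ofReal ?_
    calc weight r σ k * ‖c t k‖
        ≤ freqNorm k ^ r * Real.exp (ρ / 2 * freqNorm k) * (K * Real.exp (-ρ * freqNorm k)) := by
          unfold weight
          gcongr
          exact h.le t ht k
      _ = K * (freqNorm k ^ r * Real.exp (-(ρ / 4) * freqNorm k)) *
          Real.exp (-(ρ / 4) * freqNorm k) := by
          have : Real.exp (ρ / 2 * freqNorm k) * Real.exp (-ρ * freqNorm k) =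
              Real.exp (-(ρ / 4) * freqNorm k) * Real.exp (-(ρ / 4) * freqNorm k) := by
            rw [← Real.exp_add, ← Real.exp_add]; congr 1; ring
          linear_combination K * freqNorm k ^ r * this
      _ ≤ _ := by gcongr; exact h' k

/-- Two solutions of the mode system with uniformly decaying coefficients and the same initial
value coincide. -/
theorem modeSolution_unique {Ω T ρ K : ℝ} {c d : ℝ → Coef} (hρ : 0 < ρ) (hK : 0 ≤ K)
    (hc : ModeSolution Ω 0 T c) (hd : ModeSolution Ω 0 T d)
    (hcK : UniformDecay (Icc 0 T) ρ K c) (hdK : UniformDecay (Icc 0 T) ρ K d)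
    (h0 : c 0 = d 0) : ∀ t ∈ Icc 0 T, c t = d t := by
  -- Any order above 5/2 would do, since exponentially decaying families belong to all of them.
  obtain ⟨C, hC0, hC⟩ := exists_energy_bound (r := 3) (by norm_num)
  obtain ⟨A, α, hα, hA, hmaj⟩ := UniformDecay.exists_majorant 3 (s := Icc 0 T) hρ hK
  set ℓ : ℝ := C * (α + α) + 1 with hℓ
  have hℓ0 : 0 < ℓ := by positivity
  -- The auxiliary radius starts at ρ/2 and falls with the slope ℓ demanded by the energy estimate,
  -- so it stays nonnegative for this length of time. As ρ, K and hence δ are uniform in time,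
  -- finitely many restarts reach T.
  set δ : ℝ := ρ / 2 / ℓ with hδ
  have hδ0 : 0 < δ := by positivity
  have hstep : ∀ a b, 0 ≤ a → b ≤ T → b ≤ a + δ → c a = d a → ∀ t ∈ Icc a b, c t = d t := by
    intro a b ha hb hab hcd t ht
    have hsub : Icc a b ⊆ Icc 0 T := Icc_subset_Icc ha hb
    have hle : ∀ t ∈ Icc a b, ρ / 2 + ℓ * a - ℓ * t ≤ ρ / 2 := fun t ht => by nlinarith [ht.1]
    have h := hC Ω a b (ρ / 2 + ℓ * a) ℓ c d A A α α (hc.mono ha hb) (hd.mono ha hb) (by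
        intro t ht
        have h1 : t - a ≤ δ := by linarith [ht.2]
        have h2 : ℓ * (t - a) ≤ ℓ * δ := by gcongr
        have h3 : ℓ * δ = ρ / 2 := by rw [hδ]; field_simp
        linarith)
      (fun t ht => hmaj c hcK t (hsub ht) _ (hle t ht))
      (fun t ht => hmaj d hdK t (hsub ht) _ (hle t ht)) hα hα hA hA (by linarith) t ht
    rw [hcd, sub_self, coefNormSq_zero] at h
    exact sub_eq_zero.mp (eq_zero_of_coefNormSq_eq_zero (le_antisymm h zero_le))
  have hind : ∀ n : ℕ, ∀ t ∈ Icc 0 T, t ≤ n * δ → c t = d t := by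
    intro n
    induction n with
    | zero =>
      intro t ht htn
      have : t = 0 := le_antisymm (by simpa using htn) ht.1
      rw [this, h0]
    | succ n ih =>
      intro t ht htn
      rcases le_total t (n * δ) with h | h
      · exact ih t ht h
      · have ha : (0 : ℝ) ≤ n * δ := by positivity
        refine hstep (n * δ) t ha ht.2 ?_ (ih _ ⟨ha, h.trans ht.2⟩ le_rfl) t ⟨h, le_rfl⟩
        push_cast at htn
        linarith
  intro t ht
  obtain ⟨n, hn⟩ := exists_nat_ge (t / δ)
  exact hind n t ht ((div_le_iff₀ hδ0).mp hn)


open UnitAddTorus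

/-! ### Functions represented by exponentially decaying Fourier series -/

instance : IsProbabilityMeasure vol3 := by unfold vol3; infer_instance

theorem norm_mFourier_apply (k : Freq) (x : Torus3) : ‖mFourier k x‖ = 1 := by
  simp only [mFourier, ContinuousMap.coe_mk, norm_prod, fourier_apply]
  exact Finset.prod_eq_one fun i _ => Circle.norm_coe _

theorem mFourierCoeff_def (f : Torus3 → ℂ) (k : Freq) :
    mFourierCoeff f k = ∫ x, mFourier (-k) x * f x ∂vol3 := rfl

theorem fourier_add_apply {T : ℝ} (n : ℤ) (x y : AddCircle T) :
    fourier n (x + y) = fourier n x * fourier n y := by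
  simp [fourier_apply, smul_add, AddCircle.toCircle_add]

theorem mFourier_add_single (k : Freq) (x : Torus3) (j : Fin 3) (h : ℝ) :
    mFourier k (x + Pi.single j (h : UnitAddCircle)) =
      mFourier k x * Complex.exp (2 * Real.pi * Complex.I * k j * h) := by
  have h1 : ∀ i, fourier (k i) ((x + (Pi.single j (h : UnitAddCircle) : Torus3) : Torus3) i) =
      fourier (k i) (x i) * fourier (k i) ((Pi.single j (h : UnitAddCircle) : Torus3) i) :=
    fun i => fourier_add_apply _ _ _
  simp only [mFourier, ContinuousMap.coe_mk, h1, Finset.prod_mul_distrib]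
  congr 1
  rw [Finset.prod_eq_single j]
  · rw [Pi.single_eq_same, fourier_coe_apply]
    simp
  · intro i _ hi
    rw [Pi.single_eq_of_ne hi]
    simp
  · simp

/-- The frequency with the vertical component removed. -/
def horizontal (k : Freq) : Freq := Function.update k 2 0

theorem mFourier_update (k : Freq) (x : Torus3) (s : UnitAddCircle) :
    mFourier k (Function.update x 2 s) = mFourier (horizontal k) x * fourier (k 2) s := by
  simp [mFourier, horizontal, Fin.prod_univ_three]

theorem mFourier_horizontal_of_eq_zero {k : Freq} (hk : k 2 = 0) : horizontal k = k := by
  rw [horizontal, ← hk, Function.update_eq_self]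

theorem integral_fourier (n : ℤ) :
    ∫ s : UnitAddCircle, fourier n s ∂AddCircle.haarAddCircle = if n = 0 then 1 else 0 := by
  split_ifs with h
  · subst h; simp
  · exact integral_eq_zero_of_add_right_eq_neg (μ := AddCircle.haarAddCircle)
      (fourier_add_half_inv_index h one_pos)

/-- The change of variables `(k, j) ↦ (j, k - j)` in convolutions. -/
def convEquiv : Freq × Freq ≃ Freq × Freq where
  toFun p := (p.2, p.1 - p.2)
  invFun p := (p.1 + p.2, p.1)
  left_inv p := by simp
  right_inv p := by simp

/-- The Cauchy product over ℤ³: absolute convergence permits summing over pairs, grouped by the sum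
of the two frequencies. -/
theorem hasSum_convolution {u v w : Freq → ℂ} {p q : ℂ} (hu : HasSum u p) (hv : HasSum v q)
    (hu' : Summable fun k => ‖u k‖) (hv' : Summable fun k => ‖v k‖)
    (hw : ∀ k, HasSum (fun j => u j * v (k - j)) (w k)) : HasSum w (p * q) := by
  have h1 : HasSum (fun x : Freq × Freq => u x.1 * v x.2) (p * q) :=
    hu.mul hv (summable_mul_of_summable_norm hu' hv')
  have h2 : HasSum (fun x : Freq × Freq => u x.2 * v (x.1 - x.2)) (p * q) :=
    (convEquiv.hasSum_iff).mpr h1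
  exact h2.prod_fiberwise hw

/-- The real function `f` is the sum of the Fourier series with exponentially decaying
coefficients `a`. -/
structure Rep (f : Torus3 → ℝ) (a : Freq → ℂ) : Prop where
  decay : ExpDecay a
  hasSum : ∀ x, HasSum (fun k => a k * mFourier k x) (f x : ℂ)

namespace Rep

variable {f g : Torus3 → ℝ} {a b : Freq → ℂ}

theorem congr_coef (h : Rep f a) (hab : ∀ k, a k = b k) : Rep f b := by
  rwa [← funext hab]

theorem congr_fun (h : Rep f a) (hfg : ∀ x, f x = g x) : Rep g a := by
  rwa [← funext hfg]

theorem ext (hf : Rep f a) (hg : Rep g a) : f = g := by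
  ext x
  exact_mod_cast (hf.hasSum x).unique (hg.hasSum x)

theorem summable_norm (h : Rep f a) (x : Torus3) : Summable fun k => ‖a k * mFourier k x‖ := by
  simpa [norm_mFourier_apply] using h.decay.summable_norm

theorem add (hf : Rep f a) (hg : Rep g b) : Rep (fun x => f x + g x) fun k => a k + b k :=
  ⟨hf.decay.add hg.decay, fun x => by
    simpa [add_mul] using (hf.hasSum x).add (hg.hasSum x)⟩

theorem const_mul (hf : Rep f a) (c : ℝ) : Rep (fun x => c * f x) fun k => c * a k :=
  ⟨hf.decay.const_mul c, fun x => by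
    simpa [mul_assoc] using (hf.hasSum x).mul_left (c : ℂ)⟩

theorem neg (hf : Rep f a) : Rep (fun x => -f x) fun k => -a k := by
  simpa using hf.const_mul (-1)

theorem sub (hf : Rep f a) (hg : Rep g b) : Rep (fun x => f x - g x) fun k => a k - b k := by
  simpa [sub_eq_add_neg] using hf.add hg.neg

theorem zero : Rep (fun _ => 0) fun _ => 0 :=
  ⟨⟨1, 0, one_pos, by simp⟩, fun x => by simp⟩

theorem mul (hf : Rep f a) (hg : Rep g b) :
    Rep (fun x => f x * g x) fun k => ∑' j, a j * b (k - j) := by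
  refine ⟨(hf.decay.conv hg.decay).1, fun x => ?_⟩
  rw [Complex.ofReal_mul]
  refine hasSum_convolution (hf.hasSum x) (hg.hasSum x) (hf.summable_norm x) (hg.summable_norm x)
    fun k => ?_
  refine (((hf.decay.conv hg.decay).2 k).hasSum.mul_right (mFourier k x)).congr_fun fun j => ?_
  have : mFourier k x = mFourier j x * mFourier (k - j) x := by
    rw [← mFourier_add, add_sub_cancel]
  rw [this]
  ring

theorem continuous_ofReal (h : Rep f a) : Continuous fun x => (f x : ℂ) := by
  have h1 : (fun x => (f x : ℂ)) = fun x => ∑' k, a k * mFourier k x := by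
    ext x; exact (h.hasSum x).tsum_eq.symm
  rw [h1]
  exact continuous_tsum (fun k => continuous_const.mul (mFourier k).continuous)
    h.decay.summable_norm fun k x => by simp [norm_mFourier_apply]

theorem continuous (h : Rep f a) : Continuous f :=
  Complex.continuous_re.comp h.continuous_ofReal

theorem _root_.InviscidPE.mFourierCoeff_mFourier (k l : Freq) :
    mFourierCoeff (fun x => mFourier k x) l = if k = l then 1 else 0 := by
  have h := orthonormal_iff_ite.mp (orthonormal_mFourier (d := Fin 3)) l k
  rw [ContinuousMap.inner_toLp] at h
  simp only [eq_comm (a := k)]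
  rw [← h, mFourierCoeff]
  refine integral_congr_ae (Filter.Eventually.of_forall fun x => ?_)
  simp [mFourier_neg, mul_comm]

/-- Uniform absolute convergence allows integration term by term, and orthogonality picks out one
coefficient. -/
theorem mFourierCoeff_eq (h : Rep f a) (k : Freq) :
    mFourierCoeff (fun x => (f x : ℂ)) k = a k := by
  have h1 : ∀ l, Integrable (fun x => mFourier (-k) x * (a l * mFourier l x)) vol3 := fun l =>
    (((mFourier (-k)).continuous.mul
      (continuous_const.mul (mFourier l).continuous)).integrable_of_hasCompactSupport
      (HasCompactSupport.of_compactSpace _))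
  have h2 := hasSum_integral_of_summable_integral_norm h1 (by
    simpa [norm_mFourier_apply] using h.decay.summable_norm)
  have h3 : ∀ l, ∫ x, mFourier (-k) x * (a l * mFourier l x) ∂vol3 = if l = k then a l else 0 := by
    intro l
    have h4 := mFourierCoeff_mFourier l k
    rw [mFourierCoeff_def] at h4
    have h5 : ∀ x, mFourier (-k) x * (a l * mFourier l x) =
        a l * (mFourier (-k) x * mFourier l x) := fun x => by ring
    simp_rw [h5]
    rw [integral_const_mul, h4]
    simp
  simp_rw [h3] at h2
  have h6 := h2.unique (hasSum_ite_eq k (a k) |>.congr_fun fun l => by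
    split_ifs with hl <;> simp [hl])
  have h7 : ∀ x, ∑' l, mFourier (-k) x * (a l * mFourier l x) = mFourier (-k) x * f x := fun x =>
    ((h.hasSum x).mul_left _).tsum_eq
  simp_rw [h7] at h6
  exact h6

theorem of_continuous (hf : Continuous f)
    (h : ExpDecay fun k => mFourierCoeff (fun x => (f x : ℂ)) k) :
    Rep f fun k => mFourierCoeff (fun x => (f x : ℂ)) k := by
  refine ⟨h, fun x => ?_⟩
  let F : C(Torus3, ℂ) := ⟨fun x => (f x : ℂ), Complex.continuous_ofReal.comp hf⟩
  have := hasSum_mFourier_series_apply_of_summable (f := F) h.summable_norm.of_norm x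
  simpa [F] using this

theorem conj_symm (h : Rep f a) (k : Freq) : a (-k) = (starRingEnd ℂ) (a k) := by
  rw [← h.mFourierCoeff_eq, ← h.mFourierCoeff_eq, mFourierCoeff, mFourierCoeff, ← integral_conj]
  refine integral_congr_ae (Filter.Eventually.of_forall fun x => ?_)
  simp [mFourier_neg]

/-- Replacing k by -k shows that the sum equals its conjugate, so taking the real part loses
nothing. -/
theorem of_symm (ha : ExpDecay a) (h : ∀ k, a (-k) = (starRingEnd ℂ) (a k)) :
    Rep (fun x => (∑' k, a k * mFourier k x).re) a := by
  refine ⟨ha, fun x => ?_⟩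
  have hs : Summable fun k => a k * mFourier k x := Summable.of_norm
    (by simpa [norm_mFourier_apply] using ha.summable_norm)
  have h1 : (starRingEnd ℂ) (∑' k, a k * mFourier k x) = ∑' k, a k * mFourier k x := by
    rw [Complex.conj_tsum]
    refine Eq.trans ?_ ((Equiv.neg Freq).tsum_eq fun k => a k * mFourier k x)
    refine tsum_congr fun k => ?_
    simp [h, mFourier_neg]
  rw [Complex.conj_eq_iff_re.mp h1]
  exact hs.hasSum

/-- The differentiated series still decays exponentially, hence is dominated by a summable sequence
along each coordinate line, and termwise differentiation applies. -/
theorem pderiv (h : Rep f a) (j : Fin 3) :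
    Rep (pderiv j f) fun k => 2 * Real.pi * Complex.I * (k j * a k) := by
  have hd : ExpDecay fun k : Freq => 2 * Real.pi * Complex.I * (k j * a k) :=
    (h.decay.freq_mul j).const_mul _
  refine ⟨hd, fun x => ?_⟩
  have hsum : Summable fun k : Freq => (2 * Real.pi * Complex.I * (k j * a k)) * mFourier k x :=
    Summable.of_norm (by simpa [norm_mFourier_apply] using hd.summable_norm)
  let G : Freq → ℝ → ℂ := fun k y =>
    a k * (mFourier k x * Complex.exp (2 * Real.pi * Complex.I * k j * y))
  let G' : Freq → ℝ → ℂ := fun k y => (2 * Real.pi * Complex.I * (k j * a k)) *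
    (mFourier k x * Complex.exp (2 * Real.pi * Complex.I * k j * y))
  have hnorm : ∀ (k : Freq) (y : ℝ),
      ‖Complex.exp (2 * Real.pi * Complex.I * k j * y)‖ = 1 := by
    intro k y
    rw [Complex.norm_exp]
    simp
  have hG : ∀ k y, HasDerivAt (G k) (G' k y) y := by
    intro k y
    have h1 : HasDerivAt (fun y : ℝ => 2 * Real.pi * Complex.I * k j * (y : ℂ))
        (2 * Real.pi * Complex.I * k j) y := by
      simpa using (Complex.ofRealCLM.hasDerivAt (x := y)).const_mul
        (2 * Real.pi * Complex.I * (k j : ℂ))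
    refine ((h1.cexp.const_mul (mFourier k x)).const_mul (a k)).congr_deriv ?_
    simp only [G']
    ring
  have hG' : ∀ k y, ‖G' k y‖ ≤ ‖2 * Real.pi * Complex.I * (k j * a k)‖ := by
    intro k y
    simp only [G']
    rw [norm_mul _ (mFourier k x * _), norm_mul (mFourier k x), hnorm, norm_mFourier_apply]
    simp
  have h0 : ∀ y : ℝ, HasSum (fun k => G k y) (f (x + Pi.single j (y : UnitAddCircle)) : ℂ) := by
    intro y
    refine (h.hasSum (x + Pi.single j (y : UnitAddCircle))).congr_fun fun k => ?_
    rw [mFourier_add_single]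
  have h2 := hasDerivAt_tsum hd.summable_norm hG hG' (h0 0).summable 0
  have h3 : (fun y : ℝ => ∑' k, G k y) =
      fun y : ℝ => (f (x + Pi.single j (y : UnitAddCircle)) : ℂ) := by
    ext y; exact (h0 y).tsum_eq
  rw [h3] at h2
  have h4 : HasDerivAt (fun y : ℝ => f (x + Pi.single j (y : UnitAddCircle)))
      (∑' k, G' k 0).re 0 := by
    have : HasDerivAt (fun y : ℝ => Complex.reCLM (f (x + Pi.single j (y : UnitAddCircle)) : ℂ))
        (Complex.reCLM (∑' k, G' k 0)) 0 := Complex.reCLM.hasFDerivAt.comp_hasDerivAt (0 : ℝ) h2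
    simpa only [Complex.reCLM_apply, Complex.ofReal_re] using this
  have h5 := h4.ofReal_comp.unique h2
  have h6 : InviscidPE.pderiv j f x = (∑' k, G' k 0).re := h4.deriv
  rw [h6, h5]
  have h7 : (∑' k, G' k 0) = ∑' k : Freq, (2 * Real.pi * Complex.I * (k j * a k)) * mFourier k x :=
    tsum_congr fun k => by simp [G']
  rw [h7]
  exact hsum.hasSum

theorem vertical_average (h : Rep f a) :
    Rep (fun x => ∫ s : UnitAddCircle, f (Function.update x 2 s) ∂AddCircle.haarAddCircle)
      fun k => if k 2 = 0 then a k else 0 := by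
  refine ⟨h.decay.mono fun k => by split_ifs <;> simp, fun x => ?_⟩
  have h1 : ∀ k, Integrable (fun s : UnitAddCircle => a k * mFourier k (Function.update x 2 s))
      AddCircle.haarAddCircle := by
    intro k
    simp_rw [mFourier_update]
    exact ((continuous_const.mul (continuous_const.mul
      (fourier (k 2)).continuous)).integrable_of_hasCompactSupport
        (HasCompactSupport.of_compactSpace _))
  have h2 := hasSum_integral_of_summable_integral_norm h1 (by
    simpa [norm_mFourier_apply] using h.decay.summable_norm)
  have h3 : ∀ s : UnitAddCircle, ∑' k, a k * mFourier k (Function.update x 2 s) =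
      (f (Function.update x 2 s) : ℂ) := fun s => (h.hasSum _).tsum_eq
  simp_rw [h3, integral_complex_ofReal] at h2
  refine h2.congr_fun fun k => ?_
  simp_rw [mFourier_update, ← mul_assoc]
  rw [integral_const_mul, integral_fourier]
  split_ifs with hk
  · rw [mFourier_horizontal_of_eq_zero hk, mul_one]
  · simp

/-- Reflection of the vertical frequency. -/
def _root_.InviscidPE.reflectFreq : Freq ≃ Freq where
  toFun k := Function.update k 2 (-(k 2))
  invFun k := Function.update k 2 (-(k 2))
  left_inv k := by simp
  right_inv k := by simp

theorem _root_.InviscidPE.reflectFreq_apply (k : Freq) :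
    reflectFreq k = Function.update k 2 (-(k 2)) := rfl

theorem _root_.InviscidPE.horizontal_reflectFreq (k : Freq) :
    horizontal (reflectFreq k) = horizontal k := by
  rw [horizontal, reflectFreq_apply, Function.update_idem, horizontal]

theorem _root_.InviscidPE.reflectFreq_two (k : Freq) : reflectFreq k 2 = -(k 2) := by
  rw [reflectFreq_apply, Function.update_self]

/-- Integrating each exponential from 0 to z leaves a boundary term at z = 0. Evenness makes these
terms odd in k₃, so they add up to zero; without it the primitive would contain an extra function of
the horizontal variables. The absence of modes with k₃ = 0 keeps the primitive periodic. -/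
theorem vprim (h : Rep f a) (h0 : ∀ k, k 2 = 0 → a k = 0) (heven : ∀ k, a (reflectFreq k) = a k) :
    Rep (vprim f) fun k => a k / (2 * Real.pi * Complex.I * k 2) := by
  have hd : ExpDecay fun k : Freq => a k / (2 * Real.pi * Complex.I * k 2) := by
    refine h.decay.mono fun k => ?_
    by_cases hk : k 2 = 0
    · simp [hk]
    · rw [norm_div]
      refine div_le_self (norm_nonneg _) ?_
      have h1 : (1 : ℝ) ≤ |(k 2 : ℝ)| := by exact_mod_cast Int.one_le_abs hk
      simp only [norm_mul, Complex.norm_ofNat, Complex.norm_real, Complex.norm_I, mul_one,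
        Complex.norm_intCast, Real.norm_eq_abs, abs_of_pos Real.pi_pos]
      nlinarith [Real.pi_gt_three]
  refine ⟨hd, fun x => ?_⟩
  set z : ℝ := (AddCircle.equivIco (1 : ℝ) 0 (x 2) : ℝ) with hz
  have hzx : (z : UnitAddCircle) = x 2 := AddCircle.coe_equivIco
  have hval : ∀ (k : Freq) (s : ℝ), a k * mFourier k (Function.update x 2 (s : UnitAddCircle)) =
      a k * mFourier (horizontal k) x * Complex.exp (2 * Real.pi * Complex.I * k 2 * s) := by
    intro k s
    rw [mFourier_update, fourier_coe_apply, mul_assoc]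
    simp [mul_assoc]
  have hnorm : ∀ (k : Freq) (s : ℝ),
      ‖a k * mFourier (horizontal k) x * Complex.exp (2 * Real.pi * Complex.I * k 2 * s)‖ =
        ‖a k‖ := by
    intro k s
    rw [norm_mul, norm_mul, norm_mFourier_apply, Complex.norm_exp]
    simp
  have h1 := intervalIntegral.hasSum_integral_of_dominated_convergence (μ := volume) (a := 0)
    (b := z) (F := fun (k : Freq) (s : ℝ) =>
      a k * mFourier (horizontal k) x * Complex.exp (2 * Real.pi * Complex.I * k 2 * s))
    (f := fun s : ℝ => (f (Function.update x 2 (s : UnitAddCircle)) : ℂ)) (fun k _ => ‖a k‖)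
    (fun k => (by fun_prop : Continuous fun s : ℝ => a k * mFourier (horizontal k) x *
      Complex.exp (2 * Real.pi * Complex.I * k 2 * s)).aestronglyMeasurable)
    (fun k => Filter.Eventually.of_forall fun s _ => (hnorm k s).le)
    (Filter.Eventually.of_forall fun s _ => h.decay.summable_norm)
    (by simp)
    (Filter.Eventually.of_forall fun s _ => by
      simp_rw [← hval]; exact h.hasSum _)
  rw [intervalIntegral.integral_ofReal] at h1
  have h2 : ∀ k : Freq, ∫ s in (0 : ℝ)..z, a k * mFourier (horizontal k) x *
      Complex.exp (2 * Real.pi * Complex.I * k 2 * s) =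
      a k / (2 * Real.pi * Complex.I * k 2) * mFourier k x -
        a k / (2 * Real.pi * Complex.I * k 2) * mFourier (horizontal k) x := by
    intro k
    by_cases hk : k 2 = 0
    · simp [h0 k hk]
    · have hk' : (2 * Real.pi * Complex.I * k 2 : ℂ) ≠ 0 := by
        have : (k 2 : ℂ) ≠ 0 := by exact_mod_cast hk
        simp [Real.pi_ne_zero, this]
      have hx : mFourier k x = mFourier (horizontal k) x *
          Complex.exp (2 * Real.pi * Complex.I * k 2 * z) := by
        have := mFourier_update k x (z : UnitAddCircle)
        rw [hzx, Function.update_eq_self, ← hzx, fourier_coe_apply] at this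
        rw [this]
        simp
      rw [intervalIntegral.integral_const_mul, integral_exp_mul_complex hk', hx]
      simp
      ring
  simp_rw [h2] at h1
  have hs : Summable fun k : Freq =>
      a k / (2 * Real.pi * Complex.I * k 2) * mFourier (horizontal k) x :=
    Summable.of_norm (by simpa [norm_mFourier_apply] using hd.summable_norm)
  -- Reflecting k₃ changes the sign of the denominator only, so the sum equals its own negative.
  have h3 : ∑' k : Freq, a k / (2 * Real.pi * Complex.I * k 2) * mFourier (horizontal k) x = 0 := by
    have h4 := reflectFreq.tsum_eq
      (fun k : Freq => a k / (2 * Real.pi * Complex.I * k 2) * mFourier (horizontal k) x)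
    simp only [heven, horizontal_reflectFreq, reflectFreq_two, Int.cast_neg, mul_neg, div_neg,
      neg_mul] at h4
    rw [tsum_neg] at h4
    exact self_eq_neg.mp h4.symm
  have h5 := h1.add hs.hasSum
  rw [h3, add_zero] at h5
  simp only [sub_add_cancel] at h5
  exact h5

/-- The denominators are at least 4π² except where the division by zero gives 0, so decay is
preserved; conjugation symmetry makes the real part in the definition redundant. -/
theorem invLaplacian (h : Rep f a) : Rep (invLaplacian f) fun k =>
    -(a k / (4 * (Real.pi : ℂ) ^ 2 * ((k 0 : ℂ) ^ 2 + (k 1 : ℂ) ^ 2))) := by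
  have hd : ExpDecay fun k : Freq =>
      -(a k / (4 * (Real.pi : ℂ) ^ 2 * ((k 0 : ℂ) ^ 2 + (k 1 : ℂ) ^ 2))) := by
    refine h.decay.mono fun k => ?_
    rw [norm_neg, norm_div]
    by_cases hk : (k 0) ^ 2 + (k 1) ^ 2 = 0
    · have : ((k 0 : ℂ) ^ 2 + (k 1 : ℂ) ^ 2) = 0 := by exact_mod_cast hk
      simp [this]
    · refine div_le_self (norm_nonneg _) ?_
      have h1 : (1 : ℝ) ≤ (k 0 : ℝ) ^ 2 + (k 1 : ℝ) ^ 2 := by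
        have : 0 < (k 0) ^ 2 + (k 1) ^ 2 := lt_of_le_of_ne (by positivity) (Ne.symm hk)
        exact_mod_cast this
      have h2 : (4 * (Real.pi : ℂ) ^ 2 * ((k 0 : ℂ) ^ 2 + (k 1 : ℂ) ^ 2)) =
          ((4 * Real.pi ^ 2 * ((k 0 : ℝ) ^ 2 + (k 1 : ℝ) ^ 2) : ℝ) : ℂ) := by push_cast; ring
      rw [h2, Complex.norm_real, Real.norm_of_nonneg (by positivity)]
      nlinarith [Real.pi_gt_three]
  have h1 := of_symm hd fun k => by
    rw [h.conj_symm]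
    simp [Complex.conj_ofNat]
  refine h1.congr_fun fun x => ?_
  simp only [InviscidPE.invLaplacian, h.mFourierCoeff_eq]

end Rep


/-! ### The differential operators on Fourier coefficients -/

/-- The vector field `v` has the exponentially decaying Fourier coefficients `c`. -/
def VRep (v : VField) (c : Coef) : Prop := ∀ i, Rep (fun x => v x i) fun k => c k i

theorem VRep.congr_coef {v : VField} {c d : Coef} (h : VRep v c) (hcd : ∀ k, c k = d k) :
    VRep v d := by
  rwa [← funext hcd]

/-- A function whose Fourier coefficients are given by convolution sums. -/
structure ConvRep (f : Torus3 → ℝ) (p : Freq → Freq → ℂ) : Prop where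
  rep : Rep f fun k => ∑' j, p k j
  summable : ∀ k, Summable (p k)

namespace ConvRep

variable {f g : Torus3 → ℝ} {p q : Freq → Freq → ℂ}

theorem of_mul {a b : Freq → ℂ} (hf : Rep f a) (hg : Rep g b) :
    ConvRep (fun x => f x * g x) fun k j => a j * b (k - j) :=
  ⟨hf.mul hg, (hf.decay.conv hg.decay).2⟩

theorem congr_coef (h : ConvRep f p) (hpq : ∀ k j, p k j = q k j) : ConvRep f q := by
  rwa [← funext fun k => funext (hpq k)]

theorem add (hf : ConvRep f p) (hg : ConvRep g q) :
    ConvRep (fun x => f x + g x) fun k j => p k j + q k j :=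
  ⟨(hf.rep.add hg.rep).congr_coef fun k =>
    ((hf.summable k).tsum_add (hg.summable k)).symm, fun k => (hf.summable k).add (hg.summable k)⟩

theorem sub (hf : ConvRep f p) (hg : ConvRep g q) :
    ConvRep (fun x => f x - g x) fun k j => p k j - q k j :=
  ⟨(hf.rep.sub hg.rep).congr_coef fun k =>
    ((hf.summable k).tsum_sub (hg.summable k)).symm, fun k => (hf.summable k).sub (hg.summable k)⟩

theorem vertical_average (h : ConvRep f p) :
    ConvRep (fun x => ∫ s : UnitAddCircle, f (Function.update x 2 s) ∂AddCircle.haarAddCircle)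
      fun k j => if k 2 = 0 then p k j else 0 := by
  refine ⟨h.rep.vertical_average.congr_coef fun k => ?_, fun k => ?_⟩
  · split_ifs <;> simp
  · split_ifs
    · exact h.summable k
    · exact summable_zero

end ConvRep

theorem Rep.hdiv {v : VField} {c : Coef} (h : VRep v c) :
    Rep (hdiv v) fun k => 2 * Real.pi * Complex.I * (k 0 * c k 0 + k 1 * c k 1) :=
  (((h 0).pderiv 0).add ((h 1).pderiv 1)).congr_coef fun k => by ring

theorem ConvRep.advect {u v : VField} {a b : Coef} (hu : VRep u a) (hv : VRep v b) (i : Fin 2) :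
    ConvRep (fun x => advect u v x i) fun k j => 2 * Real.pi * Complex.I *
      ((a j 0 * (k - j) 0 + a j 1 * (k - j) 1) * b (k - j) i) :=
  ((ConvRep.of_mul (hu 0) ((hv i).pderiv 0)).add
    (ConvRep.of_mul (hu 1) ((hv i).pderiv 1))).congr_coef fun k j => by ring

theorem ConvRep.selfFlux {w : VField} {a : Coef} (hw : VRep w a) (i : Fin 2) :
    ConvRep (fun x => selfFlux w x i) fun k j => 2 * Real.pi * Complex.I *
      ((j 0 * a j 0 + j 1 * a j 1 + (a j 0 * (k - j) 0 + a j 1 * (k - j) 1)) * a (k - j) i) :=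
  ((ConvRep.of_mul (Rep.hdiv hw) (hw i)).add (ConvRep.advect hw hw i)).congr_coef
    fun k j => by ring

/-- For a field independent of z the multiplier of ∇Δ⁻¹∇· is the one in `lerayCoef`. Independence of
z is needed because `lerayCoef` is the identity at k₃ ≠ 0. -/
theorem VRep.leray {F : VField} {C : Coef} (h : VRep F C) (h0 : ∀ k, k 2 ≠ 0 → C k = 0) :
    VRep (leray F) fun k => lerayCoef k (C k) := by
  have key : ∀ (i : Fin 2) (k : Freq), C k i - 2 * Real.pi * Complex.I * ((k i.castSucc : ℂ) *
      -(2 * Real.pi * Complex.I * (k 0 * C k 0 + k 1 * C k 1) /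
        (4 * (Real.pi : ℂ) ^ 2 * ((k 0 : ℂ) ^ 2 + (k 1 : ℂ) ^ 2)))) = lerayCoef k (C k) i := by
    intro i k
    by_cases hk : k 2 = 0
    · simp only [lerayCoef, LinearMap.coe_mk, AddHom.coe_mk, if_pos hk]
      by_cases hd : ((k 0 : ℂ) ^ 2 + (k 1 : ℂ) ^ 2) = 0
      · simp [hd]
      · have hpi : (Real.pi : ℂ) ≠ 0 := by exact_mod_cast Real.pi_ne_zero
        have hI := Complex.I_sq
        field_simp
        rw [hI]
        ring
    · simp [lerayCoef, if_neg hk, h0 k hk]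
  intro i
  have hq := (Rep.hdiv h).invLaplacian
  fin_cases i
  · exact ((h 0).sub (hq.pderiv 0)).congr_coef (key 0)
  · exact ((h 1).sub (hq.pderiv 1)).congr_coef (key 1)

/-- The coefficient families of a barotropic and a baroclinic mode. -/
structure ModeCoefs (cb ct : Coef) : Prop where
  bar : ∀ k, k 2 ≠ 0 → cb k = 0
  tilde : ∀ k, k 2 = 0 → ct k = 0
  even : ∀ k, ct (reflectFreq k) = ct k

theorem transportCoef_eq_tsum (u v : Coef) (k : Freq) (i : Fin 2) :
    transportCoef u v k i = ∑' j, 2 * Real.pi * Complex.I *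
      (transportSymbol j (k - j) (u j) * v (k - j) i) := by
  rw [transportCoef, tsum_mul_left]

/-- Averaging in z turns the vertical transport -(∫₀^z ∇·ṽ)∂_z ṽ into (∇·ṽ)ṽ by integration by
parts. Hence the two projected terms together are the barotropic part of the combined transport
term. -/
theorem VRep.barotropicTerm {vb vt : VField} {cb ct : Coef} (hb : VRep vb cb) (ht : VRep vt ct)
    (hm : ModeCoefs cb ct) :
    VRep (barotropicTerm vb vt) fun k =>
      if k 2 = 0 then nonlin (cb + ct) (cb + ct) k else 0 := by
  set Ca : Coef := fun k i => ∑' j, 2 * Real.pi * Complex.I *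
      ((cb j 0 * (k - j) 0 + cb j 1 * (k - j) 1) * cb (k - j) i) with hCa
  set Cf : Coef := fun k i => ∑' j, if k 2 = 0 then 2 * Real.pi * Complex.I *
      ((j 0 * ct j 0 + j 1 * ct j 1 + (ct j 0 * (k - j) 0 + ct j 1 * (k - j) 1)) * ct (k - j) i)
      else 0 with hCf
  have ha : VRep (advect vb vb) Ca := fun i => (ConvRep.advect hb hb i).rep
  have hf : VRep (P0 (selfFlux vt)) Cf := fun i => (ConvRep.selfFlux ht i).vertical_average.rep
  have ha0 : ∀ k, k 2 ≠ 0 → Ca k = 0 := by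
    intro k hk
    ext i
    refine (tsum_congr fun j => ?_).trans tsum_zero
    by_cases hj : j 2 = 0
    · have : cb (k - j) = 0 := hm.bar _ (by simpa [hj] using hk)
      simp [this]
    · simp [hm.bar j hj]
  have hf0 : ∀ k, k 2 ≠ 0 → Cf k = 0 := by
    intro k hk
    ext i
    simp [hCf, hk]
  have h := fun i => ((ha.leray ha0) i).add ((hf.leray hf0) i)
  refine fun i => (h i).congr_coef fun k => ?_
  rw [← Pi.add_apply, ← map_add]
  by_cases hk : k 2 = 0
  · simp only [if_pos hk]
    suffices hC : Ca k + Cf k = transportCoef (cb + ct) (cb + ct) k by rw [nonlin, hC]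
    ext i
    rw [transportCoef_eq_tsum, Pi.add_apply, hCa, hCf]
    simp only [if_pos hk]
    have s1 := (ConvRep.advect hb hb i).summable k
    have s2 := (ConvRep.selfFlux ht i).summable k
    rw [← s1.tsum_add s2]
    refine tsum_congr fun j => ?_
    have hl : (k - j) 2 = -(j 2) := by simp [hk]
    by_cases hj : j 2 = 0
    · rw [hj, neg_zero] at hl
      simp [hm.tilde j hj, hm.tilde _ hl, transportSymbol, hj]
    -- Here l₃ = -j₃, so the quotient l₃/j₃ is -1 and the vertical part of the symbol becomes the
    -- divergence: the integration by parts on coefficients.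
    · have hj' : (j 2 : ℂ) ≠ 0 := by exact_mod_cast hj
      have hl' : (k - j) 2 ≠ 0 := by rw [hl]; simpa using hj
      simp only [hm.bar j hj, hm.bar _ hl', transportSymbol, hl, Pi.add_apply, Pi.zero_apply,
        zero_add, zero_mul, mul_zero, Int.cast_neg, mul_neg, div_mul_cancel₀ _ hj']
      ring
  · simp only [if_neg hk]
    rw [ha0 k hk, hf0 k hk]
    simp

/-- At k₃ = 0 the subtracted average removes exactly the mean of the transport terms. At k₃ ≠ 0 the
projection is trivial and there is no barotropic self-interaction, so the three advection terms and
the vertical one reassemble into the combined transport. -/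
theorem VRep.baroclinicTerm {vb vt : VField} {cb ct : Coef} (Ω : ℝ) (hb : VRep vb cb)
    (ht : VRep vt ct) (hm : ModeCoefs cb ct) :
    VRep (baroclinicTerm Ω vb vt) fun k =>
      if k 2 = 0 then 0 else
        nonlin (cb + ct) (cb + ct) k + (Ω : ℂ) • rotCoef k ((cb + ct) k) := by
  intro i
  have hdiv := Rep.hdiv ht
  have hvp := hdiv.vprim (fun k hk => by simp [hm.tilde k hk]) (fun k => by
    have h0 : reflectFreq k 0 = k 0 := by rw [reflectFreq_apply]; simp
    have h1 : reflectFreq k 1 = k 1 := by rw [reflectFreq_apply]; simp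
    rw [hm.even, h0, h1])
  have hperp : Rep (fun x => perp vt x i) fun k => rotCoef k (ct k) i := by
    fin_cases i
    · refine (ht 1).neg.congr_coef fun k => ?_
      by_cases hk : k 2 = 0 <;> simp [rotCoef, hk, hm.tilde]
    · refine (ht 0).congr_coef fun k => ?_
      by_cases hk : k 2 = 0 <;> simp [rotCoef, hk, hm.tilde]
  have hquad := ((((ConvRep.advect ht ht i).add (ConvRep.advect ht hb i)).add
    (ConvRep.advect hb ht i)).sub (ConvRep.selfFlux ht i).vertical_average).sub
    (ConvRep.of_mul hvp ((ht i).pderiv 2))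
  refine (hquad.rep.add (hperp.const_mul Ω)).congr_coef fun k => ?_
  have hpi : (2 * Real.pi * Complex.I : ℂ) ≠ 0 := by simp [Real.pi_ne_zero]
  have hvc : ∀ j : Freq, 2 * Real.pi * Complex.I * (j 0 * ct j 0 + j 1 * ct j 1) /
      (2 * Real.pi * Complex.I * (j 2 : ℂ)) = (j 0 * ct j 0 + j 1 * ct j 1) / j 2 := fun j =>
    mul_div_mul_left _ _ hpi
  by_cases hk : k 2 = 0
  · simp only [if_pos hk]
    rw [Pi.zero_apply, hm.tilde k hk, map_zero, Pi.zero_apply, mul_zero, add_zero]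
    refine (tsum_congr fun j => ?_).trans tsum_zero
    rw [hvc]
    have hl : (k - j) 2 = -(j 2) := by simp [hk]
    by_cases hj : j 2 = 0
    · rw [hj, neg_zero] at hl
      simp [hm.tilde j hj, hm.tilde _ hl]
    · have hj' : (j 2 : ℂ) ≠ 0 := by exact_mod_cast hj
      have hl' : (k - j) 2 ≠ 0 := by rw [hl]; simpa using hj
      simp only [hm.bar j hj, hm.bar _ hl', hl, Pi.zero_apply, Int.cast_neg]
      field_simp
      ring
  · simp only [if_neg hk]
    have hrot : rotCoef k ((cb + ct) k) = rotCoef k (ct k) := by simp [hm.bar k hk]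
    rw [Pi.add_apply, Pi.smul_apply, smul_eq_mul, hrot]
    congr 1
    simp only [nonlin, lerayCoef, LinearMap.coe_mk, AddHom.coe_mk, if_neg hk]
    rw [transportCoef_eq_tsum]
    refine tsum_congr fun j => ?_
    rw [hvc]
    have hl : (k - j) 2 = k 2 - j 2 := rfl
    by_cases hj : j 2 = 0
    -- The three remaining cases are v̄·∇ṽ, then ṽ·∇v̄ (no vertical part, as l₃ = 0), then ṽ
    -- transporting ṽ.
    · have hl' : (k - j) 2 ≠ 0 := by rw [hl, hj]; simpa using hk
      simp only [hm.tilde j hj, hm.bar _ hl', transportSymbol, Pi.add_apply, Pi.zero_apply, hj,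
        Int.cast_zero, div_zero]
      ring
    · by_cases hl' : (k - j) 2 = 0
      · simp only [hm.bar j hj, hm.tilde _ hl', transportSymbol, Pi.add_apply, Pi.zero_apply, hl',
          Int.cast_zero]
        ring
      · simp only [hm.bar j hj, hm.bar _ hl', transportSymbol, Pi.add_apply, Pi.zero_apply]
        ring


/-! ### Fourier coefficients of square integrable fields -/

/-- The z coordinate of the first argument is discarded and replaced by an independent uniform one;
it is enough to check boxes. -/
theorem measurePreserving_update :
    MeasurePreserving (fun p : Torus3 × UnitAddCircle => (Function.update p.1 2 p.2 : Torus3))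
      (vol3.prod AddCircle.haarAddCircle) vol3 := by
  have hmeas : Measurable (fun p : Torus3 × UnitAddCircle => (Function.update p.1 2 p.2 : Torus3)) :=
    (by fun_prop : Continuous fun p : Torus3 × UnitAddCircle =>
      (Function.update p.1 2 p.2 : Torus3)).measurable
  refine ⟨hmeas, ?_⟩
  symm
  refine Measure.pi_eq fun A hA => ?_
  rw [Measure.map_apply hmeas (MeasurableSet.univ_pi hA)]
  have hpre : (fun p : Torus3 × UnitAddCircle => (Function.update p.1 2 p.2 : Torus3)) ⁻¹'
      univ.pi A = (univ.pi (Function.update A 2 univ)) ×ˢ A 2 := by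
    ext ⟨x, s⟩
    simp [Fin.forall_fin_succ, Function.update]
    tauto
  rw [hpre, Measure.prod_prod, vol3, Measure.pi_pi]
  simp [Fin.prod_univ_three]

theorem measurePreserving_reflect :
    MeasurePreserving (fun x : Torus3 => (Function.update x 2 (-(x 2)) : Torus3)) vol3 vol3 := by
  have hmeas : Measurable (fun x : Torus3 => (Function.update x 2 (-(x 2)) : Torus3)) :=
    (by fun_prop : Continuous fun x : Torus3 =>
      (Function.update x 2 (-(x 2)) : Torus3)).measurable
  refine ⟨hmeas, ?_⟩
  symm
  refine Measure.pi_eq fun A hA => ?_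
  rw [Measure.map_apply hmeas (MeasurableSet.univ_pi hA)]
  have hpre : (fun x : Torus3 => (Function.update x 2 (-(x 2)) : Torus3)) ⁻¹'
      univ.pi A = univ.pi (Function.update A 2 (-(A 2))) := by
    ext x
    simp [Fin.forall_fin_succ, Function.update]
  rw [hpre, vol3, Measure.pi_pi]
  simp [Fin.prod_univ_three]

theorem fcoeff_def (v : VField) (i : Fin 2) (k : Freq) :
    fcoeff v i k = ∫ x, mFourier (-k) x * (v x i : ℂ) ∂vol3 := rfl

theorem integrable_component {v : VField} (hv : MemLp v 2 vol3) (i : Fin 2) :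
    Integrable (fun x => v x i) vol3 := by
  have h1 : Integrable v vol3 := hv.integrable (by norm_num)
  exact h1.eval i

theorem integrable_mFourier_mul (k : Freq) {f : Torus3 → ℝ} (hf : Integrable f vol3) :
    Integrable (fun x => mFourier k x * (f x : ℂ)) vol3 :=
  hf.ofReal.bdd_mul (mFourier k).continuous.aestronglyMeasurable
    (Filter.Eventually.of_forall fun x => (norm_mFourier_apply k x).le)

theorem fcoeff_congr {u v : VField} (h : u =ᵐ[vol3] v) (i : Fin 2) (k : Freq) :
    fcoeff u i k = fcoeff v i k := by
  rw [fcoeff_def, fcoeff_def]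
  refine integral_congr_ae ?_
  filter_upwards [h] with x hx
  rw [hx]

theorem fcoeff_zero_field (i : Fin 2) (k : Freq) : fcoeff 0 i k = 0 := by
  simp [fcoeff_def]

theorem fcoeff_sub {u v : VField} (hu : MemLp u 2 vol3) (hv : MemLp v 2 vol3) (i : Fin 2)
    (k : Freq) : fcoeff (u - v) i k = fcoeff u i k - fcoeff v i k := by
  rw [fcoeff_def, fcoeff_def, fcoeff_def, ← integral_sub
    (integrable_mFourier_mul _ (integrable_component hu i))
    (integrable_mFourier_mul _ (integrable_component hv i))]
  refine integral_congr_ae (Filter.Eventually.of_forall fun x => ?_)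
  simp only [Pi.sub_apply]
  push_cast
  ring

theorem fcoeff_neg_freq (v : VField) (i : Fin 2) (k : Freq) :
    fcoeff v i (-k) = (starRingEnd ℂ) (fcoeff v i k) := by
  rw [fcoeff_def, fcoeff_def, ← integral_conj]
  refine integral_congr_ae (Filter.Eventually.of_forall fun x => ?_)
  simp [mFourier_neg]

theorem fcoeff_mean_zero {v : VField} (hv : MemS v) (i : Fin 2) : fcoeff v i 0 = 0 := by
  rw [fcoeff_def]
  simp only [neg_zero, mFourier_zero, ContinuousMap.one_apply, one_mul]
  rw [integral_complex_ofReal, hv.mean_zero i, Complex.ofReal_zero]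

theorem mFourier_reflect (k : Freq) (x : Torus3) :
    mFourier (reflectFreq k) (Function.update x 2 (-(x 2))) = mFourier k x := by
  simp [mFourier, reflectFreq_apply, Fin.prod_univ_three]

theorem fcoeff_reflect {v : VField} (hv : EvenInZ v) (i : Fin 2) (k : Freq) :
    fcoeff v i (reflectFreq k) = fcoeff v i k := by
  have hemb : MeasurableEmbedding (fun x : Torus3 => (Function.update x 2 (-(x 2)) : Torus3)) := by
    have hc : Continuous (fun x : Torus3 => (Function.update x 2 (-(x 2)) : Torus3)) := by fun_prop
    refine hc.measurableEmbedding fun x y h => ?_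
    have h2 := congrArg (fun z : Torus3 => (Function.update z 2 (-(z 2)) : Torus3)) h
    simpa using h2
  rw [fcoeff_def, fcoeff_def, ← measurePreserving_reflect.integral_comp hemb]
  refine integral_congr_ae ?_
  filter_upwards [hv] with x hx
  have h1 : -reflectFreq k = reflectFreq (-k) := by
    ext j
    fin_cases j <;> simp [reflectFreq_apply]
  rw [hx, h1, mFourier_reflect]

/-- Fubini along the vertical fibres, for merely square integrable fields. At k₃ = 0 the exponential
is constant on fibres; at k₃ ≠ 0 the average is constant on fibres and the exponential integrates to
zero. -/
theorem fcoeff_P0 {v : VField} (hv : MemLp v 2 vol3) (i : Fin 2) (k : Freq) :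
    fcoeff (P0 v) i k = if k 2 = 0 then fcoeff v i k else 0 := by
  have hint := integrable_component hv i
  have hcomp : Integrable (fun p : Torus3 × UnitAddCircle => v (Function.update p.1 2 p.2) i)
      (vol3.prod AddCircle.haarAddCircle) :=
    measurePreserving_update.integrable_comp_of_integrable hint
  have hP0 : Integrable (fun x => P0 v x i) vol3 := hcomp.integral_prod_left
  by_cases hk : k 2 = 0
  · rw [if_pos hk, fcoeff_def, fcoeff_def]
    have hF := integrable_mFourier_mul (-k) hint
    have hF2 := measurePreserving_update.integrable_comp_of_integrable hF
    have h1 : ∫ x, mFourier (-k) x * (v x i : ℂ) ∂vol3 =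
        ∫ p, mFourier (-k) (Function.update p.1 2 p.2) * (v (Function.update p.1 2 p.2) i : ℂ)
          ∂(vol3.prod AddCircle.haarAddCircle) := by
      have := integral_map (μ := vol3.prod AddCircle.haarAddCircle)
        measurePreserving_update.measurable.aemeasurable
        (f := fun x => mFourier (-k) x * (v x i : ℂ))
        (by rw [measurePreserving_update.map_eq]; exact hF.aestronglyMeasurable)
      rwa [measurePreserving_update.map_eq] at this
    rw [h1]
    refine Eq.trans ?_ (integral_prod _ hF2).symm
    refine integral_congr_ae (Filter.Eventually.of_forall fun x => ?_)
    have hk' : (-k) 2 = 0 := by simp [hk]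
    simp only [Function.comp_apply, mFourier_update, mFourier_horizontal_of_eq_zero hk', hk', fourier_zero, mul_one]
    rw [integral_const_mul, integral_complex_ofReal]
    rfl
  · rw [if_neg hk, fcoeff_def]
    have hF := integrable_mFourier_mul (-k) hP0
    have hF2 := measurePreserving_update.integrable_comp_of_integrable hF
    have h1 := integral_map (μ := vol3.prod AddCircle.haarAddCircle)
        measurePreserving_update.measurable.aemeasurable
        (f := fun x => mFourier (-k) x * (P0 v x i : ℂ))
        (by rw [measurePreserving_update.map_eq]; exact hF.aestronglyMeasurable)
    rw [measurePreserving_update.map_eq] at h1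
    rw [h1]
    refine (integral_prod _ hF2).trans ?_
    have hinv : ∀ (x : Torus3) (s : UnitAddCircle), P0 v (Function.update x 2 s) i = P0 v x i := by
      intro x s
      simp [P0]
    have hk' : (-k) 2 ≠ 0 := by simpa using hk
    have hz : ∀ x : Torus3, ∫ s, mFourier (-k) (Function.update x 2 s) *
        (P0 v (Function.update x 2 s) i : ℂ) ∂AddCircle.haarAddCircle = 0 := by
      intro x
      simp only [hinv, mFourier_update]
      rw [integral_mul_const, integral_const_mul, integral_fourier, if_neg hk']
      simp
    simp only [Function.comp_apply, hz, integral_zero]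

/-- The Fourier coefficients of a field as a coefficient family. -/
noncomputable def fieldCoef (v : VField) : Coef := fun k i => fcoeff v i k

theorem VRep.fieldCoef_eq {v : VField} {c : Coef} (h : VRep v c) : fieldCoef v = c := by
  ext k i
  exact (h i).mFourierCoeff_eq k

theorem anormSq_eq (τ r : ℝ) (v : VField) : anormSq τ r v = coefNormSq τ r (fieldCoef v) := rfl

theorem VRep.continuous {v : VField} {c : Coef} (h : VRep v c) : Continuous v :=
  continuous_pi fun i => (h i).continuous

theorem memLp_of_continuous {v : VField} (hv : Continuous v) : MemLp v 2 vol3 :=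
  hv.memLp_of_hasCompactSupport (HasCompactSupport.of_compactSpace v)

/-- Coefficient properties of a pair of modes. -/
theorem IsModePair.modeCoefs {vb vt : VField} (h : IsModePair vb vt) :
    ModeCoefs (fieldCoef vb) (fieldCoef vt) where
  bar k hk := by
    ext i
    have h1 := fcoeff_congr h.P0_bar i k
    rw [fcoeff_P0 h.memS_bar.memLp, if_neg hk] at h1
    exact h1.symm
  tilde k hk := by
    ext i
    have h1 := fcoeff_congr h.P0_tilde i k
    rw [fcoeff_P0 h.memS_tilde.memLp, if_pos hk, fcoeff_zero_field] at h1
    exact h1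
  even k := by
    ext i
    exact fcoeff_reflect h.even_tilde i k

theorem IsModePair.zero {vb vt : VField} (h : IsModePair vb vt) :
    (fieldCoef vb + fieldCoef vt) 0 = 0 := by
  ext i
  simp [fieldCoef, fcoeff_mean_zero h.memS_bar, fcoeff_mean_zero h.memS_tilde]

theorem IsModePair.divFree {vb vt : VField} (h : IsModePair vb vt) :
    DivFree (fieldCoef vb + fieldCoef vt) := by
  intro k hk
  have h1 := h.memS_bar.div_free k
  rw [fcoeff_P0 h.memS_bar.memLp, fcoeff_P0 h.memS_bar.memLp, if_pos hk, if_pos hk] at h1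
  simpa [h.modeCoefs.tilde k hk, fieldCoef] using h1

theorem IsModePair.reflect {vb vt : VField} (h : IsModePair vb vt) (k : Freq) :
    (fieldCoef vb + fieldCoef vt) (reflectFreq k) = (fieldCoef vb + fieldCoef vt) k := by
  ext i
  simp [fieldCoef, fcoeff_reflect h.even_bar, fcoeff_reflect h.even_tilde]

theorem fieldCoef_conj (vb vt : VField) (k : Freq) (i : Fin 2) :
    (fieldCoef vb + fieldCoef vt) (-k) i =
      (starRingEnd ℂ) ((fieldCoef vb + fieldCoef vt) k i) := by
  simp [fieldCoef, fcoeff_neg_freq]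

theorem coefNormSq_add_of_disjoint {τ r : ℝ} {u v : Coef} (hu : ∀ k, k 2 ≠ 0 → u k = 0)
    (hv : ∀ k, k 2 = 0 → v k = 0) :
    coefNormSq τ r (u + v) = coefNormSq τ r u + coefNormSq τ r v := by
  rw [coefNormSq, coefNormSq, coefNormSq, ← ENNReal.tsum_add]
  refine tsum_congr fun k => ?_
  by_cases hk : k 2 = 0
  · simp [hv k hk]
  · simp [hu k hk]


/-! ### Symmetries of the mode system -/

/-- The Fourier coefficients of the complex conjugate of a field. -/
noncomputable def conjCoef (c : Coef) : Coef := fun k => star (c (-k))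

/-- The Fourier coefficients of the vertical reflection of a field. -/
noncomputable def reflectCoef (c : Coef) : Coef := fun k => c (reflectFreq k)

theorem transportSymbol_neg (j l : Freq) (u : Fin 2 → ℂ) :
    transportSymbol (-j) (-l) u = -transportSymbol j l u := by
  simp only [transportSymbol, Pi.neg_apply, Int.cast_neg]
  rw [← neg_div_neg_eq]
  ring

theorem transportSymbol_star (j l : Freq) (u : Fin 2 → ℂ) :
    transportSymbol j l (star u) = star (transportSymbol j l u) := by
  simp [transportSymbol]

theorem transportSymbol_reflect (j l : Freq) (u : Fin 2 → ℂ) :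
    transportSymbol (reflectFreq j) (reflectFreq l) u = transportSymbol j l u := by
  simp [transportSymbol, reflectFreq_apply, div_neg]

theorem reflectFreq_sub (k l : Freq) : reflectFreq (k - l) = reflectFreq k - reflectFreq l := by
  ext j
  fin_cases j <;> simp [reflectFreq_apply, sub_eq_add_neg, add_comm]

theorem freqNorm_reflectFreq (k : Freq) : freqNorm (reflectFreq k) = freqNorm k := by
  simp [freqNorm, reflectFreq_apply, Fin.sum_univ_three]

theorem lerayCoef_neg (k : Freq) (F : Fin 2 → ℂ) : lerayCoef (-k) F = lerayCoef k F := by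
  by_cases hk : k 2 = 0
  · simp only [lerayCoef, LinearMap.coe_mk, AddHom.coe_mk, Pi.neg_apply, hk, neg_zero, if_true,
      Int.cast_neg]
    ext i
    ring
  · simp [lerayCoef, hk]

theorem lerayCoef_star (k : Freq) (F : Fin 2 → ℂ) : lerayCoef k (star F) = star (lerayCoef k F) := by
  by_cases hk : k 2 = 0
  · ext i
    simp [lerayCoef, hk]
  · simp [lerayCoef, hk]

theorem lerayCoef_reflect (k : Freq) (F : Fin 2 → ℂ) :
    lerayCoef (reflectFreq k) F = lerayCoef k F := by
  by_cases hk : k 2 = 0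
  · ext i
    fin_cases i <;> simp [lerayCoef, hk, reflectFreq_apply]
  · simp [lerayCoef, hk, reflectFreq_apply]

theorem rotCoef_neg (k : Freq) (F : Fin 2 → ℂ) : rotCoef (-k) F = rotCoef k F := by
  simp [rotCoef]

theorem rotCoef_star (k : Freq) (F : Fin 2 → ℂ) : rotCoef k (star F) = star (rotCoef k F) := by
  by_cases hk : k 2 = 0
  · simp [rotCoef, hk]
  · ext i
    fin_cases i <;> simp [rotCoef, hk]

theorem rotCoef_reflect (k : Freq) (F : Fin 2 → ℂ) : rotCoef (reflectFreq k) F = rotCoef k F := by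
  simp [rotCoef, reflectFreq_two]

/-- Conjugation changes the sign of 2πi, and the symbol is odd under the simultaneous change of sign
of both frequencies; the two signs cancel. -/
theorem transportCoef_conjCoef (u v : Coef) (k : Freq) :
    transportCoef (conjCoef u) (conjCoef v) k = star (transportCoef u v (-k)) := by
  ext i
  simp only [transportCoef, Pi.star_apply, star_mul', tsum_star]
  rw [← (Equiv.neg Freq).tsum_eq, ← tsum_mul_left, ← tsum_mul_left]
  refine tsum_congr fun j => ?_
  have h1 : k - -j = -(-k - j) := by abel
  simp only [Equiv.neg_apply, conjCoef, h1, neg_neg, transportSymbol_neg, transportSymbol_star,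
    Pi.star_apply]
  simp

theorem transportCoef_reflectCoef (u v : Coef) (k : Freq) :
    transportCoef (reflectCoef u) (reflectCoef v) k = transportCoef u v (reflectFreq k) := by
  ext i
  simp only [transportCoef]
  rw [← reflectFreq.tsum_eq (fun j => transportSymbol j (reflectFreq k - j) (u j) *
    v (reflectFreq k - j) i)]
  congr 1
  refine tsum_congr fun j => ?_
  simp only [reflectCoef, ← reflectFreq_sub, transportSymbol_reflect]

theorem nonlin_conjCoef (u v : Coef) (k : Freq) :
    nonlin (conjCoef u) (conjCoef v) k = star (nonlin u v (-k)) := by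
  rw [nonlin, nonlin, transportCoef_conjCoef, lerayCoef_star, lerayCoef_neg]

theorem nonlin_reflectCoef (u v : Coef) (k : Freq) :
    nonlin (reflectCoef u) (reflectCoef v) k = nonlin u v (reflectFreq k) := by
  rw [nonlin, nonlin, transportCoef_reflectCoef, lerayCoef_reflect]

theorem ModeSolution.conjCoef {Ω a b : ℝ} {c : ℝ → Coef} (h : ModeSolution Ω a b c) :
    ModeSolution Ω a b fun t => conjCoef (c t) where
  cont k := (h.cont (-k)).star
  hasDerivAt k t ht := by
    have h1 := (h.hasDerivAt (-k) t ht).star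
    have h2 : star (-nonlin (c t) (c t) (-k) - (Ω : ℂ) • rotCoef (-k) (c t (-k))) =
        -nonlin (InviscidPE.conjCoef (c t)) (InviscidPE.conjCoef (c t)) k -
          (Ω : ℂ) • rotCoef k (InviscidPE.conjCoef (c t) k) := by
      rw [nonlin_conjCoef, InviscidPE.conjCoef, rotCoef_star, rotCoef_neg]
      ext i
      simp
    rw [h2] at h1
    exact h1

theorem ModeSolution.reflectCoef {Ω a b : ℝ} {c : ℝ → Coef} (h : ModeSolution Ω a b c) :
    ModeSolution Ω a b fun t => reflectCoef (c t) where
  cont k := h.cont (reflectFreq k)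
  hasDerivAt k t ht := by
    have h1 := h.hasDerivAt (reflectFreq k) t ht
    rwa [← nonlin_reflectCoef, rotCoef_reflect] at h1

theorem UniformDecay.conjCoef {s : Set ℝ} {ρ K : ℝ} {c : ℝ → Coef} (h : UniformDecay s ρ K c) :
    UniformDecay s ρ K fun t => conjCoef (c t) where
  zero t ht := by simp [InviscidPE.conjCoef, h.zero t ht]
  le t ht k := by
    simpa [InviscidPE.conjCoef, freqNorm_neg] using h.le t ht (-k)

theorem UniformDecay.reflectCoef {s : Set ℝ} {ρ K : ℝ} {c : ℝ → Coef} (h : UniformDecay s ρ K c) :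
    UniformDecay s ρ K fun t => reflectCoef (c t) where
  zero t ht := by
    have : reflectFreq 0 = 0 := by ext j; fin_cases j <;> simp [reflectFreq_apply]
    simp [InviscidPE.reflectCoef, this, h.zero t ht]
  le t ht k := by
    simpa [InviscidPE.reflectCoef, freqNorm_reflectFreq] using h.le t ht (reflectFreq k)

/-- The exponential decay of coefficients with a weighted bound. -/
theorem WeightedBound.norm_le {r σ α : ℝ} {u : Coef} {A : Freq → ℝ≥0∞} (h : WeightedBound r σ u A)
    (hr : 0 ≤ r) (hα : 0 ≤ α) (hA : ∑' k, A k ^ 2 ≤ ENNReal.ofReal (α ^ 2)) (k : Freq) :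
    ‖u k‖ ≤ α * Real.exp (-σ * freqNorm k) := by
  by_cases hk : k = 0
  · rw [hk, h.zero, norm_zero]; positivity
  have h1 : ENNReal.ofReal (Real.exp (σ * freqNorm k)) * ‖u k‖ₑ ≤ A k := by
    refine le_trans (mul_le_mul_left (ENNReal.ofReal_le_ofReal ?_) _) (h.le k)
    exact le_mul_of_one_le_left (Real.exp_pos _).le (Real.one_le_rpow (one_le_freqNorm hk) hr)
  have h2 : A k ^ 2 ≤ ENNReal.ofReal (α ^ 2) := (ENNReal.le_tsum k).trans hA
  have h3 : ‖Real.exp (σ * freqNorm k) • u k‖ ≤ α := by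
    refine norm_le_of_enorm_sq_le hα (le_trans ?_ h2)
    rw [enorm_smul, Real.enorm_eq_ofReal (Real.exp_pos _).le]
    gcongr
  rw [norm_smul, Real.norm_of_nonneg (Real.exp_pos _).le] at h3
  rw [neg_mul, Real.exp_neg, ← div_eq_mul_inv, le_div_iff₀ (Real.exp_pos _), mul_comm]
  exact h3


/-! ### From Fourier modes to solutions -/

/-- The barotropic part of a coefficient family. -/
noncomputable def barPart (c : Coef) : Coef := fun k => if k 2 = 0 then c k else 0

/-- The baroclinic part of a coefficient family. -/
noncomputable def tildePart (c : Coef) : Coef := fun k => if k 2 = 0 then 0 else c k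

/-- The field with given Fourier coefficients. -/
noncomputable def synth (c : Coef) : VField := fun x i => (∑' k, c k i * mFourier k x).re

theorem barPart_add_tildePart (c : Coef) : barPart c + tildePart c = c := by
  ext k i
  by_cases hk : k 2 = 0 <;> simp [barPart, tildePart, hk]

theorem norm_barPart_le (c : Coef) (k : Freq) : ‖barPart c k‖ ≤ ‖c k‖ := by
  by_cases hk : k 2 = 0 <;> simp [barPart, hk]

theorem norm_tildePart_le (c : Coef) (k : Freq) : ‖tildePart c k‖ ≤ ‖c k‖ := by
  by_cases hk : k 2 = 0 <;> simp [tildePart, hk]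

theorem modeCoefs_parts {c : Coef} (hc : reflectCoef c = c) :
    ModeCoefs (barPart c) (tildePart c) where
  bar k hk := by simp [barPart, hk]
  tilde k hk := by simp [tildePart, hk]
  even k := by
    have := congrFun hc k
    simp only [reflectCoef] at this
    simp [tildePart, this, reflectFreq_two]

theorem conjCoef_barPart {c : Coef} (hc : conjCoef c = c) : conjCoef (barPart c) = barPart c := by
  ext k i
  have := congrFun (congrFun hc k) i
  by_cases hk : k 2 = 0
  · simpa [conjCoef, barPart, hk] using this
  · simp [conjCoef, barPart, hk]

theorem conjCoef_tildePart {c : Coef} (hc : conjCoef c = c) :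
    conjCoef (tildePart c) = tildePart c := by
  ext k i
  have := congrFun (congrFun hc k) i
  by_cases hk : k 2 = 0
  · simp [conjCoef, tildePart, hk]
  · simpa [conjCoef, tildePart, hk] using this

theorem vRep_synth {c : Coef} {ρ K : ℝ} (hρ : 0 < ρ)
    (hd : ∀ k, ‖c k‖ ≤ K * Real.exp (-ρ * freqNorm k)) (hc : conjCoef c = c) :
    VRep (synth c) c := by
  intro i
  refine Rep.of_symm ⟨ρ, K, hρ, fun k => (norm_le_pi_norm _ i).trans (hd k)⟩ fun k => ?_
  have := congrFun (congrFun hc (-k)) i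
  simpa [conjCoef] using this.symm

/-! ### Recovering the mode constraints from coefficients -/

theorem Rep.reflect {f : Torus3 → ℝ} {a : Freq → ℂ} (h : Rep f a)
    (ha : ∀ k, a (reflectFreq k) = a k) (x : Torus3) :
    f (Function.update x 2 (-(x 2))) = f x := by
  have h1 := (h.hasSum (Function.update x 2 (-(x 2))))
  rw [← reflectFreq.hasSum_iff] at h1
  have h2 := h1.congr_fun (g := fun k => a k * mFourier k x) fun k => by
    simp [ha, mFourier_reflect]
  exact_mod_cast h2.unique (h.hasSum x)

theorem MemS.of_vRep {v : VField} {c : Coef} (h : VRep v c) (h0 : c 0 = 0) (hd : DivFree c) :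
    MemS v where
  memLp := memLp_of_continuous h.continuous
  mean_zero i := by
    have h1 := (h i).mFourierCoeff_eq 0
    rw [mFourierCoeff_def, h0] at h1
    simp only [neg_zero, mFourier_zero, ContinuousMap.one_apply, one_mul, Pi.zero_apply] at h1
    rw [integral_complex_ofReal] at h1
    exact_mod_cast h1
  div_free k := by
    have hm := memLp_of_continuous h.continuous
    have h1 : ∀ i, fcoeff v i k = c k i := fun i => (h i).mFourierCoeff_eq k
    rw [fcoeff_P0 hm, fcoeff_P0 hm, h1, h1]
    by_cases hk : k 2 = 0
    · simpa [hk] using hd k hk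
    · simp [hk]

theorem IsModePair.of_vRep {vb vt : VField} {cb ct : Coef} (hb : VRep vb cb) (ht : VRep vt ct)
    (hm : ModeCoefs cb ct) (h0 : (cb + ct) 0 = 0) (hd : DivFree (cb + ct)) : IsModePair vb vt := by
  have ht0 : ct 0 = 0 := hm.tilde 0 rfl
  have hb0 : cb 0 = 0 := by simpa [ht0] using h0
  have hreflb : ∀ k, cb (reflectFreq k) = cb k := by
    intro k
    by_cases hk : k 2 = 0
    · have : reflectFreq k = k := by rw [reflectFreq_apply, hk, neg_zero, ← hk]; simp
      rw [this]
    · rw [hm.bar k hk, hm.bar _ (by simpa [reflectFreq_two] using hk)]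
  refine ⟨MemS.of_vRep hb hb0 fun k hk => ?_, MemS.of_vRep ht ht0 fun k hk => ?_, ?_, ?_, ?_, ?_⟩
  · simpa [hm.tilde k hk] using hd k hk
  · simp [hm.tilde k hk]
  · refine Filter.Eventually.of_forall fun x => funext fun i => ?_
    exact (hb i).reflect (fun k => by rw [hreflb]) x
  · refine Filter.Eventually.of_forall fun x => funext fun i => ?_
    exact (ht i).reflect (fun k => by rw [hm.even]) x
  · refine Filter.Eventually.of_forall fun x => funext fun i => ?_
    refine congrFun ((hb i).vertical_average.ext ((hb i).congr_coef fun k => ?_)) x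
    by_cases hk : k 2 = 0
    · simp [hk]
    · simp [hk, hm.bar k hk]
  · refine Filter.Eventually.of_forall fun x => funext fun i => ?_
    refine congrFun ((ht i).vertical_average.ext (Rep.zero.congr_coef fun k => ?_)) x
    by_cases hk : k 2 = 0
    · simp [hk, hm.tilde k hk]
    · simp [hk]

/-! ### Pairing with square integrable test fields -/

theorem exists_fcoeff_bound (φ : VField) :
    ∃ M, 0 ≤ M ∧ ∀ i k, ‖fcoeff φ i k‖ ≤ M := by
  refine ⟨∑ i, ∫ x, ‖φ x i‖ ∂vol3, by positivity, fun i k => ?_⟩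
  refine le_trans ?_ (Finset.single_le_sum (f := fun i => ∫ x, ‖φ x i‖ ∂vol3)
    (fun i _ => by positivity) (Finset.mem_univ i))
  rw [fcoeff_def]
  refine (norm_integral_le_integral_norm _).trans (le_of_eq ?_)
  simp [norm_mFourier_apply]

theorem Rep.hasSum_integral_mul {f : Torus3 → ℝ} {a : Freq → ℂ} (h : Rep f a) {φ : VField}
    (hφ : MemLp φ 2 vol3) (i : Fin 2) :
    HasSum (fun k => a k * fcoeff φ i (-k)) ((∫ x, f x * φ x i ∂vol3 : ℝ) : ℂ) := by
  have hi := integrable_component hφ i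
  have h1 : ∀ k, Integrable (fun x => a k * (mFourier k x * (φ x i : ℂ))) vol3 :=
    fun k => (integrable_mFourier_mul k hi).const_mul _
  have h2 := hasSum_integral_of_summable_integral_norm h1 (by
    simp only [norm_mul, norm_mFourier_apply, one_mul, integral_const_mul]
    exact h.decay.summable_norm.mul_right _)
  have h3 : ∀ x, ∑' k, a k * (mFourier k x * (φ x i : ℂ)) = ((f x * φ x i : ℝ) : ℂ) := by
    intro x
    push_cast
    rw [← ((h.hasSum x).mul_right (φ x i : ℂ)).tsum_eq]
    simp only [mul_assoc]
  simp_rw [h3, integral_complex_ofReal, integral_const_mul] at h2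
  simpa only [fcoeff_def, neg_neg] using h2

/-- The contribution of one frequency to an inner product. -/
noncomputable def modePairing (φ : VField) (k : Freq) (w : Fin 2 → ℂ) : ℂ :=
  w 0 * fcoeff φ 0 (-k) + w 1 * fcoeff φ 1 (-k)

theorem VRep.hasSum_innerL2 {F : VField} {C : Coef} (h : VRep F C) {φ : VField}
    (hφ : MemLp φ 2 vol3) : HasSum (fun k => modePairing φ k (C k)) (innerL2 F φ : ℂ) := by
  have h1 := ((h 0).hasSum_integral_mul hφ 0).add ((h 1).hasSum_integral_mul hφ 1)
  have h2 : ∀ i, Integrable (fun x => F x i * φ x i) vol3 := fun i => by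
    obtain ⟨M, hM⟩ := (isCompact_univ (X := Torus3)).exists_bound_of_continuousOn
      (h i).continuous.continuousOn
    exact (integrable_component hφ i).bdd_mul (h i).continuous.aestronglyMeasurable
      (Filter.Eventually.of_forall fun x => hM x (mem_univ x))
  have h3 : innerL2 F φ = ∫ x, F x 0 * φ x 0 ∂vol3 + ∫ x, F x 1 * φ x 1 ∂vol3 := by
    simp only [innerL2, Fin.sum_univ_two]
    exact integral_add (h2 0) (h2 1)
  rw [h3]
  push_cast at h1 ⊢
  exact h1

theorem norm_modePairing_le {φ : VField} {M : ℝ} (hM : ∀ i k, ‖fcoeff φ i k‖ ≤ M) (k : Freq)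
    (w : Fin 2 → ℂ) : ‖modePairing φ k w‖ ≤ 2 * M * ‖w‖ := by
  have h : ∀ i, ‖w i * fcoeff φ i (-k)‖ ≤ ‖w‖ * M := fun i => by
    rw [norm_mul]
    gcongr
    · exact norm_le_pi_norm w i
    · exact hM i _
  refine (norm_add_le _ _).trans ?_
  linarith [h 0, h 1]

theorem continuousOn_innerL2 {s : Set ℝ} {u : ℝ → VField} {c : ℝ → Coef} {g : Freq → ℝ}
    (hu : ∀ t ∈ s, VRep (u t) (c t)) (hc : ∀ k, ContinuousOn (fun t => c t k) s)
    (hg : Summable g) (hcg : ∀ t ∈ s, ∀ k, ‖c t k‖ ≤ g k) {φ : VField} (hφ : MemLp φ 2 vol3) :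
    ContinuousOn (fun t => innerL2 (u t) φ) s := by
  obtain ⟨M, hM0, hM⟩ := exists_fcoeff_bound φ
  have h1 : ContinuousOn (fun t => (∑' k, modePairing φ k (c t k)).re) s := by
    refine Complex.continuous_re.comp_continuousOn ?_
    refine continuousOn_tsum (u := fun k => 2 * M * g k) (fun k => ?_) (hg.mul_left _)
      fun k t ht => (norm_modePairing_le hM k _).trans (by gcongr; exact hcg t ht k)
    have h2 := fun i => (continuous_apply i).comp_continuousOn (hc k)
    exact ((h2 0).mul continuousOn_const).add ((h2 1).mul continuousOn_const)
  refine h1.congr fun t ht => ?_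
  simp only [((hu t ht).hasSum_innerL2 hφ).tsum_eq, Complex.ofReal_re]

/-- A field whose Fourier coefficients satisfy `∂ₜ u + F = 0` evolves by `F`. -/
theorem evolvesBy_of_vRep {T : ℝ} (hT : 0 ≤ T) {u F : ℝ → VField} {c d : ℝ → Coef} {g g' : Freq → ℝ}
    (hu : ∀ t ∈ Icc 0 T, VRep (u t) (c t)) (hF : ∀ t ∈ Icc 0 T, VRep (F t) (d t))
    (hc : ∀ k, ContinuousOn (fun t => c t k) (Icc 0 T))
    (hd : ∀ k, ContinuousOn (fun t => d t k) (Icc 0 T))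
    (hg : Summable g) (hg' : Summable g') (hcg : ∀ t ∈ Icc 0 T, ∀ k, ‖c t k‖ ≤ g k)
    (hdg : ∀ t ∈ Icc 0 T, ∀ k, ‖d t k‖ ≤ g' k)
    (hderiv : ∀ k, ∀ t ∈ Ioo 0 T, HasDerivAt (fun s => c s k) (-(d t k)) t) : EvolvesBy T u F := by
  intro φ hφ
  have hcu := continuousOn_innerL2 hu hc hg hcg hφ
  have hcF := continuousOn_innerL2 hF hd hg' hdg hφ
  obtain ⟨M, hM0, hM⟩ := exists_fcoeff_bound φ
  have hD : ∀ t ∈ Ioo 0 T, HasDerivAt (fun s => innerL2 (u s) φ) (-innerL2 (F t) φ) t := by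
    intro t ht
    have htI := Ioo_subset_Icc_self ht
    -- The coefficients of φ are bounded, so the summable bound on the force coefficients dominates
    -- the termwise derivatives.
    have h1 := hasDerivAt_tsum_of_isPreconnected (𝕜 := ℝ) (hg'.mul_left (2 * M)) isOpen_Ioo
      isPreconnected_Ioo (g := fun k s => modePairing φ k (c s k))
      (g' := fun k s => modePairing φ k (-(d s k))) (fun k s hs => by
        have h2 := hasDerivAt_pi.mp (hderiv k s hs)
        exact ((h2 0).mul_const _).add ((h2 1).mul_const _))
      (fun k s hs => (norm_modePairing_le hM k _).trans (by
        rw [norm_neg]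
        gcongr
        exact hdg s (Ioo_subset_Icc_self hs) k)) ht
      ((hu t htI).hasSum_innerL2 hφ).summable ht
    have h2 : ∑' k, modePairing φ k (-(d t k)) = ((-innerL2 (F t) φ : ℝ) : ℂ) := by
      rw [Complex.ofReal_neg, ← ((hF t htI).hasSum_innerL2 hφ).tsum_eq, ← tsum_neg]
      refine tsum_congr fun k => ?_
      simp only [modePairing, Pi.neg_apply]
      ring
    rw [h2] at h1
    have h3 := Complex.reCLM.hasFDerivAt.comp_hasDerivAt t h1
    simp only [Complex.reCLM_apply, Complex.ofReal_re] at h3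
    refine h3.congr_of_eventuallyEq ?_
    filter_upwards [Ioo_mem_nhds ht.1 ht.2] with s hs
    simp [((hu s (Ioo_subset_Icc_self hs)).hasSum_innerL2 hφ).tsum_eq]
  refine ⟨(hcF.mono (by rw [uIcc_of_le hT])).intervalIntegrable, fun t ht => ?_⟩
  have hsub : Icc 0 t ⊆ Icc 0 T := Icc_subset_Icc_right ht.2
  have h1 := intervalIntegral.integral_eq_sub_of_hasDerivAt_of_le ht.1 (hcu.mono hsub)
    (fun s hs => hD s (Ioo_subset_Ioo_right ht.2 hs))
    ((hcF.mono hsub).neg.mono (by rw [uIcc_of_le ht.1])).intervalIntegrable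
  rw [intervalIntegral.integral_neg] at h1
  linarith


/-- Completeness of the exponentials in L². It lets the initial condition, where the data are only
square integrable, be checked on coefficients. -/
theorem ae_eq_zero_of_mFourierCoeff {f : Torus3 → ℂ} (hf : MemLp f 2 vol3)
    (h : ∀ k, mFourierCoeff f k = 0) : f =ᵐ[vol3] 0 := by
  set F : Lp ℂ 2 vol3 := hf.toLp f with hF
  have hae : (F : Torus3 → ℂ) =ᵐ[vol3] f := hf.coeFn_toLp
  have h1 : mFourierBasis.repr F = 0 := by
    ext k
    refine (mFourierBasis_repr F k).trans ?_
    rw [mFourierCoeff_def]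
    refine Eq.trans (integral_congr_ae ?_) (h k)
    filter_upwards [hae] with x hx
    exact congrArg (fun z => mFourier (-k) x * z) hx
  have h2 : F = 0 := (LinearIsometryEquiv.map_eq_zero_iff _).mp h1
  have h3 := Lp.coeFn_zero ℂ 2 vol3
  rw [← h2] at h3
  exact hae.symm.trans h3

theorem ae_eq_of_fieldCoef_eq {u v : VField} (hu : MemLp u 2 vol3) (hv : MemLp v 2 vol3)
    (h : fieldCoef u = fieldCoef v) : u =ᵐ[vol3] v := by
  have h1 : ∀ i, ∀ᵐ x ∂vol3, u x i = v x i := by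
    intro i
    have hm : MemLp (fun x => (((u - v) x i : ℝ) : ℂ)) 2 vol3 :=
      (((hu.sub hv).eval i)).ofReal
    filter_upwards [ae_eq_zero_of_mFourierCoeff hm fun k => by
      have h2 := fcoeff_sub hu hv i k
      have h3 : fcoeff u i k = fcoeff v i k := congrFun (congrFun h k) i
      rw [h3, sub_self] at h2
      exact h2] with x hx
    have h4 : (u - v) x i = 0 := Complex.ofReal_eq_zero.mp hx
    exact sub_eq_zero.mp h4
  filter_upwards [h1 0, h1 1] with x h0 h1
  ext i
  fin_cases i
  · exact h0
  · exact h1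

/-- The right-hand side of the mode system, up to sign. -/
noncomputable def modeForce (Ω : ℝ) (c : Coef) (k : Freq) : Fin 2 → ℂ :=
  nonlin c c k + (Ω : ℂ) • rotCoef k (c k)

theorem modeForce_of_eq_zero (Ω : ℝ) (c : Coef) {k : Freq} (hk : k 2 = 0) :
    modeForce Ω c k = nonlin c c k := by
  simp [modeForce, rotCoef, hk]

section

variable {Ω T ρ K : ℝ} {c : ℝ → Coef}

/-- Bounds on the time derivative of the modes. -/
theorem UniformDecay.exists_modeForce_bound (Ω : ℝ) (hρ : 0 < ρ) (hK : 0 ≤ K)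
    (hcont : ∀ k, ContinuousOn (fun t => c t k) (Icc 0 T)) (hd : UniformDecay (Icc 0 T) ρ K c) :
    (∀ k, ContinuousOn (fun t => modeForce Ω (c t) k) (Icc 0 T)) ∧
      ∃ g : Freq → ℝ, Summable g ∧ ∀ t ∈ Icc 0 T, ∀ k, ‖modeForce Ω (c t) k‖ ≤ g k := by
  obtain ⟨A, α, hα, hA, hmaj⟩ := UniformDecay.exists_majorant 3 (s := Icc 0 T) hρ hK
  have hAt : ∑' k, A k ^ 2 ≠ ⊤ := (hA.trans_lt ENNReal.ofReal_lt_top).ne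
  have hW0 : ∀ t ∈ Icc 0 T, WeightedBound 3 0 (c t) A :=
    fun t ht => hmaj c hd t ht 0 (by positivity)
  refine ⟨fun k => ?_, fun k => 24 * Real.pi * α ^ 2 * Real.exp (-(ρ / 2) * freqNorm k) +
    |Ω| * (K * Real.exp (-ρ * freqNorm k)), ?_, fun t ht k => ?_⟩
  · refine (continuousOn_nonlin (by norm_num) hAt hAt hW0 hW0 hcont hcont k).add ?_
    have h1 : ContinuousOn (fun t => rotCoef k (c t k)) (Icc 0 T) :=
      (LinearMap.continuous_of_finiteDimensional (rotCoef k)).comp_continuousOn (hcont k)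
    exact h1.const_smul (Ω : ℂ)
  · exact ((summable_exp_neg_freqNorm (by positivity)).mul_left _).add
      (((summable_exp_neg_freqNorm hρ).mul_left _).mul_left _)
  · refine (norm_add_le _ _).trans (add_le_add ?_ ?_)
    · have hW := hmaj c hd t ht (ρ / 2) le_rfl
      have h1 := hW.nonlin_le hW (by positivity) k
      have h2 : convMaj 3 A A k ≤ ENNReal.ofReal (α ^ 2) := by
        refine ENNReal_le_of_sq_le ((convMaj_sq_le (by norm_num) A A k).trans ?_)
        rw [sq]
        exact mul_le_mul' hA hA
      have h3 : ENNReal.ofReal (Real.exp (ρ / 2 * freqNorm k) * ‖nonlin (c t) (c t) k‖) ≤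
          ENNReal.ofReal (24 * Real.pi * α ^ 2) := by
        rw [ENNReal.ofReal_mul (Real.exp_pos _).le, ENNReal.ofReal_mul (by positivity), ofReal_norm]
        exact h1.trans (mul_le_mul_right h2 _)
      rw [ENNReal.ofReal_le_ofReal_iff (by positivity)] at h3
      rw [neg_mul, Real.exp_neg, ← div_eq_mul_inv, le_div_iff₀ (Real.exp_pos _), mul_comm]
      exact h3
    · rw [norm_smul, Complex.norm_real, Real.norm_eq_abs]
      gcongr
      exact (norm_rotCoef_le k _).trans (hd.le t ht k)

/-- The conjugated path solves the same system with the same decay and initial value, so uniqueness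
identifies the two: the field stays real. Evenness is obtained in the same way from reflection. -/
theorem ModeSolution.conjCoef_eq (hρ : 0 < ρ) (hK : 0 ≤ K) (hc : ModeSolution Ω 0 T c)
    (hd : UniformDecay (Icc 0 T) ρ K c) (h0 : InviscidPE.conjCoef (c 0) = c 0) :
    ∀ t ∈ Icc 0 T, InviscidPE.conjCoef (c t) = c t :=
  modeSolution_unique hρ hK hc.conjCoef hc hd.conjCoef hd h0

theorem ModeSolution.reflectCoef_eq (hρ : 0 < ρ) (hK : 0 ≤ K) (hc : ModeSolution Ω 0 T c)
    (hd : UniformDecay (Icc 0 T) ρ K c) (h0 : InviscidPE.reflectCoef (c 0) = c 0) :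
    ∀ t ∈ Icc 0 T, InviscidPE.reflectCoef (c t) = c t :=
  modeSolution_unique hρ hK hc.reflectCoef hc hd.reflectCoef hd h0

/-- Solutions of the mode system give solutions of the primitive equations. -/
theorem ModeSolution.isSolution (hT : 0 ≤ T) (hρ : 0 < ρ) (hK : 0 ≤ K) (hc : ModeSolution Ω 0 T c)
    (hd : UniformDecay (Icc 0 T) ρ K c) (hdiv : ∀ t ∈ Icc 0 T, DivFree (c t)) {vb₀ vt₀ : VField}
    (hm : IsModePair vb₀ vt₀) (h0 : c 0 = fieldCoef vb₀ + fieldCoef vt₀) :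
    IsSolution Ω T vb₀ vt₀ (fun t => synth (barPart (c t))) fun t => synth (tildePart (c t)) := by
  have hconj := hc.conjCoef_eq hρ hK hd (by
    ext k i
    have := fieldCoef_conj vb₀ vt₀ (-k) i
    rw [neg_neg] at this
    rw [h0, this]
    rfl)
  have hrefl := hc.reflectCoef_eq hρ hK hd (by
    ext k i
    rw [h0]
    exact congrFun (hm.reflect k) i)
  have hb : ∀ t ∈ Icc 0 T, VRep (synth (barPart (c t))) (barPart (c t)) := fun t ht =>
    vRep_synth hρ (fun k => (norm_barPart_le _ k).trans (hd.le t ht k))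
      (conjCoef_barPart (hconj t ht))
  have ht : ∀ t ∈ Icc 0 T, VRep (synth (tildePart (c t))) (tildePart (c t)) := fun t ht =>
    vRep_synth hρ (fun k => (norm_tildePart_le _ k).trans (hd.le t ht k))
      (conjCoef_tildePart (hconj t ht))
  have hmc : ∀ t ∈ Icc 0 T, ModeCoefs (barPart (c t)) (tildePart (c t)) := fun t ht =>
    modeCoefs_parts (hrefl t ht)
  have h0T : (0 : ℝ) ∈ Icc 0 T := ⟨le_rfl, hT⟩
  obtain ⟨hfc, g, hg, hfg⟩ := hd.exists_modeForce_bound Ω hρ hK hc.cont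
  have hsum := (summable_exp_neg_freqNorm hρ).mul_left K
  have hderiv : ∀ k, ∀ t ∈ Ioo 0 T, HasDerivAt (fun s => c s k) (-modeForce Ω (c t) k) t := by
    intro k t ht
    have h1 := hc.hasDerivAt k t ht
    rwa [← neg_add'] at h1
  have hmc0 := hm.modeCoefs
  refine ⟨fun t h => (hb t h).continuous, fun t h => (ht t h).continuous, fun t h => ?_, ?_, ?_,
    ?_, ?_⟩
  · refine IsModePair.of_vRep (hb t h) (ht t h) (hmc t h) ?_ ?_
    · rw [barPart_add_tildePart, hd.zero t h]
    · rw [barPart_add_tildePart]; exact hdiv t h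
  · refine ae_eq_of_fieldCoef_eq (memLp_of_continuous (hb 0 h0T).continuous) hm.memS_bar.memLp ?_
    rw [(hb 0 h0T).fieldCoef_eq, h0]
    ext k i
    by_cases hk : k 2 = 0
    · simp [barPart, hk, hmc0.tilde k hk]
    · simp [barPart, hk, hmc0.bar k hk]
  · refine ae_eq_of_fieldCoef_eq (memLp_of_continuous (ht 0 h0T).continuous) hm.memS_tilde.memLp ?_
    rw [(ht 0 h0T).fieldCoef_eq, h0]
    ext k i
    by_cases hk : k 2 = 0
    · simp [tildePart, hk, hmc0.tilde k hk]
    · simp [tildePart, hk, hmc0.bar k hk]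
  · refine evolvesBy_of_vRep hT hb (d := fun t => barPart (modeForce Ω (c t))) (fun t h => ?_)
      (fun k => ?_) (fun k => ?_) hsum hg (fun t h k => (norm_barPart_le _ k).trans (hd.le t h k))
      (fun t h k => (norm_barPart_le _ k).trans (hfg t h k)) fun k t h => ?_
    · refine ((hb t h).barotropicTerm (ht t h) (hmc t h)).congr_coef fun k => ?_
      rw [barPart_add_tildePart]
      by_cases hk : k 2 = 0
      · simp [barPart, hk, modeForce_of_eq_zero]
      · simp [barPart, hk]
    · by_cases hk : k 2 = 0
      · simpa only [barPart, if_pos hk] using hc.cont k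
      · simpa only [barPart, if_neg hk] using continuousOn_const
    · by_cases hk : k 2 = 0
      · simpa only [barPart, if_pos hk] using hfc k
      · simpa only [barPart, if_neg hk] using continuousOn_const
    · by_cases hk : k 2 = 0
      · simpa only [barPart, if_pos hk] using hderiv k t h
      · simpa only [barPart, if_neg hk, neg_zero] using hasDerivAt_const t (0 : Fin 2 → ℂ)
  · refine evolvesBy_of_vRep hT ht (d := fun t => tildePart (modeForce Ω (c t))) (fun t h => ?_)
      (fun k => ?_) (fun k => ?_) hsum hg (fun t h k => (norm_tildePart_le _ k).trans (hd.le t h k))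
      (fun t h k => (norm_tildePart_le _ k).trans (hfg t h k)) fun k t h => ?_
    · refine ((hb t h).baroclinicTerm Ω (ht t h) (hmc t h)).congr_coef fun k => ?_
      rw [barPart_add_tildePart]
      rfl
    · by_cases hk : k 2 = 0
      · simpa only [tildePart, if_pos hk] using continuousOn_const
      · simpa only [tildePart, if_neg hk] using hc.cont k
    · by_cases hk : k 2 = 0
      · simpa only [tildePart, if_pos hk] using continuousOn_const
      · simpa only [tildePart, if_neg hk] using hfc k
    · by_cases hk : k 2 = 0
      · simpa only [tildePart, if_pos hk, neg_zero] using hasDerivAt_const t (0 : Fin 2 → ℂ)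
      · simpa only [tildePart, if_neg hk] using hderiv k t h

end

/-! ### The analytic class -/

/-- Giving up δ of the radius contributes e^{-2δ|k|}, which pays for p additional derivatives. The
summand 1 and the two components account for the factor 4. -/
theorem coefNormSq_le {r σ δ : ℝ} {u : Coef} {A : Freq → ℝ≥0∞} (h : WeightedBound r σ u A)
    {p : ℝ} (hrp : 0 ≤ r + p) (hδ : 0 ≤ σ - δ) :
    coefNormSq (σ - δ) (r + p) u ≤ 4 * ∑' k, ENNReal.ofReal
      (freqNorm k ^ (2 * p) * Real.exp (-2 * δ * freqNorm k)) * A k ^ 2 := by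
  rw [coefNormSq, ← ENNReal.tsum_mul_left]
  refine ENNReal.tsum_le_tsum fun k => ?_
  by_cases hk : k = 0
  · simp [hk, h.zero]
  have hn := freqNorm_pos hk
  have hsum := sum_norm_sq_le (u k)
  have h1 : 1 ≤ freqNorm k ^ (2 * (r + p)) * Real.exp (2 * (σ - δ) * freqNorm k) :=
    one_le_weight (by positivity) (by positivity) hk
  have h2 : freqNorm k ^ (2 * (r + p)) * Real.exp (2 * (σ - δ) * freqNorm k) =
      freqNorm k ^ (2 * p) * Real.exp (-2 * δ * freqNorm k) * weight r σ k ^ 2 := by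
    have e1 : freqNorm k ^ (2 * (r + p)) = freqNorm k ^ (2 * p) * (freqNorm k ^ r) ^ 2 := by
      rw [← Real.rpow_natCast, ← Real.rpow_mul hn.le, ← Real.rpow_add hn]
      congr 1; push_cast; ring
    have e2 : Real.exp (2 * (σ - δ) * freqNorm k) =
        Real.exp (-2 * δ * freqNorm k) * Real.exp (σ * freqNorm k) ^ 2 := by
      rw [← Real.exp_nat_mul, ← Real.exp_add]
      congr 1; push_cast; ring
    rw [e1, e2, weight]; ring
  set w := freqNorm k ^ (2 * p) * Real.exp (-2 * δ * freqNorm k) with hw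
  have hw0 : 0 ≤ w := by positivity
  have hsq := weight_nonneg r σ k
  calc ENNReal.ofReal ((1 + freqNorm k ^ (2 * (r + p)) * Real.exp (2 * (σ - δ) * freqNorm k)) *
        ∑ i, ‖u k i‖ ^ 2)
      ≤ ENNReal.ofReal (4 * (w * (weight r σ k * ‖u k‖) ^ 2)) := by
        refine ENNReal.ofReal_le_ofReal ?_
        rw [h2] at h1 ⊢
        calc _ ≤ (2 * (w * weight r σ k ^ 2)) * (2 * ‖u k‖ ^ 2) := by
              gcongr
              linarith
          _ = _ := by ring
    _ = 4 * (ENNReal.ofReal w * (ENNReal.ofReal (weight r σ k) * ‖u k‖ₑ) ^ 2) := by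
        rw [ENNReal.ofReal_mul (by norm_num), ENNReal.ofReal_mul hw0,
          ENNReal.ofReal_pow (by positivity), ENNReal.ofReal_mul hsq, ofReal_norm]
        simp
    _ ≤ _ := by
        gcongr
        exact h.le k

/-- Uniform in n: the half derivative gained in H^{r+1/2} is square integrable in time because the
radius given up grows linearly. -/
theorem lintegral_mul_exp_le {L T n : ℝ} (hL : 0 < L) (hT : 0 ≤ T) (hn : 0 ≤ n) :
    ∫⁻ t in Icc 0 T, ENNReal.ofReal (n * Real.exp (-2 * (L * t) * n)) ≤
      ENNReal.ofReal (1 / (2 * L)) := by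
  have hcont : Continuous fun t : ℝ => n * Real.exp (-2 * (L * t) * n) := by fun_prop
  have hderiv : ∀ t ∈ uIcc 0 T, HasDerivAt (fun t : ℝ => -(Real.exp (-2 * (L * t) * n) / (2 * L)))
      (n * Real.exp (-2 * (L * t) * n)) t := by
    intro t _
    have h1 : HasDerivAt (fun t : ℝ => -2 * (L * t) * n) (-2 * (L * 1) * n) t :=
      (((hasDerivAt_id t).const_mul L).const_mul (-2)).mul_const n
    refine (((h1.exp).div_const (2 * L)).fun_neg).congr_deriv ?_
    field_simp
  have h2 := intervalIntegral.integral_eq_sub_of_hasDerivAt hderiv (hcont.intervalIntegrable _ _)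
  rw [← ofReal_integral_eq_lintegral_ofReal
    (hcont.integrableOn_Icc) (Filter.Eventually.of_forall fun t => by positivity),
    integral_Icc_eq_integral_Ioc, ← intervalIntegral.integral_of_le hT, h2]
  refine ENNReal.ofReal_le_ofReal ?_
  have h3 : 0 ≤ Real.exp (-2 * (L * T) * n) / (2 * L) := by positivity
  simp only [mul_zero, zero_mul, Real.exp_zero]
  linarith

/-- Weighted bounds for a radius decreasing with slope `L` give membership in the analytic class for
the radius decreasing with slope `2L`. -/
theorem inAnalyticClass_of_weightedBound {r L T τ₀ : ℝ} (hr : 0 ≤ r) (hL : 0 < L) (hT : 0 ≤ T)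
    (hτ : 0 ≤ τ₀ - 2 * L * T) {u : ℝ → VField} {c : ℝ → Coef} {A : Freq → ℝ≥0∞}
    (hA : ∑' k, A k ^ 2 ≠ ⊤) (hu : ∀ t ∈ Icc 0 T, fieldCoef (u t) = c t)
    (hc : ∀ t ∈ Icc 0 T, WeightedBound r (τ₀ - L * t) (c t) A) {τ : ℝ → ℝ}
    (hτt : ∀ t, τ t = τ₀ - L * t - L * t) : InAnalyticClass r T τ u := by
  have hpos : ∀ t ∈ Icc 0 T, 0 ≤ τ₀ - L * t - L * t := fun t ht => by nlinarith [ht.2]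
  refine ⟨⟨(4 * ∑' k, A k ^ 2).toReal, ?_⟩, ?_⟩
  · refine (ae_restrict_iff' measurableSet_Icc).mpr (Filter.Eventually.of_forall fun t ht => ?_)
    rw [ENNReal.ofReal_toReal (ENNReal.mul_ne_top (by simp) hA), anormSq_eq, hu t ht, hτt]
    have h1 := coefNormSq_le (hc t ht) (p := 0) (by simpa using hr) (hpos t ht)
    rw [add_zero] at h1
    refine h1.trans ?_
    gcongr with k
    refine mul_le_of_le_one_left zero_le (ENNReal.ofReal_le_one.mpr ?_)
    rw [mul_zero, Real.rpow_zero, one_mul, Real.exp_le_one_iff]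
    have := freqNorm_nonneg k
    have := mul_nonneg (mul_nonneg hL.le ht.1) this
    linarith
  · calc ∫⁻ t in Icc 0 T, anormSq (τ t) (r + 1 / 2) (u t)
        ≤ ∫⁻ t in Icc 0 T, 4 * ∑' k, ENNReal.ofReal
          (freqNorm k * Real.exp (-2 * (L * t) * freqNorm k)) * A k ^ 2 := by
          refine setLIntegral_mono' measurableSet_Icc fun t ht => ?_
          rw [anormSq_eq, hu t ht, hτt]
          refine (coefNormSq_le (hc t ht) (p := 1 / 2) (by linarith)
            (hpos t ht)).trans (le_of_eq ?_)
          norm_num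
      _ = 4 * ∑' k, (∫⁻ t in Icc 0 T, ENNReal.ofReal
          (freqNorm k * Real.exp (-2 * (L * t) * freqNorm k))) * A k ^ 2 := by
          have hm : ∀ k : Freq, Measurable fun t : ℝ => ENNReal.ofReal
              (freqNorm k * Real.exp (-2 * (L * t) * freqNorm k)) := fun k =>
            (by fun_prop : Continuous fun t : ℝ =>
              freqNorm k * Real.exp (-2 * (L * t) * freqNorm k)).measurable.ennreal_ofReal
          -- The majorant A is independent of time, so by Tonelli the time integral reaches only the
          -- exponential factor of each frequency.
          rw [lintegral_const_mul' _ _ (by simp), lintegral_tsum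
            fun k => ((hm k).mul_const _).aemeasurable]
          congr 1
          exact tsum_congr fun k => lintegral_mul_const _ (hm k)
      _ ≤ 4 * ∑' k, ENNReal.ofReal (1 / (2 * L)) * A k ^ 2 := by
          gcongr with k
          exact lintegral_mul_exp_le hL hT (freqNorm_nonneg k)
      _ < ⊤ := by
          rw [ENNReal.tsum_mul_left]
          exact ENNReal.mul_lt_top (by simp)
            (ENNReal.mul_lt_top ENNReal.ofReal_lt_top hA.lt_top)


/-! ### From solutions to Fourier modes -/

/-- The field whose only nonzero component is the `i`-th one, equal to `g`. -/
def componentField (i : Fin 2) (g : Torus3 → ℝ) : VField := fun x j => if j = i then g x else 0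

theorem innerL2_componentField (v : VField) (i : Fin 2) (g : Torus3 → ℝ) :
    innerL2 v (componentField i g) = ∫ x, v x i * g x ∂vol3 := by
  simp [innerL2, componentField]

theorem memLp_componentField (i : Fin 2) {g : Torus3 → ℝ} (hg : Continuous g) :
    MemLp (componentField i g) 2 vol3 := by
  refine memLp_of_continuous (continuous_pi fun j => ?_)
  by_cases hj : j = i
  · simpa only [componentField, if_pos hj] using hg
  · simpa only [componentField, if_neg hj] using continuous_const

/-- The real part of an exponential as a test field. -/
noncomputable def reTest (i : Fin 2) (k : Freq) : VField :=
  componentField i fun x => (mFourier (-k) x).re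

/-- The imaginary part of an exponential as a test field. -/
noncomputable def imTest (i : Fin 2) (k : Freq) : VField :=
  componentField i fun x => (mFourier (-k) x).im

theorem memLp_reTest (i : Fin 2) (k : Freq) : MemLp (reTest i k) 2 vol3 :=
  memLp_componentField i (Complex.continuous_re.comp (mFourier (-k)).continuous)

theorem memLp_imTest (i : Fin 2) (k : Freq) : MemLp (imTest i k) 2 vol3 :=
  memLp_componentField i (Complex.continuous_im.comp (mFourier (-k)).continuous)

theorem innerL2_reTest {v : VField} (hv : MemLp v 2 vol3) (i : Fin 2) (k : Freq) :
    innerL2 v (reTest i k) = (fcoeff v i k).re := by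
  rw [reTest, innerL2_componentField, fcoeff_def]
  have h := Complex.reCLM.integral_comp_comm (integrable_mFourier_mul (-k)
    (integrable_component hv i))
  refine Eq.trans (integral_congr_ae (Filter.Eventually.of_forall fun x => ?_)) h
  simp [mul_comm]

theorem innerL2_imTest {v : VField} (hv : MemLp v 2 vol3) (i : Fin 2) (k : Freq) :
    innerL2 v (imTest i k) = (fcoeff v i k).im := by
  rw [imTest, innerL2_componentField, fcoeff_def]
  have h := Complex.imCLM.integral_comp_comm (integrable_mFourier_mul (-k)
    (integrable_component hv i))
  refine Eq.trans (integral_congr_ae (Filter.Eventually.of_forall fun x => ?_)) h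
  simp [mul_comm]

/-- Test fields are real, so a Fourier coefficient is recovered from two of them. -/
theorem fcoeff_eq_innerL2 {v : VField} (hv : MemLp v 2 vol3) (i : Fin 2) (k : Freq) :
    fcoeff v i k = (innerL2 v (reTest i k) : ℂ) + (innerL2 v (imTest i k) : ℂ) * Complex.I := by
  rw [innerL2_reTest hv, innerL2_imTest hv, Complex.re_add_im]

namespace EvolvesBy

variable {T : ℝ} {u F : ℝ → VField}

theorem innerL2_eq (h : EvolvesBy T u F) {φ : VField} (hφ : MemLp φ 2 vol3) {t : ℝ}
    (ht : t ∈ Icc 0 T) :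
    innerL2 (u t) φ = innerL2 (u 0) φ - ∫ s in (0 : ℝ)..t, innerL2 (F s) φ := by
  linarith [(h φ hφ).2 t ht]

theorem continuousOn_innerL2 (h : EvolvesBy T u F) (hT : 0 ≤ T) {φ : VField}
    (hφ : MemLp φ 2 vol3) : ContinuousOn (fun t => innerL2 (u t) φ) (Icc 0 T) := by
  have h1 := intervalIntegral.continuousOn_primitive_interval'
    (h φ hφ).1 (left_mem_uIcc (a := (0 : ℝ)) (b := T))
  rw [uIcc_of_le hT] at h1
  exact (continuousOn_const.sub h1).congr fun t ht => h.innerL2_eq hφ ht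

theorem hasDerivAt_innerL2 (h : EvolvesBy T u F) {φ : VField} (hφ : MemLp φ 2 vol3)
    (hc : ContinuousOn (fun s => innerL2 (F s) φ) (Icc 0 T)) {t : ℝ} (ht : t ∈ Ioo 0 T) :
    HasDerivAt (fun s => innerL2 (u s) φ) (-innerL2 (F t) φ) t := by
  have hc' := hc.mono Ioo_subset_Icc_self
  have h1 := intervalIntegral.integral_hasDerivAt_right
    ((hc.mono (by rw [uIcc_of_le ht.1.le]; exact Icc_subset_Icc_right ht.2.le)).intervalIntegrable)
    (hc'.stronglyMeasurableAtFilter isOpen_Ioo t ht) (hc'.continuousAt (Ioo_mem_nhds ht.1 ht.2))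
  refine (h1.const_sub (innerL2 (u 0) φ)).congr_of_eventuallyEq ?_
  filter_upwards [Ioo_mem_nhds ht.1 ht.2] with s hs
  exact h.innerL2_eq hφ (Ioo_subset_Icc_self hs)

/-- The integrated identity alone, with an integrable right-hand side, makes each mode continuous in
time. No knowledge of the force is needed, so this can precede every bound. -/
theorem continuousOn_fieldCoef (h : EvolvesBy T u F) (hT : 0 ≤ T)
    (hu : ∀ t ∈ Icc 0 T, Continuous (u t)) (k : Freq) :
    ContinuousOn (fun t => fieldCoef (u t) k) (Icc 0 T) := by
  refine continuousOn_pi.mpr fun i => ?_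
  have h1 := Complex.continuous_ofReal.comp_continuousOn
    (h.continuousOn_innerL2 hT (memLp_reTest i k))
  have h2 := Complex.continuous_ofReal.comp_continuousOn
    (h.continuousOn_innerL2 hT (memLp_imTest i k))
  exact (h1.add (h2.mul continuousOn_const)).congr fun t ht =>
    fcoeff_eq_innerL2 (memLp_of_continuous (hu t ht)) i k

theorem hasDerivAt_fieldCoef (h : EvolvesBy T u F)
    (hu : ∀ t ∈ Icc 0 T, Continuous (u t)) {d : ℝ → Coef} (hF : ∀ t ∈ Icc 0 T, VRep (F t) (d t))
    (k : Freq) (hd : ContinuousOn (fun t => d t k) (Icc 0 T)) {t : ℝ} (ht : t ∈ Ioo 0 T) :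
    HasDerivAt (fun s => fieldCoef (u s) k) (-(d t k)) t := by
  have hFm : ∀ t ∈ Icc 0 T, MemLp (F t) 2 vol3 := fun t ht => memLp_of_continuous (hF t ht).continuous
  have hcoef : ∀ t ∈ Icc 0 T, ∀ i, fcoeff (F t) i k = d t k i :=
    fun t ht i => (hF t ht i).mFourierCoeff_eq k
  refine hasDerivAt_pi.mpr fun i => ?_
  have hdi : ContinuousOn (fun t => d t k i) (Icc 0 T) :=
    (continuous_apply i).comp_continuousOn hd
  have h1 := (h.hasDerivAt_innerL2 (memLp_reTest i k)
    ((Complex.continuous_re.comp_continuousOn hdi).congr fun t ht => by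
      rw [innerL2_reTest (hFm t ht), hcoef t ht]; rfl) ht).ofReal_comp
  have h2 := (h.hasDerivAt_innerL2 (memLp_imTest i k)
    ((Complex.continuous_im.comp_continuousOn hdi).congr fun t ht => by
      rw [innerL2_imTest (hFm t ht), hcoef t ht]; rfl) ht).ofReal_comp
  have htI := Ioo_subset_Icc_self ht
  refine ((h1.add (h2.mul_const Complex.I)).congr_deriv ?_).congr_of_eventuallyEq ?_
  · rw [Pi.neg_apply, ← hcoef t htI i, fcoeff_eq_innerL2 (hFm t htI)]
    push_cast
    ring
  · filter_upwards [Ioo_mem_nhds ht.1 ht.2] with s hs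
    exact fcoeff_eq_innerL2 (memLp_of_continuous (hu s (Ioo_subset_Icc_self hs))) i k

end EvolvesBy

/-- A bound almost everywhere on an interval of positive length extends to every point by
continuity. -/
theorem norm_le_of_ae_le {T M : ℝ} (hT : 0 < T) {f : ℝ → ℝ} (hf : ContinuousOn f (Icc 0 T))
    (h : ∀ᵐ t ∂(volume.restrict (Icc 0 T)), f t ≤ M) : ∀ t ∈ Icc 0 T, f t ≤ M := by
  have h1 : (fun t => max (f t) M) =ᵐ[volume.restrict (Icc 0 T)] fun _ => M := by
    filter_upwards [h] with t ht
    exact max_eq_right ht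
  intro t ht
  have h2 := Measure.eqOn_Icc_of_ae_eq volume hT.ne h1 (hf.sup continuousOn_const)
    continuousOn_const ht
  exact (le_max_left _ _).trans h2.le

theorem norm_le_of_coefNormSq_le {τ ρ r K : ℝ} (hr : 0 ≤ r) (hρ : ρ ≤ τ) {u : Coef} (h0 : u 0 = 0)
    (h : coefNormSq τ r u ≤ ENNReal.ofReal K) (k : Freq) :
    ‖u k‖ ≤ Real.sqrt (max K 0) * Real.exp (-ρ * freqNorm k) := by
  by_cases hk : k = 0
  · rw [hk, h0, norm_zero]; positivity
  have hn := freqNorm_pos hk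
  have h1 := (ENNReal.le_tsum k).trans h
  replace h1 := h1.trans (ENNReal.ofReal_le_ofReal (le_max_left K 0))
  rw [ENNReal.ofReal_le_ofReal_iff (le_max_right _ _)] at h1
  have h2 := norm_sq_le_sum (u k)
  have h3 : Real.exp (2 * ρ * freqNorm k) ≤
      1 + freqNorm k ^ (2 * r) * Real.exp (2 * τ * freqNorm k) := by
    have h4 : Real.exp (2 * ρ * freqNorm k) ≤ Real.exp (2 * τ * freqNorm k) := by gcongr
    have h5 := Real.one_le_rpow (one_le_freqNorm hk) (show 0 ≤ 2 * r by positivity)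
    have h6 := le_mul_of_one_le_left (Real.exp_pos (2 * τ * freqNorm k)).le h5
    linarith
  have h4 : (Real.exp (ρ * freqNorm k) * ‖u k‖) ^ 2 ≤ max K 0 := by
    calc _ = Real.exp (2 * ρ * freqNorm k) * ‖u k‖ ^ 2 := by
          rw [mul_pow, ← Real.exp_nat_mul]; congr 2; push_cast; ring
      _ ≤ _ := mul_le_mul h3 h2 (by positivity) (by positivity)
      _ ≤ _ := h1
  have h5 := Real.le_sqrt_of_sq_le h4
  rw [neg_mul, Real.exp_neg, ← div_eq_mul_inv, le_div_iff₀ (Real.exp_pos _), mul_comm]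
  exact h5

/-- The essential bound in the class controls each mode for almost every time; continuity of the
modes promotes it to every time, with one constant for all frequencies. -/
theorem InAnalyticClass.exists_bound {r T ρ : ℝ} {τ : ℝ → ℝ} {u : ℝ → VField} (hr : 0 ≤ r)
    (hT : 0 < T) (hτ : ∀ t ∈ Icc 0 T, ρ ≤ τ t) (h : InAnalyticClass r T τ u)
    (h0 : ∀ t ∈ Icc 0 T, fieldCoef (u t) 0 = 0)
    (hc : ∀ k, ContinuousOn (fun t => fieldCoef (u t) k) (Icc 0 T)) :
    ∃ K, 0 ≤ K ∧ ∀ t ∈ Icc 0 T, ∀ k, ‖fieldCoef (u t) k‖ ≤ K * Real.exp (-ρ * freqNorm k) := by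
  obtain ⟨K, hK⟩ := h.1
  refine ⟨Real.sqrt (max K 0), Real.sqrt_nonneg _, fun t ht k => ?_⟩
  refine norm_le_of_ae_le hT (hc k).norm ?_ t ht
  filter_upwards [hK, ae_restrict_mem measurableSet_Icc] with t ht htI
  exact norm_le_of_coefNormSq_le hr (hτ t htI) (h0 t htI) ht k

theorem vRep_fieldCoef {v : VField} (hv : Continuous v) {ρ K : ℝ} (hρ : 0 < ρ)
    (h : ∀ k, ‖fieldCoef v k‖ ≤ K * Real.exp (-ρ * freqNorm k)) : VRep v (fieldCoef v) := fun i =>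
  Rep.of_continuous ((continuous_apply i).comp hv)
    ⟨ρ, K, hρ, fun k => (norm_le_pi_norm (fieldCoef v k) i).trans (h k)⟩

/-- The Fourier modes of an analytic solution of the primitive equations solve the mode system. -/
theorem IsSolution.exists_modeSolution {r Ω T ρ : ℝ} {τ : ℝ → ℝ} {vb₀ vt₀ : VField}
    {vb vt : ℝ → VField} (h : IsSolution Ω T vb₀ vt₀ vb vt) (hr : 0 ≤ r) (hT : 0 < T) (hρ : 0 < ρ)
    (hτ : ∀ t ∈ Icc 0 T, ρ ≤ τ t) (hb : InAnalyticClass r T τ vb) (ht : InAnalyticClass r T τ vt) :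
    ModeSolution Ω 0 T (fun t => fieldCoef (vb t) + fieldCoef (vt t)) ∧
      (∃ K, 0 ≤ K ∧ UniformDecay (Icc 0 T) ρ K fun t => fieldCoef (vb t) + fieldCoef (vt t)) ∧
      fieldCoef (vb 0) + fieldCoef (vt 0) = fieldCoef vb₀ + fieldCoef vt₀ ∧
      ∀ t ∈ Icc 0 T, VRep (vb t) (fieldCoef (vb t)) ∧ VRep (vt t) (fieldCoef (vt t)) := by
  have hcb := h.barotropic.continuousOn_fieldCoef hT.le h.cont_bar
  have hct := h.baroclinic.continuousOn_fieldCoef hT.le h.cont_tilde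
  obtain ⟨Kb, hKb, hb⟩ := hb.exists_bound hr hT hτ
    (fun t ht => funext fun i => fcoeff_mean_zero (h.modes t ht).memS_bar i) hcb
  obtain ⟨Kt, hKt, ht⟩ := ht.exists_bound hr hT hτ
    (fun t ht => funext fun i => fcoeff_mean_zero (h.modes t ht).memS_tilde i) hct
  have hRb : ∀ t ∈ Icc 0 T, VRep (vb t) (fieldCoef (vb t)) := fun t h' =>
    vRep_fieldCoef (h.cont_bar t h') hρ (hb t h')
  have hRt : ∀ t ∈ Icc 0 T, VRep (vt t) (fieldCoef (vt t)) := fun t h' =>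
    vRep_fieldCoef (h.cont_tilde t h') hρ (ht t h')
  have hcont : ∀ k, ContinuousOn (fun t => (fieldCoef (vb t) + fieldCoef (vt t)) k) (Icc 0 T) :=
    fun k => (hcb k).add (hct k)
  have hdecay : UniformDecay (Icc 0 T) ρ (Kb + Kt) fun t => fieldCoef (vb t) + fieldCoef (vt t) :=
    ⟨fun t h' => (h.modes t h').zero, fun t h' k => by
      refine (norm_add_le _ _).trans ?_
      rw [add_mul]
      exact add_le_add (hb t h' k) (ht t h' k)⟩
  -- With uniform decay available the force is continuous in time, so the integrated equations can
  -- be differentiated and the modes satisfy the system pointwise.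
  obtain ⟨hfc, -⟩ := hdecay.exists_modeForce_bound Ω hρ (by positivity) hcont
  refine ⟨⟨hcont, fun k t h' => ?_⟩, ⟨_, by positivity, hdecay⟩, ?_, fun t h' =>
    ⟨hRb t h', hRt t h'⟩⟩
  · have h1 := h.barotropic.hasDerivAt_fieldCoef h.cont_bar
      (d := fun t => barPart (modeForce Ω (fieldCoef (vb t) + fieldCoef (vt t))))
      (fun t h' => ((hRb t h').barotropicTerm (hRt t h') (h.modes t h').modeCoefs).congr_coef
        fun k => by
          by_cases hk : k 2 = 0
          · simp only [barPart, if_pos hk, modeForce_of_eq_zero _ _ hk]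
          · simp only [barPart, if_neg hk]) k
      (by
        by_cases hk : k 2 = 0
        · simpa only [barPart, if_pos hk] using hfc k
        · simpa only [barPart, if_neg hk] using continuousOn_const) h'
    have h2 := h.baroclinic.hasDerivAt_fieldCoef h.cont_tilde
      (d := fun t => tildePart (modeForce Ω (fieldCoef (vb t) + fieldCoef (vt t))))
      (fun t h' => (hRb t h').baroclinicTerm Ω (hRt t h') (h.modes t h').modeCoefs) k
      (by
        by_cases hk : k 2 = 0
        · simpa only [tildePart, if_pos hk] using continuousOn_const
        · simpa only [tildePart, if_neg hk] using hfc k) h'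
    refine (h1.add h2).congr_deriv ?_
    rw [← neg_add, ← Pi.add_apply (barPart _), barPart_add_tildePart, modeForce, neg_add']
  · have e1 : fieldCoef (vb 0) = fieldCoef vb₀ :=
      funext fun k => funext fun i => fcoeff_congr h.init_bar i k
    have e2 : fieldCoef (vt 0) = fieldCoef vt₀ :=
      funext fun k => funext fun i => fcoeff_congr h.init_tilde i k
    rw [e1, e2]


/-! ### Analytic data and analytic solutions -/

theorem tsum_weight_sq_le_coefNormSq (r τ : ℝ) (u : Coef) :
    ∑' k, (ENNReal.ofReal (weight r τ k) * ‖u k‖ₑ) ^ 2 ≤ coefNormSq τ r u := by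
  refine ENNReal.tsum_le_tsum fun k => ?_
  have hn := freqNorm_nonneg k
  rw [← ofReal_norm, ← ENNReal.ofReal_mul (weight_nonneg _ _ _), ← ENNReal.ofReal_pow
    (mul_nonneg (weight_nonneg _ _ _) (norm_nonneg _))]
  refine ENNReal.ofReal_le_ofReal ?_
  have h1 : weight r τ k ^ 2 = freqNorm k ^ (2 * r) * Real.exp (2 * τ * freqNorm k) := by
    rw [weight, mul_pow, ← Real.rpow_natCast, ← Real.rpow_mul hn, ← Real.exp_nat_mul]
    congr 2 <;> push_cast <;> ring
  rw [mul_pow, h1]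
  have h2 : 0 ≤ freqNorm k ^ (2 * r) * Real.exp (2 * τ * freqNorm k) := by positivity
  exact mul_le_mul (by linarith) (norm_sq_le_sum _) (by positivity) (by linarith)

theorem IsModePair.barPart_eq {vb vt : VField} (h : IsModePair vb vt) :
    barPart (fieldCoef vb + fieldCoef vt) = fieldCoef vb := by
  ext k i
  by_cases hk : k 2 = 0
  · simp [barPart, hk, h.modeCoefs.tilde k hk]
  · simp [barPart, hk, h.modeCoefs.bar k hk]

theorem IsModePair.tildePart_eq {vb vt : VField} (h : IsModePair vb vt) :
    tildePart (fieldCoef vb + fieldCoef vt) = fieldCoef vt := by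
  ext k i
  by_cases hk : k 2 = 0
  · simp [tildePart, hk, h.modeCoefs.tilde k hk]
  · simp [tildePart, hk, h.modeCoefs.bar k hk]

theorem fieldCoef_sub {u v : VField} (hu : MemLp u 2 vol3) (hv : MemLp v 2 vol3) :
    fieldCoef (u - v) = fieldCoef u - fieldCoef v :=
  funext fun k => funext fun i => fcoeff_sub hu hv i k

/-- Barotropic and baroclinic differences have disjoint frequencies, so their squared norms add up
to that of the combined family, to which the energy estimate applies. -/
theorem IsModePair.anormSq_sub_add {ub ut vb vt : VField} (hu : IsModePair ub ut)
    (hv : IsModePair vb vt) (τ s : ℝ) :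
    anormSq τ s (ub - vb) + anormSq τ s (ut - vt) =
      coefNormSq τ s (fieldCoef ub + fieldCoef ut - (fieldCoef vb + fieldCoef vt)) := by
  rw [anormSq_eq, anormSq_eq, fieldCoef_sub hu.memS_bar.memLp hv.memS_bar.memLp,
    fieldCoef_sub hu.memS_tilde.memLp hv.memS_tilde.memLp, ← coefNormSq_add_of_disjoint,
    add_sub_add_comm]
  · intro k hk
    simp [hu.modeCoefs.bar k hk, hv.modeCoefs.bar k hk]
  · intro k hk
    simp [hu.modeCoefs.tilde k hk, hv.modeCoefs.tilde k hk]

section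

variable {r τ₀ C : ℝ} {vb₀ vt₀ : VField}

theorem dataSize_nonneg (r τ₀ : ℝ) (vb₀ vt₀ : VField) : 0 ≤ dataSize r τ₀ vb₀ vt₀ := by
  unfold dataSize; positivity

theorem IsData.coefNormSq_eq (h : IsData r τ₀ vb₀ vt₀) :
    coefNormSq τ₀ r (fieldCoef vb₀ + fieldCoef vt₀) = ENNReal.ofReal (dataSize r τ₀ vb₀ vt₀) := by
  rw [dataSize, ENNReal.ofReal_add (by positivity) (by positivity),
    ENNReal.ofReal_toReal h.analytic_bar.2.ne, ENNReal.ofReal_toReal h.analytic_tilde.2.ne,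
    anormSq_eq, anormSq_eq]
  exact coefNormSq_add_of_disjoint h.modes.modeCoefs.bar h.modes.modeCoefs.tilde

theorem sqrt_le_one_add {E : ℝ} (hE : 0 ≤ E) : Real.sqrt E ≤ 1 + E := by
  rw [Real.sqrt_le_left (by positivity)]
  nlinarith

theorem existTime_pos {E : ℝ} (hC : 0 < C) (hτ : 0 < τ₀) (hE : 0 ≤ E) : 0 < existTime C τ₀ E := by
  unfold existTime; positivity

/-- The additional 1 in the denominator of the existence time keeps the radius strictly positive at
the final time, which supplies a uniform decay rate on the whole interval. -/
theorem two_mul_existTime_lt {E : ℝ} (hC : 0 < C) (hτ : 0 < τ₀) (hE : 0 ≤ E) :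
    2 * (C * (1 + E)) * existTime C τ₀ E < τ₀ := by
  have h1 := existTime_pos hC hτ hE
  have h2 : existTime C τ₀ E * (1 + 2 * C * (1 + E)) = τ₀ := by
    unfold existTime
    have : 0 < 1 + 2 * C * (1 + E) := by positivity
    field_simp
  nlinarith

theorem radius_eq (C τ₀ E t : ℝ) : radius C τ₀ E t = τ₀ - 2 * (C * (1 + E)) * t := by
  unfold radius; ring

theorem existTime_mono {τ₁ τ₂ E₁ E₂ : ℝ} (hC : 0 < C) (hτ : 0 ≤ τ₁) (hτ' : τ₁ ≤ τ₂) (hE : 0 ≤ E₂)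
    (hE' : E₂ ≤ E₁) : existTime C τ₁ E₁ ≤ existTime C τ₂ E₂ := by
  have := hτ.trans hτ'
  unfold existTime
  gcongr

theorem UniformDecay.mono_const {s : Set ℝ} {ρ K K' : ℝ} {c : ℝ → Coef} (h : UniformDecay s ρ K c)
    (hK : K ≤ K') : UniformDecay s ρ K' c :=
  ⟨h.zero, fun t ht k => (h.le t ht k).trans (by gcongr)⟩

/-- The constant `C` is large enough for the construction of mode solutions from analytic data. -/
def IsExistenceConstant (r C : ℝ) : Prop :=
  ∀ (τ₀ Ω : ℝ) (vb₀ vt₀ : VField), 0 < τ₀ → IsData r τ₀ vb₀ vt₀ →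
    ∃ (c : ℝ → Coef) (A : Freq → ℝ≥0∞),
      ModeSolution Ω 0 (existTime C τ₀ (dataSize r τ₀ vb₀ vt₀)) c ∧
      c 0 = fieldCoef vb₀ + fieldCoef vt₀ ∧
      (∀ t ∈ Icc 0 (existTime C τ₀ (dataSize r τ₀ vb₀ vt₀)),
        WeightedBound r (τ₀ - C * (1 + dataSize r τ₀ vb₀ vt₀) * t) (c t) A) ∧
      ∑' k, A k ^ 2 ≤ ENNReal.ofReal ((4 * Real.sqrt (dataSize r τ₀ vb₀ vt₀)) ^ 2) ∧
      ∀ t ∈ Icc 0 (existTime C τ₀ (dataSize r τ₀ vb₀ vt₀)), DivFree (c t)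

theorem exists_isExistenceConstant (hr : 5 / 2 < r) :
    ∃ C₀, 0 < C₀ ∧ ∀ C, C₀ ≤ C → IsExistenceConstant r C := by
  obtain ⟨C₀, hC₀, h⟩ := exists_modeSolution hr
  refine ⟨C₀, hC₀, fun C hC τ₀ Ω vb₀ vt₀ hτ hdata => ?_⟩
  have hE := dataSize_nonneg r τ₀ vb₀ vt₀
  have hC0 : 0 < C := hC₀.trans_le hC
  have h1 := existTime_pos hC0 hτ hE
  have h2 := two_mul_existTime_lt hC0 hτ hE
  set E := dataSize r τ₀ vb₀ vt₀ with hEdef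
  have hL : 0 < C * (1 + E) := by positivity
  refine h (C * (1 + E)) (existTime C τ₀ E) τ₀ Ω _ (Real.sqrt E) hL h1.le (by nlinarith)
    hdata.modes.zero hdata.modes.divFree (Real.sqrt_nonneg _) ?_ ?_
  · rw [Real.sq_sqrt hE, hEdef, ← hdata.coefNormSq_eq]
    exact tsum_weight_sq_le_coefNormSq _ _ _
  -- The construction needs a slope proportional to √E; the inequality √E ≤ 1 + E converts it to the
  -- form in the theorem.
  · exact mul_le_mul hC (sqrt_le_one_add hE) (Real.sqrt_nonneg _) hC0.le

variable {Ω : ℝ}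

theorem WeightedBound.uniformDecay {L T e : ℝ} {c : ℝ → Coef} {A : Freq → ℝ≥0∞} (hr : 0 ≤ r)
    (hL : 0 ≤ L) (h : ∀ t ∈ Icc 0 T, WeightedBound r (τ₀ - L * t) (c t) A) (he : 0 ≤ e)
    (hA : ∑' k, A k ^ 2 ≤ ENNReal.ofReal (e ^ 2)) :
    UniformDecay (Icc 0 T) (τ₀ - 2 * L * T) e c := by
  refine ⟨fun t ht => (h t ht).zero, fun t ht k => ((h t ht).norm_le hr he hA k).trans ?_⟩
  have h1 : τ₀ - 2 * L * T ≤ τ₀ - L * t := by nlinarith [ht.1, ht.2]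
  have := freqNorm_nonneg k
  gcongr

/-- The modes are constructed with slope C(1+E), while the class asks only for the radius of slope
2C(1+E). The gap gives both parts of the class, and the positive final radius makes the Fourier
synthesis smooth enough to be a solution. -/
theorem exists_isAnalyticSolution (hr : 0 ≤ r) (hC : 0 < C) (hCr : IsExistenceConstant r C)
    (hτ : 0 < τ₀) (hdata : IsData r τ₀ vb₀ vt₀) (Ω : ℝ) :
    ∃ vb vt : ℝ → VField, IsAnalyticSolution C r Ω τ₀ vb₀ vt₀ vb vt := by
  obtain ⟨c, A, hc, hc0, hcA, hA, hdiv⟩ := hCr τ₀ Ω vb₀ vt₀ hτ hdata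
  have hE := dataSize_nonneg r τ₀ vb₀ vt₀
  have hT := existTime_pos hC hτ hE
  have hlt := two_mul_existTime_lt hC hτ hE
  set E := dataSize r τ₀ vb₀ vt₀ with hEdef
  set T := existTime C τ₀ E with hTdef
  have hL : 0 < C * (1 + E) := by positivity
  have hρ : 0 < τ₀ - 2 * (C * (1 + E)) * T := by linarith
  have hd := WeightedBound.uniformDecay hr hL.le hcA (by positivity) hA
  have hsol := hc.isSolution hT.le hρ (by positivity) hd hdiv hdata.modes hc0
  have hAt := (hA.trans_lt ENNReal.ofReal_lt_top).ne
  have hconj := hc.conjCoef_eq hρ (by positivity) hd (by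
    ext k i
    have := fieldCoef_conj vb₀ vt₀ (-k) i
    rw [neg_neg] at this
    rw [hc0, this]
    rfl)
  refine ⟨_, _, hsol, ?_, ?_⟩
  · refine inAnalyticClass_of_weightedBound hr hL hT.le hρ.le (c := fun t => barPart (c t)) hAt
      (fun t ht => (vRep_synth hρ (fun k => (norm_barPart_le _ k).trans (hd.le t ht k))
        (conjCoef_barPart (hconj t ht))).fieldCoef_eq) (fun t ht => ⟨?_, fun k => ?_⟩)
      fun t => by rw [radius_eq]; ring
    · simp [barPart, (hcA t ht).zero]
    · refine le_trans (mul_le_mul_right ?_ _) ((hcA t ht).le k)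
      exact enorm_le_iff_norm_le.mpr (norm_barPart_le _ k)
  · refine inAnalyticClass_of_weightedBound hr hL hT.le hρ.le (c := fun t => tildePart (c t)) hAt
      (fun t ht => (vRep_synth hρ (fun k => (norm_tildePart_le _ k).trans (hd.le t ht k))
        (conjCoef_tildePart (hconj t ht))).fieldCoef_eq) (fun t ht => ⟨?_, fun k => ?_⟩)
      fun t => by rw [radius_eq]; ring
    · simp [tildePart]
    · refine le_trans (mul_le_mul_right ?_ _) ((hcA t ht).le k)
      exact enorm_le_iff_norm_le.mpr (norm_tildePart_le _ k)

/-! ### Identification of arbitrary analytic solutions -/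

namespace IsAnalyticSolution

variable {vb vt vb' vt' : ℝ → VField}

theorem exists_modeSolution (h : IsAnalyticSolution C r Ω τ₀ vb₀ vt₀ vb vt) (hr : 0 ≤ r)
    (hC : 0 < C) (hτ : 0 < τ₀) :
    ModeSolution Ω 0 (existTime C τ₀ (dataSize r τ₀ vb₀ vt₀))
        (fun t => fieldCoef (vb t) + fieldCoef (vt t)) ∧
      (∃ K, 0 ≤ K ∧ UniformDecay (Icc 0 (existTime C τ₀ (dataSize r τ₀ vb₀ vt₀)))
        (τ₀ - 2 * (C * (1 + dataSize r τ₀ vb₀ vt₀)) * existTime C τ₀ (dataSize r τ₀ vb₀ vt₀)) K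
        fun t => fieldCoef (vb t) + fieldCoef (vt t)) ∧
      fieldCoef (vb 0) + fieldCoef (vt 0) = fieldCoef vb₀ + fieldCoef vt₀ ∧
      ∀ t ∈ Icc 0 (existTime C τ₀ (dataSize r τ₀ vb₀ vt₀)),
        VRep (vb t) (fieldCoef (vb t)) ∧ VRep (vt t) (fieldCoef (vt t)) := by
  have hE := dataSize_nonneg r τ₀ vb₀ vt₀
  have hlt := two_mul_existTime_lt hC hτ hE
  refine h.solves.exists_modeSolution hr (existTime_pos hC hτ hE) (by linarith) (fun t ht => ?_)
    h.class_bar h.class_tilde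
  rw [radius_eq]
  have := ht.2
  gcongr

/-- Equality holds at every point and not merely almost everywhere, because both fields are the sums
of the same absolutely convergent Fourier series. -/
theorem unique (h : IsAnalyticSolution C r Ω τ₀ vb₀ vt₀ vb vt)
    (h' : IsAnalyticSolution C r Ω τ₀ vb₀ vt₀ vb' vt') (hr : 0 ≤ r) (hC : 0 < C) (hτ : 0 < τ₀) :
    ∀ t ∈ Icc 0 (existTime C τ₀ (dataSize r τ₀ vb₀ vt₀)), vb t = vb' t ∧ vt t = vt' t := by
  intro t ht
  obtain ⟨hm, ⟨K, hK0, hK⟩, h0, hR⟩ := h.exists_modeSolution hr hC hτ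
  obtain ⟨hm', ⟨K', hK0', hK'⟩, h0', hR'⟩ := h'.exists_modeSolution hr hC hτ
  have hlt := two_mul_existTime_lt hC hτ (dataSize_nonneg r τ₀ vb₀ vt₀)
  have heq := modeSolution_unique (by linarith) (le_max_of_le_left hK0) hm hm'
    (hK.mono_const (le_max_left K K')) (hK'.mono_const (le_max_right K K')) (h0.trans h0'.symm) t ht
  have hmp := h.solves.modes t ht
  have hmp' := h'.solves.modes t ht
  have hb : fieldCoef (vb t) = fieldCoef (vb' t) := by
    rw [← hmp.barPart_eq, heq, hmp'.barPart_eq]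
  have ht' : fieldCoef (vt t) = fieldCoef (vt' t) := by
    rw [← hmp.tildePart_eq, heq, hmp'.tildePart_eq]
  refine ⟨funext fun x => funext fun i => ?_, funext fun x => funext fun i => ?_⟩
  · exact congrFun (Rep.ext ((hR t ht).1 i) (by rw [hb]; exact (hR' t ht).1 i)) x
  · exact congrFun (Rep.ext ((hR t ht).2 i) (by rw [ht']; exact (hR' t ht).2 i)) x

/-- The class itself offers no frequency-wise majorant uniform in time, nor a quantitative bound.
Both are inherited from the constructed solution, with which the given one coincides by uniqueness.
-/
theorem exists_weightedBound (h : IsAnalyticSolution C r Ω τ₀ vb₀ vt₀ vb vt) (hr : 0 ≤ r)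
    (hC : 0 < C) (hCr : IsExistenceConstant r C) (hτ : 0 < τ₀) (hdata : IsData r τ₀ vb₀ vt₀) :
    ∃ A : Freq → ℝ≥0∞,
      ∑' k, A k ^ 2 ≤ ENNReal.ofReal ((4 * Real.sqrt (dataSize r τ₀ vb₀ vt₀)) ^ 2) ∧
      ∀ t ∈ Icc 0 (existTime C τ₀ (dataSize r τ₀ vb₀ vt₀)),
        WeightedBound r (τ₀ - C * (1 + dataSize r τ₀ vb₀ vt₀) * t)
          (fieldCoef (vb t) + fieldCoef (vt t)) A := by
  obtain ⟨c, A, hc, hc0, hcA, hA, -⟩ := hCr τ₀ Ω vb₀ vt₀ hτ hdata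
  obtain ⟨hm, ⟨K, hK0, hK⟩, h0, -⟩ := h.exists_modeSolution hr hC hτ
  have hE := dataSize_nonneg r τ₀ vb₀ vt₀
  have hlt := two_mul_existTime_lt hC hτ hE
  have hd := WeightedBound.uniformDecay hr (by positivity) hcA (by positivity) hA
  have heq := modeSolution_unique (by linarith) (le_max_of_le_left hK0) hm hc
    (hK.mono_const (le_max_left K _)) (hd.mono_const (le_max_right K _)) (h0.trans hc0.symm)
  refine ⟨A, hA, fun t ht => ?_⟩
  have := hcA t ht
  rwa [← heq t ht] at this

end IsAnalyticSolution

end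

end InviscidPE

/-! ### The theorem -/

theorem theorem3p1 (r : ℝ) (hr : 5 / 2 < r) :
    ∃ C : ℝ, 0 < C ∧
      -- existence and uniqueness
      (∀ (τ₀ : ℝ) (vb₀ vt₀ : VField), 0 < τ₀ → IsData r τ₀ vb₀ vt₀ →
        0 < existTime C τ₀ (dataSize r τ₀ vb₀ vt₀) ∧
        ∀ Ω : ℝ,
          (∃ vb vt : ℝ → VField, IsAnalyticSolution C r Ω τ₀ vb₀ vt₀ vb vt) ∧
          (∀ vb vt vb' vt' : ℝ → VField,
            IsAnalyticSolution C r Ω τ₀ vb₀ vt₀ vb vt →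
            IsAnalyticSolution C r Ω τ₀ vb₀ vt₀ vb' vt' →
            ∀ t ∈ Set.Icc 0 (existTime C τ₀ (dataSize r τ₀ vb₀ vt₀)),
              vb t = vb' t ∧ vt t = vt' t)) ∧
      -- continuous dependence on the initial data
      (∀ (Ω τ₁ τ₂ : ℝ) (vb₁₀ vt₁₀ vb₂₀ vt₂₀ : VField) (vb₁ vt₁ vb₂ vt₂ : ℝ → VField),
        0 < τ₁ → 0 < τ₂ → IsData r τ₁ vb₁₀ vt₁₀ → IsData r τ₂ vb₂₀ vt₂₀ →
        IsAnalyticSolution C r Ω τ₁ vb₁₀ vt₁₀ vb₁ vt₁ →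
        IsAnalyticSolution C r Ω τ₂ vb₂₀ vt₂₀ vb₂ vt₂ →
        ∀ t ∈ Set.Icc 0 (existTime C (min τ₁ τ₂)
            (max (dataSize r τ₁ vb₁₀ vt₁₀) (dataSize r τ₂ vb₂₀ vt₂₀))),
          anormSq (radius C (min τ₁ τ₂)
              (max (dataSize r τ₁ vb₁₀ vt₁₀) (dataSize r τ₂ vb₂₀ vt₂₀)) t)
              (r - 1 / 2) (vb₁ t - vb₂ t) +
            anormSq (radius C (min τ₁ τ₂)
              (max (dataSize r τ₁ vb₁₀ vt₁₀) (dataSize r τ₂ vb₂₀ vt₂₀)) t)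
              (r - 1 / 2) (vt₁ t - vt₂ t) ≤
          anormSq (min τ₁ τ₂) (r - 1 / 2) (vb₁₀ - vb₂₀) +
            anormSq (min τ₁ τ₂) (r - 1 / 2) (vt₁₀ - vt₂₀)) := by
  obtain ⟨C₁, hC₁, h₁⟩ := exists_isExistenceConstant hr
  obtain ⟨C₂, hC₂, h₂⟩ := exists_energy_bound hr
  have hr0 : 0 ≤ r := by linarith
  -- C₁ serves the construction and C₂ the energy estimate; the factor 4 comes from the bound 4√E on
  -- the majorants.
  have hC : 0 < C₁ + 4 * C₂ := by positivity
  have hCr := h₁ (C₁ + 4 * C₂) (by linarith)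
  have hC₂C : 4 * C₂ ≤ C₁ + 4 * C₂ := by linarith
  generalize C₁ + 4 * C₂ = C at hC hCr hC₂C
  refine ⟨C, hC, fun τ₀ vb₀ vt₀ hτ hdata => ⟨existTime_pos hC hτ (dataSize_nonneg _ _ _ _),
    fun Ω => ⟨exists_isAnalyticSolution hr0 hC hCr hτ hdata Ω, fun vb vt vb' vt' h h' =>
      h.unique h' hr0 hC hτ⟩⟩, ?_⟩
  intro Ω τ₁ τ₂ vb₁₀ vt₁₀ vb₂₀ vt₂₀ vb₁ vt₁ vb₂ vt₂ hτ₁ hτ₂ hd₁ hd₂ h₁ h₂' t ht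
  obtain ⟨A, hA, hWA⟩ := h₁.exists_weightedBound hr0 hC hCr hτ₁ hd₁
  obtain ⟨B, hB, hWB⟩ := h₂'.exists_weightedBound hr0 hC hCr hτ₂ hd₂
  obtain ⟨hm₁, -, h0₁, -⟩ := h₁.exists_modeSolution hr0 hC hτ₁
  obtain ⟨hm₂, -, h0₂, -⟩ := h₂'.exists_modeSolution hr0 hC hτ₂
  have hmodes₁ := h₁.solves.modes
  have hmodes₂ := h₂'.solves.modes
  have hE₁ := dataSize_nonneg r τ₁ vb₁₀ vt₁₀
  have hE₂ := dataSize_nonneg r τ₂ vb₂₀ vt₂₀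
  generalize dataSize r τ₁ vb₁₀ vt₁₀ = E₁ at *
  generalize dataSize r τ₂ vb₂₀ vt₂₀ = E₂ at *
  have hτ := lt_min hτ₁ hτ₂
  have hM : 0 ≤ max E₁ E₂ := le_max_of_le_left hE₁
  have hT₁ := existTime_mono hC hτ.le (min_le_left τ₁ τ₂) hE₁ (le_max_left E₁ E₂)
  have hT₂ := existTime_mono hC hτ.le (min_le_right τ₁ τ₂) hE₂ (le_max_right E₁ E₂)
  have hlt := two_mul_existTime_lt hC hτ hM
  -- The radius used for the difference lies below the radius at which each solution was
  -- constructed, so the majorants of both remain valid for it.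
  have hle : ∀ {τ E s : ℝ}, min τ₁ τ₂ ≤ τ → 0 ≤ E → E ≤ max E₁ E₂ → 0 ≤ s →
      min τ₁ τ₂ - 2 * (C * (1 + max E₁ E₂)) * s ≤ τ - C * (1 + E) * s := by
    intro τ E s hτ' hE hEM hs
    have h1 : C * (1 + E) * s ≤ C * (1 + max E₁ E₂) * s := by gcongr
    have h2 : 0 ≤ C * (1 + max E₁ E₂) * s := by positivity
    linarith
  have key := h₂ Ω 0 (existTime C (min τ₁ τ₂) (max E₁ E₂)) (min τ₁ τ₂)
    (2 * (C * (1 + max E₁ E₂))) _ _ A B _ _ (hm₁.mono le_rfl hT₁) (hm₂.mono le_rfl hT₂)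
    (fun s hs => by
      have : 2 * (C * (1 + max E₁ E₂)) * s ≤
          2 * (C * (1 + max E₁ E₂)) * existTime C (min τ₁ τ₂) (max E₁ E₂) := by
        have := hs.2
        gcongr
      linarith)
    (fun s hs => (hWA s ⟨hs.1, hs.2.trans hT₁⟩).mono
      (hle (min_le_left _ _) hE₁ (le_max_left _ _) hs.1))
    (fun s hs => (hWB s ⟨hs.1, hs.2.trans hT₂⟩).mono
      (hle (min_le_right _ _) hE₂ (le_max_right _ _) hs.1))
    -- The slope condition: C₂(4√E₁ + 4√E₂) ≤ 2C(1 + M), by √Eᵢ ≤ 1 + Eᵢ ≤ 1 + M and 4C₂ ≤ C.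
    (by positivity) (by positivity) hA hB (by
      have e₁ := (sqrt_le_one_add hE₁).trans (add_le_add_right (le_max_left E₁ E₂) 1)
      have e₂ := (sqrt_le_one_add hE₂).trans (add_le_add_right (le_max_right E₁ E₂) 1)
      calc C₂ * (4 * Real.sqrt E₁ + 4 * Real.sqrt E₂) =
            4 * C₂ * (Real.sqrt E₁ + Real.sqrt E₂) := by ring
        _ ≤ C * ((1 + max E₁ E₂) + (1 + max E₁ E₂)) := by gcongr
        _ = _ := by ring) t ht
  rw [mul_zero, sub_zero, h0₁, h0₂] at key
  rw [radius_eq, (hmodes₁ t ⟨ht.1, ht.2.trans hT₁⟩).anormSq_sub_add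
    (hmodes₂ t ⟨ht.1, ht.2.trans hT₂⟩), hd₁.modes.anormSq_sub_add hd₂.modes]
  exact key
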